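/- **Conventions.** A tensor category is a symmetric monoidal category with unit $\mathcal O$; a tensor functor is a strong symmetric monoidal functor; morphisms of tensor functors are monoidal natural transformations. A *locally finitely presentable (lfp) tensor category* is a tensor category whose underlying category is locally finitely presentable (in particular cocomplete), such that $\otimes$ preserves colimits in each variable and finitely presentable (fp) objects are closed under finite tensor products (including the unit). An *idal* is a morphism $e : I \to \mathcal O$ with $e \otimes I = I \otimes e : I \otimes I \to I$ (up to unit isomorphisms); morphisms of idals are morphisms over $\mathcal O$; the product of two idals is $I \otimes J \to \mathcal O\otimes\mathcal O\cong\mathcal O$; tensor functors map idals to idals. An idal is fp if $I$ is. Two idals $I_1,I_2$ form an *idal cover* if $\mathcal O$ is the pushout of $I_1 \leftarrow I_1 \otimes I_2 \to I_2$ via $I_1 \to \mathcal O \leftarrow I_2$. For an fp idal $I$ of an lfp tensor category $C$ let $C_I \subseteq C$ be the full reflective subcategory of those $M$ for which $M \to \mathrm{HOM}(I,M)$ is an isomorphism, i.e. $\mathrm{Hom}(X,M) \to \mathrm{Hom}(X \otimes I,M)$ is bijective for all $X$. It is a tensor category with unit $R_I(\mathcal O)$ and tensor product $R_I(M \otimes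 N)$, such that the reflector $R_I : C \to C_I$ is a cocontinuous tensor functor, which is universal among those mapping $I \to \mathcal O$ to an isomorphism: if a cocontinuous tensor functor $F : C \to E$ inverts $I\to\mathcal O$, then so is $F|_{C_I} : C_I \to E$, and $F \cong F|_{C_I} \circ R_I$. If $f : I \to I'$ is a morphism of fp idals, let $f^* : C_{I'} \to C_I$ be the restriction of $R_I$; thus $R_I \cong f^* R_{I'}$. **Local data.** Let $C,D$ be lfp tensor categories and let $I_1,I_2$ be an fp idal cover of $C$. Let $\mathrm{Hom}_{c\otimes fp}(C,D)$ be the category of cocontinuous tensor functors $C \to D$ preserving fp objects. Let $\mathrm{Hom}^{I_1,I_2}_{c\otimes fp}(C,D)$ be the following category. Objects are tuples $(J_1,J_2,H_1,H_2,\pi_1,\pi_2,\delta)$ consisting of 1. an fp idal cover $J_1,J_2$ of $D$; 2. cocontinuous tensor functors $H_i : C_{I_i} \to D_{J_i}$ preserving fp objects ($i=1,2$); 3. isomorphisms of idals $\pi_1 : R_{J_1}J_2 \cong H_1(R_{I_1}I_2)$ in $D_{J_1}$ and $\pi_2 : R_{J_2}J_1 \cong H_2(R_{I_2}I_1)$ in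 $D_{J_2}$; 4. an isomorphism of tensor functors $\delta : \widetilde H_1 \cong \widetilde H_2$, where $\widetilde H_i : C_{I_1 \otimes I_2} \to D_{J_1 \otimes J_2}$ is the functor induced by $H_i$, i.e. the restriction to $C_{I_1\otimes I_2}$ of the composition $C \xrightarrow{R_{I_i}} C_{I_i} \xrightarrow{H_i} D_{J_i} \to D_{J_1 \otimes J_2}$ (the last functor is the restriction of $R_{J_1\otimes J_2}$), which inverts $I_1 \otimes I_2$ because of $\pi_i$. A morphism to $(J'_1,J'_2,H'_1,H'_2,\pi'_1,\pi'_2,\delta')$ consists of morphisms of idals $f_i : J_i \to J'_i$ and morphisms of tensor functors $\eta_i : H_i \to f_i^* H'_i$ ($i=1,2$) such that * for $\{i,j\}=\{1,2\}$, the morphism $\eta_i(R_{I_i}I_j) \circ \pi_i$ equals the composition $R_{J_i}J_j \xrightarrow{R_{J_i}f_j} R_{J_i}J'_j \cong f_i^* R_{J'_i}J'_j \xrightarrow{f_i^*\pi'_i} f_i^* H'_i(R_{I_i}I_j)$; * $\widetilde\eta_2 \circ \delta = (f_1 \otimes f_2)^*\delta' \circ \widetilde\eta_1$, where $\widetilde\eta_i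 : \widetilde H_i \to (f_1 \otimes f_2)^* \widetilde H'_i$ is induced by $\eta_i$. Morphisms are composed via $f^* f'^* \cong (f' f)^*$. There is a canonical functor $\mathrm{Hom}_{c\otimes fp}(C,D) \to \mathrm{Hom}^{I_1,I_2}_{c\otimes fp}(C,D)$. It maps $H$ to the datum with $J_i = H(I_i)$ and $H_i : C_{I_i} \to D_{J_i}$ the restriction of $R_{J_i}H$, with $\pi_i$ the component at $I_j$ ($j \neq i$) of the canonical isomorphism $R_{J_i}H \cong H_i R_{I_i}$, and with $\delta$ the isomorphism that arises from the canonical isomorphisms of both compositions $C \to C_{I_i} \to D_{J_i} \to D_{J_1 \otimes J_2}$ with $R_{J_1\otimes J_2}H$. It maps $\eta : H \to H'$ to $f_i = \eta(I_i)$ and $\eta_i : R_{J_i}H|_{C_{I_i}} \to R_{J_i}H'|_{C_{I_i}} \cong f_i^* R_{J'_i} H'|_{C_{I_i}}$. **Theorem.** Let $C$ and $D$ be lfp tensor categories and let $I_1,I_2$ be an fp idal cover of $C$. Then this functor is an equivalence of categories $$\mathrm{Hom}_{c\otimes fp}(C,D) \;\simeq\; \mathrm{Hom}^{I_1,I_2}_{c\otimes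 fp}(C,D).$$ Moreover, if $K$ is a commutative ring and $C,D$ are $K$-linear tensor categories (i.e. $K$-linear categories with $\otimes$ $K$-linear in each variable), then it restricts to an equivalence between the full subcategory of $K$-linear functors $C \to D$ and the full subcategory of local data with $K$-linear $H_1,H_2$. -/

import Mathlib

open CategoryTheory Limits MonoidalCategory

universe v u u₁ u₂ w

namespace TensorLoc

/-- A locally finitely presentable tensor category: a symmetric monoidal category whose underlying
category is locally finitely presentable (in particular cocomplete), whose tensor product preserves
colimits in each variable, and whose finitely presentable objects are closed under finite tensor
products (including the empty one, the unit). -/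
class LFPTensorCategory (C : Type u) [Category.{v} C] [MonoidalCategory C] [SymmetricCategory C] :
    Prop where
  locallyFinitelyPresentable : IsLocallyFinitelyPresentable.{v} C
  tensorLeft_cocontinuous : ∀ X : C, PreservesColimitsOfSize.{v, v} (tensorLeft X)
  tensorRight_cocontinuous : ∀ X : C, PreservesColimitsOfSize.{v, v} (tensorRight X)
  unit_fp : IsFinitelyPresentable.{v} (𝟙_ C)
  tensor_fp : ∀ X Y : C, IsFinitelyPresentable.{v} X → IsFinitelyPresentable.{v} Y →
    IsFinitelyPresentable.{v} (X ⊗ Y)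

section Idals

variable {C : Type u₁} [Category.{v} C] [MonoidalCategory C]
  {D : Type u₂} [Category.{v} D] [MonoidalCategory D]

variable (C) in
/-- An idal: a morphism `e : I ⟶ 𝟙` with `e ⊗ I = I ⊗ e` (up to the unit isomorphisms). -/
structure Idal where
  obj : C
  hom : obj ⟶ 𝟙_ C
  comm : (hom ▷ obj) ≫ (λ_ obj).hom = (obj ◁ hom) ≫ (ρ_ obj).hom

namespace Idal

/-- Morphisms of idals are the morphisms over the unit. -/
@[ext]
structure Hom (I J : Idal C) where
  hom : I.obj ⟶ J.obj
  w : hom ≫ J.hom = I.hom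

@[simps]
instance : Category (Idal C) where
  Hom I J := Hom I J
  id I := ⟨𝟙 _, by simp⟩
  comp f g := ⟨f.hom ≫ g.hom, by simp [f.w, g.w]⟩

/-- The image of an idal under a tensor functor. -/
def map (F : C ⥤ D) [F.Monoidal] (I : Idal C) : Idal D where
  obj := F.obj I.obj
  hom := F.map I.hom ≫ Functor.OplaxMonoidal.η F
  comm := by
    have h := congrArg F.map I.comm
    rw [F.map_comp, F.map_comp, Functor.Monoidal.map_whiskerRight,
      Functor.Monoidal.map_whiskerLeft, Functor.Monoidal.map_leftUnitor,
      Functor.Monoidal.map_rightUnitor] at h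
    simpa using congrArg (fun f => Functor.LaxMonoidal.μ F I.obj I.obj ≫ f) h

/-- The idal product `I ⊗ J ⟶ 𝟙 ⊗ 𝟙 ≅ 𝟙`. -/
def tensor [SymmetricCategory C] (I J : Idal C) : Idal C where
  obj := I.obj ⊗ J.obj
  hom := (I.hom ⊗ₘ J.hom) ≫ (λ_ (𝟙_ C)).hom
  comm := by
    have h₁ : ((I.hom ⊗ₘ J.hom) ≫ (λ_ (𝟙_ C)).hom) ▷ (I.obj ⊗ J.obj) ≫ (λ_ _).hom =
        tensorμ I.obj J.obj I.obj J.obj ≫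
          ((I.hom ▷ I.obj ≫ (λ_ _).hom) ⊗ₘ (J.hom ▷ J.obj ≫ (λ_ _).hom)) := by
      rw [tensor_left_unitality, comp_whiskerRight, Category.assoc,
        ← comp_whiskerRight_assoc (λ_ (𝟙_ C)).hom, Iso.hom_inv_id, id_whiskerRight,
        Category.id_comp, ← tensorHom_comp_tensorHom, tensorμ_natural_left_assoc]
    have h₂ : (I.obj ⊗ J.obj) ◁ ((I.hom ⊗ₘ J.hom) ≫ (λ_ (𝟙_ C)).hom) ≫ (ρ_ _).hom =
        tensorμ I.obj J.obj I.obj J.obj ≫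
          ((I.obj ◁ I.hom ≫ (ρ_ _).hom) ⊗ₘ (J.obj ◁ J.hom ≫ (ρ_ _).hom)) := by
      rw [tensor_right_unitality, MonoidalCategory.whiskerLeft_comp, Category.assoc,
        ← MonoidalCategory.whiskerLeft_comp_assoc _ (λ_ (𝟙_ C)).hom, Iso.hom_inv_id,
        MonoidalCategory.whiskerLeft_id, Category.id_comp, ← tensorHom_comp_tensorHom,
        tensorμ_natural_right_assoc]
    rw [h₁, h₂, I.comm, J.comm]

end Idal

end Idals

section Local

variable {C : Type u₁} [Category.{v} C] [MonoidalCategory C]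

namespace Idal

/-- The morphism `X ⊗ e : X ⊗ I ⟶ X`. -/
def act (I : Idal C) (X : C) : X ⊗ I.obj ⟶ X := X ◁ I.hom ≫ (ρ_ X).hom

/-- The action of `I` as a natural transformation. -/
def actNat (I : Idal C) : tensorRight I.obj ⟶ 𝟭 C where
  app X := I.act X
  naturality X Y f := by
    change f ▷ I.obj ≫ Y ◁ I.hom ≫ (ρ_ Y).hom = (X ◁ I.hom ≫ (ρ_ X).hom) ≫ f
    rw [← whisker_exchange_assoc, rightUnitor_naturality, Category.assoc]

/-- The objects `M` for which `Hom(X, M) ⟶ Hom(X ⊗ I, M)` is bijective for all `X`, i.e. for which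
`M ⟶ HOM(I, M)` is an isomorphism, where `HOM` is the internal hom. -/
def isLocal (I : Idal C) : ObjectProperty C :=
  (MorphismProperty.ofHoms I.act).isLocal

/-- For fixed `M`, the class of all `X` such that `Hom(X, M) ⟶ Hom(X ⊗ I, M)` is bijective is
closed under colimits. -/
lemma bijective_of_isColimit (I : Idal C) (M : C) {A : Type v} [Category.{v} A]
    [PreservesColimitsOfShape A (tensorRight I.obj)]
    {F : A ⥤ C} {c : Cocone F} (hc : IsColimit c)
    (h : ∀ a, Function.Bijective (fun f : F.obj a ⟶ M => I.act (F.obj a) ≫ f)) :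
    Function.Bijective (fun f : c.pt ⟶ M => I.act c.pt ≫ f) := by
  have hc' := isColimitOfPreserves (tensorRight I.obj) hc
  have nat : ∀ {X Y : C} (f : X ⟶ Y), f ▷ I.obj ≫ I.act Y = I.act X ≫ f :=
    fun f => I.actNat.naturality f
  refine ⟨fun f g hfg => hc.hom_ext fun a => (h a).1 ?_, fun g => ?_⟩
  · dsimp at hfg ⊢
    rw [← Category.assoc, ← Category.assoc, ← nat, Category.assoc, Category.assoc, hfg]
  · choose φ hφ using fun a => (h a).2 (c.ι.app a ▷ I.obj ≫ g)
    refine ⟨hc.desc (Cocone.mk M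
      { app := φ
        naturality := fun a b f => (h a).1 ?_ }), hc'.hom_ext fun a => ?_⟩
    · dsimp at hφ ⊢
      rw [Category.comp_id, hφ, ← Category.assoc, ← nat, Category.assoc, hφ,
        ← comp_whiskerRight_assoc, c.w]
    · dsimp at hφ ⊢
      rw [← Category.assoc, nat, Category.assoc, hc.fac, hφ]

open Cardinal in
attribute [local instance] fact_isRegular_aleph0 in
/-- The local objects are the objects which are local for a small set of maps between finitely
presentable objects. -/
lemma exists_small [SymmetricCategory C] [LFPTensorCategory C] (I : Idal C)
    (hI : IsFinitelyPresentable.{v} I.obj) :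
    ∃ (W : MorphismProperty C) (_ : MorphismProperty.IsSmall.{v} W),
      W ≤ MorphismProperty.ofHoms I.act ∧ W.isLocal = I.isLocal ∧
      ∀ ⦃X Y : C⦄ (f : X ⟶ Y), W f → IsFinitelyPresentable.{v} X ∧ IsFinitelyPresentable.{v} Y := by
  have := LFPTensorCategory.locallyFinitelyPresentable (C := C)
  have := LFPTensorCategory.tensorRight_cocontinuous I.obj
  obtain ⟨P, _, hP⟩ := HasCardinalFilteredGenerator.exists_small_generator C ℵ₀
  have le : MorphismProperty.ofHoms (fun X : Subtype P => I.act X.1) ≤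
      MorphismProperty.ofHoms I.act := by
    rintro _ _ _ ⟨X⟩
    exact ⟨X.1⟩
  refine ⟨MorphismProperty.ofHoms (fun X : Subtype P => I.act X.1), inferInstance,
    le, le_antisymm ?_ ?_, ?_⟩
  · intro M hM X Y f hf
    have hf' : ∃ Z, Arrow.mk f = Arrow.mk (I.act Z) := (MorphismProperty.ofHoms_iff _ _).1 hf
    obtain ⟨Z, hZ⟩ := hf'
    obtain rfl : Y = Z := congrArg Comma.right hZ
    obtain rfl : X = _ := congrArg Comma.left hZ
    obtain rfl : f = I.act Y := (Arrow.mk_inj _ _).1 hZ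
    obtain ⟨A, _, _, ⟨p⟩⟩ := hP.exists_colimitsOfShape Y
    refine I.bijective_of_isColimit M p.isColimit fun a => ?_
    exact
      hM _ (MorphismProperty.ofHoms_iff _ _ |>.2 ⟨⟨_, p.prop_diag_obj a⟩, rfl⟩)
  · exact MorphismProperty.isLocal_antitone le
  · rintro _ _ _ ⟨X⟩
    have hX : IsFinitelyPresentable.{v} X.1 := hP.le_isCardinalPresentable _ X.2
    exact ⟨LFPTensorCategory.tensor_fp _ _ hX hI, hX⟩

end Idal

section Inverts

open OrthogonalReflection Cardinal

variable {C : Type u₁} [Category.{v} C] {E : Type u₂} [Category.{v} E]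

/-- The morphism of `W` underlying an index of the orthogonal reflection construction. -/
def d₁Hom {W : MorphismProperty C} {Z : C} (d : D₁ W Z) : D₁.obj₁ d ⟶ D₁.obj₂ d :=
  (Sigma.fst d).1.hom

lemma d₁Hom_mem {W : MorphismProperty C} {Z : C} (d : D₁ W Z) : W (d₁Hom d) :=
  (Sigma.fst d).2

attribute [local instance] essentiallySmall_of_small_of_locallySmall in
lemma isIso_map_toSucc [HasColimitsOfSize.{v, v} C]
    (F : C ⥤ E) [PreservesColimitsOfSize.{v, v} F]
    (W : MorphismProperty C) [MorphismProperty.IsSmall.{v} W]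
    [∀ Z, HasCoproduct (D₁.obj₁ (W := W) (Z := Z))]
    [∀ Z, HasCoproduct (D₁.obj₂ (W := W) (Z := Z))]
    [∀ Z, HasMulticoequalizer (D₂.multispanIndex W Z)]
    (hW : W.IsInvertedBy F) (Z : C)  :
    IsIso (F.map (toSucc W Z)) := by
  have : PreservesColimitsOfShape (Discrete (D₁ (W := W) (Z := Z))) F :=
    preservesColimitsOfShape_of_equiv
      (Discrete.equivalence (equivShrink.{v} (D₁ (W := W) (Z := Z))).symm) F
  have : PreservesColimitsOfShape (WalkingMultispan (D₂.multispanShape W Z)) F :=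
    preservesColimitsOfShape_of_equiv (equivSmallModel.{v} _).symm F
  have h₁ := isColimitOfPreserves F (colimit.isColimit (Discrete.functor (D₁.obj₁ (W := W) (Z := Z))))
  have h₂ := isColimitOfPreserves F (colimit.isColimit (Discrete.functor (D₁.obj₂ (W := W) (Z := Z))))
  have t_iso : IsIso (F.map (D₁.t W Z)) := by
    let e : Discrete.functor (D₁.obj₁ (W := W) (Z := Z)) ⋙ F ≅
        Discrete.functor (D₁.obj₂ (W := W) (Z := Z)) ⋙ F :=
      Discrete.natIso fun d =>
        have : IsIso (F.map (d₁Hom d.as)) := hW _ (d₁Hom_mem d.as)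
        (asIso (F.map (d₁Hom d.as)) : F.obj (D₁.obj₁ d.as) ≅ F.obj (D₁.obj₂ d.as))
    have : F.map (D₁.t W Z) = (h₁.coconePointsIsoOfNatIso h₂ e).hom := by
      refine h₁.hom_ext fun d => ?_
      rw [IsColimit.comp_coconePointsIsoOfNatIso_hom]
      have h : Sigma.ι _ d.as ≫ D₁.t W Z = d₁Hom d.as ≫ Sigma.ι D₁.obj₂ d.as :=
        D₁.ι_comp_t (W := W) (Z := Z) d.as
      have h := congrArg F.map h
      rw [F.map_comp, F.map_comp] at h
      exact h
    rw [this]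
    infer_instance
  have s_iso : IsIso (F.map (toStep W Z)) := by
    have := (IsPushout.of_hasPushout (D₁.t W Z) (D₁.l W Z)).map F
    exact MorphismProperty.of_isPushout (P := MorphismProperty.isomorphisms E) this.flip t_iso
  have f_iso : IsIso (F.map (fromStep W Z)) := by
    have hc := (Multicofork.isColimitMapEquiv _ F) (isColimitOfPreserves F
      (colimit.isColimit (D₂.multispanIndex W Z).multispan))
    let s : Multicofork ((D₂.multispanIndex W Z).map F) :=
      Multicofork.ofπ _ (F.obj (step W Z)) (fun _ => 𝟙 _) fun d => by
        have := hW _ d.1.2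
        have h := congrArg F.map d.2.2
        rw [F.map_comp, F.map_comp, cancel_epi] at h
        exact h =≫ 𝟙 _
    obtain ⟨r, hr⟩ : ∃ r : F.obj (succ W Z) ⟶ F.obj (step W Z),
        F.map (fromStep W Z) ≫ r = 𝟙 _ := ⟨hc.desc s, hc.fac s (.right .unit)⟩
    have : Epi (F.map (fromStep W Z)) :=
      ⟨fun _ _ hgh => Multicofork.IsColimit.hom_ext hc fun _ => hgh⟩
    have : IsSplitMono (F.map (fromStep W Z)) := ⟨⟨⟨r, hr⟩⟩⟩
    exact isIso_of_epi_of_isSplitMono _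
  rw [F.map_comp]
  infer_instance

attribute [local instance] fact_isRegular_aleph0 in
lemma isIso_map_reflection [HasColimitsOfSize.{v, v} C]
    (F : C ⥤ E) [PreservesColimitsOfSize.{v, v} F]
    (W : MorphismProperty C) [MorphismProperty.IsSmall.{v} W] [LocallySmall.{v} C]
    (hW : W.IsInvertedBy F)
    (hW' : ∀ ⦃X Y : C⦄ (f : X ⟶ Y), W f →
      IsFinitelyPresentable.{v} X ∧ IsFinitelyPresentable.{v} Y) :
    W.isLocal.isLocal.IsInvertedBy F := by
  have : Nonempty (ℵ₀ : Cardinal.{v}).ord.ToType := by simp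
  have := WellFoundedLT.toOrderBot (ℵ₀ : Cardinal.{v}).ord.ToType
  have := D₁.hasCoproductsOfShape.{v} W
  have := D₂.hasColimitsOfShape.{v} W
  have key : ∀ Z, IsIso (F.map (reflection W Z ℵ₀)) := fun Z => by
    have : PreservesWellOrderContinuousOfShape (ℵ₀ : Cardinal.{v}).ord.ToType F := ⟨fun j hj => inferInstance⟩
    let h : ((MorphismProperty.isomorphisms E).inverseImage F).TransfiniteCompositionOfShape
        (ℵ₀ : Cardinal.{v}).ord.ToType (reflection W Z ℵ₀) :=
      ((succStruct W Z).transfiniteCompositionOfShapeιIteration _).ofLE (by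
        rintro Z₀ _ _ ⟨_⟩
        exact isIso_map_toSucc F W hW Z₀)
    exact (MorphismProperty.isomorphisms E).transfiniteCompositionsOfShape_le _ _ ⟨h.map⟩
  intro X Y f hf
  have hX := isLocal_isLocal_reflection W X ℵ₀
  have hY := isLocal_isLocal_reflection W Y ℵ₀
  obtain ⟨g, hg⟩ := (hX _ (isLocal_reflectionObj Y hW')).2 (f ≫ reflection W Y ℵ₀)
  dsimp only at hg
  have hg' : IsIso g := by
    rw [← W.isLocal.isLocal_iff_isIso g (isLocal_reflectionObj X hW') (isLocal_reflectionObj Y hW')]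
    refine W.isLocal.isLocal.of_precomp _ _ hX ?_
    rw [hg]
    exact W.isLocal.isLocal.comp_mem _ _ hf hY
  have := key X
  have := key Y
  have h := congrArg F.map hg
  rw [F.map_comp, F.map_comp] at h
  have : IsIso (F.map f ≫ F.map (reflection W Y ℵ₀)) := by rw [← h]; infer_instance
  exact IsIso.of_isIso_comp_right _ (F.map (reflection W Y ℵ₀))

end Inverts

end Local

section TensorFunctors

variable (C : Type u₁) [Category.{v} C] [MonoidalCategory C] [SymmetricCategory C]
  (D : Type u₂) [Category.{v} D] [MonoidalCategory D] [SymmetricCategory D]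
  {E : Type u} [Category.{v} E] [MonoidalCategory E] [SymmetricCategory E]

/-- A cocontinuous tensor functor: a strong symmetric monoidal functor which preserves all small
colimits. -/
structure TensorFunctor where
  toFunctor : C ⥤ D
  braided : toFunctor.Braided
  cocontinuous : PreservesColimitsOfSize.{v, v} toFunctor

attribute [instance] TensorFunctor.braided TensorFunctor.cocontinuous

variable {C D}

namespace TensorFunctor

/-- A morphism of tensor functors: a monoidal natural transformation. -/
@[ext]
structure Hom (F G : TensorFunctor C D) where
  hom : F.toFunctor ⟶ G.toFunctor
  isMonoidal : NatTrans.IsMonoidal hom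

attribute [instance] Hom.isMonoidal

instance : Category (TensorFunctor C D) where
  Hom F G := Hom F G
  id F := ⟨𝟙 _, inferInstance⟩
  comp f g := ⟨f.hom ≫ g.hom, inferInstance⟩

@[simp]
lemma id_hom (F : TensorFunctor C D) : Hom.hom (𝟙 F) = 𝟙 F.toFunctor := rfl

@[simp]
lemma comp_hom {F G H : TensorFunctor C D} (f : F ⟶ G) (g : G ⟶ H) :
    (f ≫ g).hom = f.hom ≫ g.hom := rfl

@[ext]
lemma hom_ext {F G : TensorFunctor C D} {f g : F ⟶ G} (h : ∀ X, f.hom.app X = g.hom.app X) :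
    f = g :=
  Hom.ext (NatTrans.ext (funext h))

/-- An isomorphism of tensor functors. -/
def isoMk {F G : TensorFunctor C D} (e : F.toFunctor ≅ G.toFunctor)
    (he : NatTrans.IsMonoidal e.hom) : F ≅ G where
  hom := ⟨e.hom, he⟩
  inv := ⟨e.inv, inferInstance⟩
  hom_inv_id := Hom.ext e.hom_inv_id
  inv_hom_id := Hom.ext e.inv_hom_id

/-- The composition of cocontinuous tensor functors. -/
def comp (F : TensorFunctor C D) (G : TensorFunctor D E) : TensorFunctor C E where
  toFunctor := F.toFunctor ⋙ G.toFunctor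
  braided := inferInstance
  cocontinuous := inferInstance

/-- Preservation of finitely presentable objects. -/
def preservesFP : ObjectProperty (TensorFunctor C D) := fun F =>
  ∀ X : C, IsFinitelyPresentable.{v} X → IsFinitelyPresentable.{v} (F.toFunctor.obj X)

end TensorFunctor

end TensorFunctors

set_option linter.unusedSectionVars false

section Localization

open Functor LaxMonoidal OplaxMonoidal

variable (C : Type u₁) [Category.{v} C] [MonoidalCategory C]

/-- An idal whose underlying object is finitely presentable. -/
structure FPIdal extends Idal C where
  fp : IsFinitelyPresentable.{v} obj

variable {C} [SymmetricCategory C] [LFPTensorCategory C]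

namespace FPIdal

open Cardinal in
attribute [local instance] fact_isRegular_aleph0 in
lemma isRightAdjoint_ι (J : FPIdal C) : J.isLocal.ι.IsRightAdjoint := by
  have := LFPTensorCategory.locallyFinitelyPresentable (C := C)
  obtain ⟨W, _, _, h, hW⟩ := J.exists_small J.fp
  rw [← h]
  exact MorphismProperty.isRightAdjoint_ι_isLocal W _ hW

open Cardinal in
attribute [local instance] fact_isRegular_aleph0 in
lemma isFinitelyAccessible_ι (J : FPIdal C) : Functor.IsFinitelyAccessible.{v} J.isLocal.ι := by
  have := LFPTensorCategory.locallyFinitelyPresentable (C := C)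
  obtain ⟨W, _, _, h, hW⟩ := J.exists_small J.fp
  rw [← h]
  exact MorphismProperty.isCardinalAccessible_ι_isLocal W _ hW

/-- The reflector onto the full subcategory of local objects. -/
noncomputable def reflector (J : FPIdal C) : C ⥤ J.isLocal.FullSubcategory :=
  have := J.isRightAdjoint_ι
  J.isLocal.ι.leftAdjoint

/-- The adjunction between the reflector and the inclusion. -/
noncomputable def reflectorAdj (J : FPIdal C) : J.reflector ⊣ J.isLocal.ι :=
  have := J.isRightAdjoint_ι
  Adjunction.ofIsRightAdjoint _

/-- The morphisms inverted by the reflector. -/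
def localEquiv (J : FPIdal C) : MorphismProperty C := J.isLocal.isLocal

lemma localEquiv_eq (J : FPIdal C) :
    J.localEquiv = ObjectProperty.isLocal (· ∈ Set.range J.isLocal.ι.obj) := by
  have : (· ∈ Set.range J.isLocal.ι.obj) = J.isLocal := by
    ext X
    exact ⟨by rintro ⟨Y, rfl⟩; exact Y.property, fun h => ⟨⟨X, h⟩, rfl⟩⟩
  rw [this]
  rfl

instance (J : FPIdal C) : J.reflector.IsLocalization J.localEquiv := by
  rw [localEquiv_eq]
  exact ObjectProperty.isLocalization_isLocal J.reflectorAdj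

lemma localEquiv_iff (J : FPIdal C) {X Y : C} (f : X ⟶ Y) :
    J.localEquiv f ↔ IsIso (J.reflector.map f) := by
  rw [localEquiv_eq]
  exact ObjectProperty.isLocal_iff_isIso_map J.reflectorAdj f

lemma isInvertedBy (J : FPIdal C) {E : Type u₂} [Category.{v} E] (F : C ⥤ E)
    [PreservesColimitsOfSize.{v, v} F] (hF : ∀ X, IsIso (F.map (J.act X))) :
    J.localEquiv.IsInvertedBy F := by
  have := LFPTensorCategory.locallyFinitelyPresentable (C := C)
  obtain ⟨W, _, hle, h, hW⟩ := J.exists_small J.fp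
  rw [localEquiv, ← h]
  refine isIso_map_reflection F W (fun X Y f hf => ?_) hW
  have hf' : ∃ Z, Arrow.mk f = Arrow.mk (J.act Z) :=
    (MorphismProperty.ofHoms_iff _ _).1 (hle _ hf)
  obtain ⟨Z, hZ⟩ := hf'
  obtain rfl : Y = Z := congrArg Comma.right hZ
  obtain rfl : X = _ := congrArg Comma.left hZ
  obtain rfl : f = J.act Y := (Arrow.mk_inj _ _).1 hZ
  exact hF Y

instance (J : FPIdal C) : PreservesColimitsOfSize.{v, v} J.reflector :=
  J.reflectorAdj.leftAdjoint_preservesColimits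

lemma localEquiv_act (J : FPIdal C) (X : C) : J.localEquiv (J.act X) :=
  MorphismProperty.le_isLocal_isLocal _ _ ⟨X⟩

instance (J : FPIdal C) : J.localEquiv.RespectsIso := by
  unfold localEquiv; infer_instance

instance (J : FPIdal C) : J.localEquiv.IsMultiplicative := by
  unfold localEquiv; infer_instance

lemma localEquiv_whiskerLeft (J : FPIdal C) (Z : C) {X Y : C} (f : X ⟶ Y)
    (hf : J.localEquiv f) : J.localEquiv (Z ◁ f) := by
  have := LFPTensorCategory.tensorLeft_cocontinuous Z
  have h := J.isInvertedBy (tensorLeft Z ⋙ J.reflector) fun X => by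
    change IsIso (J.reflector.map (Z ◁ J.act X))
    rw [← J.localEquiv_iff]
    have h : Z ◁ J.act X = (α_ Z X J.obj).inv ≫ J.act (Z ⊗ X) := by
      simp [Idal.act]
    rw [h]
    exact MorphismProperty.RespectsIso.precomp _ _ _ (J.localEquiv_act _)
  exact (J.localEquiv_iff _).2 (h f hf)

instance (J : FPIdal C) : J.localEquiv.IsMonoidal where
  whiskerLeft Z _ _ f hf := J.localEquiv_whiskerLeft Z f hf
  whiskerRight f hf Z := by
    have h : f ▷ Z = (β_ _ _).hom ≫ Z ◁ f ≫ (β_ _ _).inv := by simp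
    rw [h]
    exact MorphismProperty.RespectsIso.precomp _ _ _
      (MorphismProperty.RespectsIso.postcomp _ _ _ (J.localEquiv_whiskerLeft Z f hf))

/-- The category `C_J`: the full (reflective) subcategory of the objects `M` such that
`M ⟶ HOM(J, M)` is an isomorphism. Its tensor structure is the one for which the
reflector is a tensor functor: the unit is `R_J 𝟙` and the tensor product is `R_J (M ⊗ N)`. -/
def Loc (J : FPIdal C) : Type u₁ :=
  LocalizedMonoidal J.reflector J.localEquiv (Iso.refl _)

noncomputable section

variable (J : FPIdal C)

instance : Category.{v} J.Loc :=
  inferInstanceAs (Category (LocalizedMonoidal J.reflector J.localEquiv (Iso.refl _)))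

instance : MonoidalCategory J.Loc :=
  inferInstanceAs (MonoidalCategory (LocalizedMonoidal J.reflector J.localEquiv (Iso.refl _)))

instance : SymmetricCategory J.Loc :=
  inferInstanceAs (SymmetricCategory (LocalizedMonoidal J.reflector J.localEquiv (Iso.refl _)))

/-- The reflector `R_J : C ⟶ C_J`. -/
def R : C ⥤ J.Loc :=
  Localization.Monoidal.toMonoidalCategory J.reflector J.localEquiv (Iso.refl _)

instance : J.R.Braided :=
  inferInstanceAs (Localization.Monoidal.toMonoidalCategory J.reflector J.localEquiv
    (Iso.refl _)).Braided

instance : J.R.IsLocalization J.localEquiv :=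
  inferInstanceAs (J.reflector.IsLocalization J.localEquiv)

instance : PreservesColimitsOfSize.{v, v} J.R :=
  inferInstanceAs (PreservesColimitsOfSize.{v, v} J.reflector)

/-- The inclusion `C_J ⟶ C` of the full subcategory. -/
def incl : J.Loc ⥤ C := J.isLocal.ι

instance : J.incl.Full := inferInstanceAs J.isLocal.ι.Full

instance : J.incl.Faithful := inferInstanceAs J.isLocal.ι.Faithful

/-- The adjunction between the reflector and the inclusion. -/
def adj : J.R ⊣ J.incl := J.reflectorAdj

instance : J.incl.LaxMonoidal := J.adj.rightAdjointLaxMonoidal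

instance : J.adj.IsMonoidal := inferInstance

instance : J.incl.LaxBraided where
  braided X Y := by
    apply (J.adj.homEquiv _ _).symm.injective
    rw [Adjunction.homEquiv_counit, Adjunction.homEquiv_counit, Functor.map_comp,
      Functor.map_comp, Category.assoc, Category.assoc, Adjunction.counit_naturality,
      Adjunction.map_μ_comp_counit_app_tensor_assoc, Adjunction.map_μ_comp_counit_app_tensor,
      BraidedCategory.braiding_naturality, Functor.map_braiding]
    simp

/-- The reflector `R_J : C ⟶ C_J` as a cocontinuous tensor functor. -/
def loc : TensorFunctor C J.Loc where
  toFunctor := J.R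
  braided := inferInstance
  cocontinuous := inferInstance

end

end FPIdal

end Localization

section Inverts

variable {C : Type u₁} [Category.{v} C] [MonoidalCategory C]

lemma Idal.isIso_of_isSplitEpi (I : Idal C) [h : IsSplitEpi I.hom] : IsIso I.hom := by
  obtain ⟨⟨s, hs⟩⟩ := h
  refine ⟨s, ?_, hs⟩
  have h := (λ_ I.obj).inv ≫= (s ▷ I.obj ≫= I.comm)
  rw [← comp_whiskerRight_assoc, hs, id_whiskerRight, Category.id_comp, Iso.inv_hom_id,
    ← whisker_exchange_assoc, ← leftUnitor_inv_naturality_assoc, rightUnitor_naturality,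
    ← unitors_equal, Iso.inv_hom_id_assoc] at h
  exact h.symm

variable [SymmetricCategory C] {D : Type u₂} [Category.{v} D] [MonoidalCategory D]
  [SymmetricCategory D] {E : Type u} [Category.{v} E] [MonoidalCategory E] [SymmetricCategory E]

namespace Idal

/-- The morphism of idals `I ⊗ J ⟶ I`. -/
def fst (I J : Idal C) : I.tensor J ⟶ I where
  hom := I.obj ◁ J.hom ≫ (ρ_ I.obj).hom
  w := by
    change (I.obj ◁ J.hom ≫ (ρ_ I.obj).hom) ≫ I.hom = (I.hom ⊗ₘ J.hom) ≫ (λ_ (𝟙_ C)).hom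
    rw [MonoidalCategory.tensorHom_def', unitors_equal, Category.assoc, Category.assoc,
      rightUnitor_naturality]

/-- The morphism of idals `I ⊗ J ⟶ J`. -/
def snd (I J : Idal C) : I.tensor J ⟶ J where
  hom := I.hom ▷ J.obj ≫ (λ_ J.obj).hom
  w := by
    change (I.hom ▷ J.obj ≫ (λ_ J.obj).hom) ≫ J.hom = (I.hom ⊗ₘ J.hom) ≫ (λ_ (𝟙_ C)).hom
    rw [MonoidalCategory.tensorHom_def, Category.assoc, Category.assoc, leftUnitor_naturality]

/-- The product of two morphisms of idals. -/
def tensorHom {I J I' J' : Idal C} (f : I ⟶ I') (g : J ⟶ J') : I.tensor J ⟶ I'.tensor J' where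
  hom := f.hom ⊗ₘ g.hom
  w := by
    simp [tensor, ← f.w, ← g.w]

end Idal

namespace TensorFunctor

/-- `F` maps the idal `I ⟶ 𝟙` to an isomorphism. -/
def Inverts (F : TensorFunctor C D) (I : Idal C) : Prop := IsIso (F.toFunctor.map I.hom)

variable (F : TensorFunctor C D)

lemma Inverts.comp {F : TensorFunctor C D} {I : Idal C} (h : F.Inverts I)
    (G : TensorFunctor D E) : (F.comp G).Inverts I := by
  have : IsIso (F.toFunctor.map I.hom) := h
  exact inferInstanceAs (IsIso (G.toFunctor.map (F.toFunctor.map I.hom)))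

lemma Inverts.of_iso {F G : TensorFunctor C D} {I : Idal C} (h : F.Inverts I) (e : F ≅ G) :
    G.Inverts I := by
  have : IsIso (F.toFunctor.map I.hom) := h
  let e' : F.toFunctor ≅ G.toFunctor :=
    ⟨e.hom.hom, e.inv.hom, congrArg Hom.hom e.hom_inv_id, congrArg Hom.hom e.inv_hom_id⟩
  exact (NatIso.isIso_map_iff e' I.hom).1 this

lemma Inverts.of_hom {F : TensorFunctor C D} {I J : Idal C} (h : F.Inverts I) (f : I ⟶ J) :
    F.Inverts J := by
  have : IsIso (F.toFunctor.map I.hom) := h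
  have h' : F.toFunctor.map I.hom = F.toFunctor.map f.hom ≫ F.toFunctor.map J.hom := by
    rw [← Functor.map_comp, f.w]
  have : IsSplitEpi (J.map F.toFunctor).hom := by
    refine ⟨⟨Functor.LaxMonoidal.ε F.toFunctor ≫ inv (F.toFunctor.map I.hom) ≫
      F.toFunctor.map f.hom, ?_⟩⟩
    change (_ ≫ _ ≫ _) ≫ F.toFunctor.map J.hom ≫ _ = _
    simp only [Category.assoc]
    rw [← reassoc_of% h']
    simp
  have h₂ : IsIso (F.toFunctor.map J.hom ≫ Functor.OplaxMonoidal.η F.toFunctor) :=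
    (J.map F.toFunctor).isIso_of_isSplitEpi
  exact IsIso.of_isIso_comp_right _ (Functor.OplaxMonoidal.η F.toFunctor)

lemma Inverts.tensor {F : TensorFunctor C D} {I J : Idal C} (hI : F.Inverts I)
    (hJ : F.Inverts J) : F.Inverts (I.tensor J) := by
  have : IsIso (F.toFunctor.map I.hom) := hI
  have : IsIso (F.toFunctor.map J.hom) := hJ
  change IsIso (F.toFunctor.map ((I.hom ⊗ₘ J.hom) ≫ (λ_ (𝟙_ C)).hom))
  rw [Functor.map_comp, Functor.Monoidal.map_tensor]
  infer_instance

lemma Inverts.isIso_act {F : TensorFunctor C D} {I : Idal C} (h : F.Inverts I) (X : C) :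
    IsIso (F.toFunctor.map (I.act X)) := by
  have : IsIso (F.toFunctor.map I.hom) := h
  rw [Idal.act, Functor.map_comp, Functor.Monoidal.map_whiskerLeft]
  infer_instance

/-- Composition of a morphism of tensor functors with a tensor functor on the target side. -/
def whiskerRight {F G : TensorFunctor C D} (τ : F ⟶ G) (H : TensorFunctor D E) :
    F.comp H ⟶ G.comp H where
  hom := Functor.whiskerRight τ.hom H.toFunctor
  isMonoidal := NatTrans.IsMonoidal.whiskerRight τ.hom

/-- Composition of a morphism of tensor functors with a tensor functor on the source side. -/
def whiskerLeft (F : TensorFunctor C D) {G H : TensorFunctor D E} (τ : G ⟶ H) :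
    F.comp G ⟶ F.comp H where
  hom := Functor.whiskerLeft F.toFunctor τ.hom
  isMonoidal := NatTrans.IsMonoidal.whiskerLeft τ.hom

end TensorFunctor

end Inverts

section Lift

open Functor LaxMonoidal OplaxMonoidal

variable {C : Type u₁} [Category.{v} C] [MonoidalCategory C] [SymmetricCategory C]
  [LFPTensorCategory C] {D : Type u₂} [Category.{v} D] [MonoidalCategory D]
  [SymmetricCategory D]

namespace FPIdal

variable (J : FPIdal C)

lemma isIso_map_unit {F : TensorFunctor C D} (h : F.Inverts J.toIdal) (X : C) :
    IsIso (F.toFunctor.map (J.adj.unit.app X)) := by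
  refine J.isInvertedBy F.toFunctor h.isIso_act _ ?_
  rw [localEquiv_eq]
  exact ObjectProperty.isLocal_adj_unit_app J.reflectorAdj X

lemma loc_inverts : J.loc.Inverts J.toIdal := by
  have h : J.hom = (λ_ J.obj).inv ≫ J.act (𝟙_ C) := by
    simp [Idal.act, ← unitors_equal]
  have : IsIso (J.R.map (J.act (𝟙_ C))) := Localization.inverts J.R J.localEquiv _
    (J.localEquiv_act _)
  change IsIso (J.R.map J.hom)
  rw [h, Functor.map_comp]
  infer_instance

noncomputable section

/-- The restriction to `C_J` of a tensor functor inverting `J` is a tensor functor. -/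
@[reducible] def liftBraided (F : TensorFunctor C D) (h : F.Inverts J.toIdal) :
    (J.incl ⋙ F.toFunctor).Braided := by
  have h₁ : IsIso (ε (J.incl ⋙ F.toFunctor)) := by
    have := J.isIso_map_unit h (𝟙_ C)
    have : ε J.incl = J.adj.unit.app _ ≫ J.incl.map (η J.R) :=
      Adjunction.IsMonoidal.leftAdjoint_ε (adj := J.adj)
    rw [LaxMonoidal.comp_ε, this, Functor.map_comp]
    infer_instance
  have h₂ : ∀ X Y, IsIso (μ (J.incl ⋙ F.toFunctor) X Y) := fun X Y => by
    have := J.isIso_map_unit h (J.incl.obj X ⊗ J.incl.obj Y)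
    have : μ J.incl X Y = J.adj.unit.app _ ≫
      J.incl.map (δ J.R _ _ ≫ (J.adj.counit.app X ⊗ₘ J.adj.counit.app Y)) :=
      Adjunction.IsMonoidal.leftAdjoint_μ (adj := J.adj) X Y
    rw [LaxMonoidal.comp_μ, this, Functor.map_comp]
    infer_instance
  exact
    { toMonoidal :=
        { toLaxMonoidal := inferInstance
          toOplaxMonoidal := (CoreMonoidal.ofLaxMonoidal (J.incl ⋙ F.toFunctor)).toOplaxMonoidal
          ε_η := (CoreMonoidal.ofLaxMonoidal (J.incl ⋙ F.toFunctor)).toMonoidal.ε_η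
          η_ε := (CoreMonoidal.ofLaxMonoidal (J.incl ⋙ F.toFunctor)).toMonoidal.η_ε
          μ_δ := (CoreMonoidal.ofLaxMonoidal (J.incl ⋙ F.toFunctor)).toMonoidal.μ_δ
          δ_μ := (CoreMonoidal.ofLaxMonoidal (J.incl ⋙ F.toFunctor)).toMonoidal.δ_μ }
      braided := Functor.LaxBraided.braided (F := J.incl ⋙ F.toFunctor) }

end

end FPIdal

end Lift

section Lift2

open Functor LaxMonoidal OplaxMonoidal

variable {C : Type u₁} [Category.{v} C] [MonoidalCategory C] [SymmetricCategory C]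
  [LFPTensorCategory C] {D : Type u₂} [Category.{v} D] [MonoidalCategory D]
  [SymmetricCategory D] {E : Type u} [Category.{v} E] [MonoidalCategory E] [SymmetricCategory E]

noncomputable section

namespace FPIdal

variable (J : FPIdal C)

/-- The isomorphism `F ≅ F ∘ R_J` given by the unit of the adjunction. -/
def liftFunctorIso (F : TensorFunctor C D) (h : F.Inverts J.toIdal) :
    F.toFunctor ≅ J.R ⋙ J.incl ⋙ F.toFunctor :=
  have (X : C) := J.isIso_map_unit h X
  NatIso.ofComponents (fun X => asIso (F.toFunctor.map (J.adj.unit.app X))) fun f => by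
    have := congrArg F.toFunctor.map (J.adj.unit.naturality f)
    rw [F.toFunctor.map_comp, F.toFunctor.map_comp] at this
    exact this

lemma lift_cocontinuous (F : TensorFunctor C D) (h : F.Inverts J.toIdal) :
    PreservesColimitsOfSize.{v, v} (J.incl ⋙ F.toFunctor) := by
  have := LFPTensorCategory.locallyFinitelyPresentable (C := C)
  have e := J.liftFunctorIso F h
  have : PreservesColimitsOfSize.{v, v} (J.R ⋙ J.incl ⋙ F.toFunctor) :=
    preservesColimits_of_natIso e
  refine ⟨fun {A} _ => ⟨fun {K} => ?_⟩⟩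
  let c := colimit.cocone (K ⋙ J.incl)
  have hc : IsColimit c := colimit.isColimit _
  have h₁ : PreservesColimit ((K ⋙ J.incl) ⋙ J.R) (J.incl ⋙ F.toFunctor) :=
    preservesColimit_of_preserves_colimit_cocone (isColimitOfPreserves J.R hc)
      (isColimitOfPreserves (J.R ⋙ J.incl ⋙ F.toFunctor) hc)
  have : IsIso J.adj.counit := inferInstance
  have h₂ : PreservesColimit (K ⋙ J.incl ⋙ J.R) (J.incl ⋙ F.toFunctor) := h₁
  exact preservesColimit_of_iso_diagram (J.incl ⋙ F.toFunctor)
    (Functor.isoWhiskerLeft K (asIso J.adj.counit) : (K ⋙ J.incl) ⋙ J.R ≅ K)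

/-- The universal property of the localization: a cocontinuous tensor functor `F : C ⟶ D`
which inverts `J` induces a cocontinuous tensor functor `C_J ⟶ D`, namely the restriction of `F` to `C_J`. -/
def lift (F : TensorFunctor C D) (h : F.Inverts J.toIdal) : TensorFunctor J.Loc D where
  toFunctor := J.incl ⋙ F.toFunctor
  braided := J.liftBraided F h
  cocontinuous := J.lift_cocontinuous F h

lemma lift_ε (F : TensorFunctor C D) (h : F.Inverts J.toIdal) :
    ε (J.lift F h).toFunctor = ε F.toFunctor ≫ F.toFunctor.map (ε J.incl) := rfl

lemma lift_μ (F : TensorFunctor C D) (h : F.Inverts J.toIdal) (X Y : J.Loc) :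
    μ (J.lift F h).toFunctor X Y = μ F.toFunctor _ _ ≫ F.toFunctor.map (μ J.incl X Y) := rfl

/-- The isomorphism `F ≅ lift F ∘ R`. -/
def liftIso (F : TensorFunctor C D) (h : F.Inverts J.toIdal) : F ≅ J.loc.comp (J.lift F h) :=
  TensorFunctor.isoMk (J.liftFunctorIso F h) <| by
    have := (inferInstance : J.adj.IsMonoidal)
    have h₀ := NatTrans.IsMonoidal.unit (τ := J.adj.unit)
    have h₂ := NatTrans.IsMonoidal.tensor (τ := J.adj.unit)
    constructor
    · have := congrArg F.toFunctor.map h₀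
      rw [F.toFunctor.map_comp] at this
      change ε F.toFunctor ≫ F.toFunctor.map (J.adj.unit.app _) =
        (ε F.toFunctor ≫ F.toFunctor.map (ε J.incl)) ≫ F.toFunctor.map (J.incl.map (ε J.R))
      rw [Category.assoc, ← F.toFunctor.map_comp, ← LaxMonoidal.comp_ε, ← h₀,
        F.toFunctor.map_comp, ← F.toFunctor.map_comp]
      simp
    · intro X Y
      change μ F.toFunctor X Y ≫ F.toFunctor.map (J.adj.unit.app _) =
        (F.toFunctor.map (J.adj.unit.app X) ⊗ₘ F.toFunctor.map (J.adj.unit.app Y)) ≫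
        (μ F.toFunctor _ _ ≫ F.toFunctor.map (μ J.incl _ _)) ≫
          F.toFunctor.map (J.incl.map (μ J.R X Y))
      rw [Category.assoc, ← F.toFunctor.map_comp, ← LaxMonoidal.comp_μ, μ_natural_assoc,
        ← F.toFunctor.map_comp]
      erw [← h₂ X Y]
      simp

/-- The morphism `lift F ⟶ lift G` induced by a morphism `F ⟶ G`. -/
def liftMap {F G : TensorFunctor C D} (τ : F ⟶ G) (hF : F.Inverts J.toIdal)
    (hG : G.Inverts J.toIdal) : J.lift F hF ⟶ J.lift G hG where
  hom := Functor.whiskerLeft J.incl τ.hom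
  isMonoidal := NatTrans.IsMonoidal.whiskerLeft τ.hom

end FPIdal
end

end Lift2

section Transition

open Functor LaxMonoidal OplaxMonoidal

variable {C : Type u₁} [Category.{v} C] [MonoidalCategory C] [SymmetricCategory C]
  {D : Type u₂} [Category.{v} D] [MonoidalCategory D]
  [SymmetricCategory D] {E : Type u} [Category.{v} E] [MonoidalCategory E] [SymmetricCategory E]
  {E' : Type w} [Category.{v} E'] [MonoidalCategory E'] [SymmetricCategory E']

namespace TensorFunctor

variable (C) in
/-- The identity functor. -/
def id : TensorFunctor C C where
  toFunctor := 𝟭 C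
  braided := inferInstance
  cocontinuous := inferInstance

/-- Composition of tensor functors is associative. -/
def assoc (F : TensorFunctor C D) (G : TensorFunctor D E) (H : TensorFunctor E E') :
    (F.comp G).comp H ≅ F.comp (G.comp H) :=
  isoMk (Functor.associator F.toFunctor G.toFunctor H.toFunctor)
    (inferInstanceAs (NatTrans.IsMonoidal
      (Functor.associator F.toFunctor G.toFunctor H.toFunctor).hom))

/-- The identity functor is a right unit. -/
def rightUnitor (F : TensorFunctor C D) : F.comp (id D) ≅ F :=
  isoMk (Functor.rightUnitor F.toFunctor)
    (inferInstanceAs (NatTrans.IsMonoidal (Functor.rightUnitor F.toFunctor).hom))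

/-- Whiskering of an isomorphism. -/
def whiskerLeftIso (F : TensorFunctor C D) {G H : TensorFunctor D E} (e : G ≅ H) :
    F.comp G ≅ F.comp H where
  hom := F.whiskerLeft e.hom
  inv := F.whiskerLeft e.inv
  hom_inv_id := by
    ext X
    exact congrArg (fun t => t.hom.app (F.toFunctor.obj X)) e.hom_inv_id
  inv_hom_id := by
    ext X
    exact congrArg (fun t => t.hom.app (F.toFunctor.obj X)) e.inv_hom_id

/-- Whiskering of an isomorphism. -/
def whiskerRightIso {F G : TensorFunctor C D} (e : F ≅ G) (H : TensorFunctor D E) :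
    F.comp H ≅ G.comp H where
  hom := whiskerRight e.hom H
  inv := whiskerRight e.inv H
  hom_inv_id := by
    ext X
    exact ((H.toFunctor.map_comp _ _).symm.trans
      (congrArg (fun t => H.toFunctor.map (t.hom.app X)) e.hom_inv_id)).trans (H.toFunctor.map_id _)
  inv_hom_id := by
    ext X
    exact ((H.toFunctor.map_comp _ _).symm.trans
      (congrArg (fun t => H.toFunctor.map (t.hom.app X)) e.inv_hom_id)).trans (H.toFunctor.map_id _)

end TensorFunctor

variable [LFPTensorCategory C]

noncomputable section

namespace FPIdal

lemma liftMap_comp (J : FPIdal C) {F G H : TensorFunctor C D} (σ : F ⟶ G) (τ : G ⟶ H)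
    (hF : F.Inverts J.toIdal) (hG : G.Inverts J.toIdal) (hH : H.Inverts J.toIdal) :
    J.liftMap (σ ≫ τ) hF hH = J.liftMap σ hF hG ≫ J.liftMap τ hG hH := rfl

lemma liftMap_id (J : FPIdal C) (F : TensorFunctor C D) (hF : F.Inverts J.toIdal) :
    J.liftMap (𝟙 F) hF hF = 𝟙 _ := rfl

/-- The isomorphism `lift F ≅ lift G` induced by an isomorphism `F ≅ G`. -/
def liftMapIso (J : FPIdal C) {F G : TensorFunctor C D} (τ : F ≅ G) (hF : F.Inverts J.toIdal)
    (hG : G.Inverts J.toIdal) : J.lift F hF ≅ J.lift G hG where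
  hom := J.liftMap τ.hom hF hG
  inv := J.liftMap τ.inv hG hF
  hom_inv_id := by rw [← liftMap_comp, τ.hom_inv_id, liftMap_id]
  inv_hom_id := by rw [← liftMap_comp, τ.inv_hom_id, liftMap_id]

/-- The lift is compatible with compositions. -/
def liftCompIso (J : FPIdal C) (F : TensorFunctor C D) (hF : F.Inverts J.toIdal)
    (G : TensorFunctor D E) (h : (F.comp G).Inverts J.toIdal) :
    J.lift (F.comp G) h ≅ (J.lift F hF).comp G :=
  TensorFunctor.isoMk (Iso.refl (J.incl ⋙ F.toFunctor ⋙ G.toFunctor)) <| by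
    constructor
    · change ((ε G.toFunctor ≫ G.toFunctor.map (ε F.toFunctor)) ≫
        G.toFunctor.map (F.toFunctor.map (ε J.incl))) ≫ 𝟙 _ =
        ε G.toFunctor ≫ G.toFunctor.map (ε F.toFunctor ≫ F.toFunctor.map (ε J.incl))
      simp
    · intro X Y
      change ((μ G.toFunctor _ _ ≫ G.toFunctor.map (μ F.toFunctor _ _)) ≫
        G.toFunctor.map (F.toFunctor.map (μ J.incl X Y))) ≫ 𝟙 _ = (𝟙 _ ⊗ₘ 𝟙 _) ≫
        μ G.toFunctor _ _ ≫ G.toFunctor.map (μ F.toFunctor _ _ ≫ F.toFunctor.map (μ J.incl X Y))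
      simp

/-- The transition functor `C_{J'} ⟶ C_J` for idals `J`, `J'` such that `C_J` is contained
in `C_{J'}`: the restriction of the localization functor `R_J`. -/
def trans (J J' : FPIdal C) (h : J.loc.Inverts J'.toIdal) : TensorFunctor J'.Loc J.Loc :=
  J'.lift J.loc h

/-- The functor `f^* : C_{J'} ⟶ C_J` for a morphism of idals `f : J ⟶ J'`. -/
def pull {J J' : FPIdal C} (f : J.toIdal ⟶ J'.toIdal) : TensorFunctor J'.Loc J.Loc :=
  trans J J' (J.loc_inverts.of_hom f)

/-- The isomorphism `R_J ≅ (C_{J'} ⟶ C_J) ∘ R_{J'}`. -/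
def transIso (J J' : FPIdal C) (h : J.loc.Inverts J'.toIdal) :
    J.loc ≅ J'.loc.comp (trans J J' h) :=
  J'.liftIso J.loc h

/-- The transition functor from `C_J` to itself is the identity. -/
def transId (J : FPIdal C) (h : J.loc.Inverts J.toIdal) : trans J J h ≅ TensorFunctor.id J.Loc :=
  have := (inferInstance : J.adj.IsMonoidal)
  let e : J.incl ⋙ J.R ≅ 𝟭 J.Loc := asIso J.adj.counit
  TensorFunctor.isoMk e
    (inferInstanceAs (NatTrans.IsMonoidal J.adj.counit))

/-- The transition functors compose. -/
def transComp (J J' J'' : FPIdal C) (h : J.loc.Inverts J'.toIdal)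
    (h' : J'.loc.Inverts J''.toIdal) (h'' : J.loc.Inverts J''.toIdal) :
    (trans J' J'' h').comp (trans J J' h) ≅ trans J J'' h'' :=
  (liftCompIso J'' J'.loc h' (trans J J' h) (h'.comp _)).symm ≪≫
    liftMapIso J'' (transIso J J' h).symm _ _

lemma transIso_hom_app (J J' : FPIdal C) (h : J.loc.Inverts J'.toIdal) (X : C) :
    (transIso J J' h).hom.hom.app X = J.R.map (J'.adj.unit.app X) := rfl

lemma trans_map (J J' : FPIdal C) (h : J.loc.Inverts J'.toIdal) {M N : J'.Loc} (f : M ⟶ N) :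
    (trans J J' h).toFunctor.map f = J.R.map (J'.incl.map f) := rfl

lemma transComp_inv_app (J J' J'' : FPIdal C) (h : J.loc.Inverts J'.toIdal)
    (h' : J'.loc.Inverts J''.toIdal) (h'' : J.loc.Inverts J''.toIdal) (M : J''.Loc) :
    (transComp J J' J'' h h' h'').inv.hom.app M =
      J.R.map (J'.adj.unit.app (J''.incl.obj M)) := by
  change _ ≫ 𝟙 _ = _
  rw [Category.comp_id]
  rfl

lemma transId_hom_app (J : FPIdal C) (h : J.loc.Inverts J.toIdal) (M : J.Loc) :
    (transId J h).hom.hom.app M = J.adj.counit.app M := rfl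

end FPIdal

end

end Transition

section Gluing

variable {C : Type u₁} [Category.{v} C] [MonoidalCategory C] [SymmetricCategory C]
  {D : Type u₂} [Category.{v} D] [MonoidalCategory D] [SymmetricCategory D]

/-- The idals `I` and `J` form an idal cover: the square consisting of `I ⊗ J ⟶ I`,
`I ⊗ J ⟶ J`, `I ⟶ 𝟙` and `J ⟶ 𝟙` is a pushout. -/
def Idal.IsCover (I J : Idal C) : Prop :=
  IsPushout (I.fst J).hom (I.snd J).hom I.hom J.hom

lemma TensorFunctor.Inverts.of_comp {E : Type u} [Category.{v} E] [MonoidalCategory E]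
    [SymmetricCategory E] {F : TensorFunctor C D} {G : TensorFunctor D E} {I : Idal C}
    (h : (F.comp G).Inverts I) : G.Inverts (I.map F.toFunctor) := by
  have : IsIso (G.toFunctor.map (F.toFunctor.map I.hom)) := h
  change IsIso (G.toFunctor.map (F.toFunctor.map I.hom ≫ Functor.OplaxMonoidal.η F.toFunctor))
  rw [Functor.map_comp]
  infer_instance

lemma TensorFunctor.Inverts.comp_of_map {E : Type u} [Category.{v} E] [MonoidalCategory E]
    [SymmetricCategory E] {F : TensorFunctor C D} {G : TensorFunctor D E} {I : Idal C}
    (h : G.Inverts (I.map F.toFunctor)) : (F.comp G).Inverts I := by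
  have : IsIso (G.toFunctor.map (F.toFunctor.map I.hom ≫ Functor.OplaxMonoidal.η F.toFunctor)) := h
  rw [Functor.map_comp] at this
  change IsIso (G.toFunctor.map (F.toFunctor.map I.hom))
  exact IsIso.of_isIso_comp_right _ (G.toFunctor.map (Functor.OplaxMonoidal.η F.toFunctor))

namespace FPIdal

/-- The product of two finitely presentable idals. -/
def tensor [LFPTensorCategory C] (I J : FPIdal C) : FPIdal C where
  toIdal := I.toIdal.tensor J.toIdal
  fp := LFPTensorCategory.tensor_fp _ _ I.fp J.fp

/-- The product of two morphisms of idals. -/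
def tensorHom [LFPTensorCategory C] {J₁ J₂ J₁' J₂' : FPIdal C} (f₁ : J₁.toIdal ⟶ J₁'.toIdal)
    (f₂ : J₂.toIdal ⟶ J₂'.toIdal) : (J₁.tensor J₂).toIdal ⟶ (J₁'.tensor J₂').toIdal :=
  Idal.tensorHom f₁ f₂

/-- The image of a finitely presentable idal. -/
def map (F : TensorFunctor C D) (hF : TensorFunctor.preservesFP F) (I : FPIdal C) : FPIdal D where
  toIdal := I.toIdal.map F.toFunctor
  fp := hF _ I.fp

variable [LFPTensorCategory C] [LFPTensorCategory D]

lemma inverts_left (J₁ J₂ : FPIdal D) : (J₁.tensor J₂).loc.Inverts J₁.toIdal :=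
  (J₁.tensor J₂).loc_inverts.of_hom (J₁.toIdal.fst J₂.toIdal)

lemma inverts_right (J₁ J₂ : FPIdal D) : (J₁.tensor J₂).loc.Inverts J₂.toIdal :=
  (J₁.tensor J₂).loc_inverts.of_hom (J₁.toIdal.snd J₂.toIdal)

end FPIdal

noncomputable section

open FPIdal

variable [LFPTensorCategory C] [LFPTensorCategory D]

/-- The composition `C ⟶ C_I ⟶ D_J ⟶ D_L` of `R_I`, `H` and the transition functor. -/
def path {I : FPIdal C} {J : FPIdal D} (L : FPIdal D) (h : L.loc.Inverts J.toIdal)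
    (H : TensorFunctor I.Loc J.Loc) : TensorFunctor C L.Loc :=
  I.loc.comp (H.comp (trans L J h))

lemma path_inverts_self {I : FPIdal C} {J : FPIdal D} (L : FPIdal D)
    (h : L.loc.Inverts J.toIdal) (H : TensorFunctor I.Loc J.Loc) :
    (path L h H).Inverts I.toIdal :=
  I.loc_inverts.comp _

lemma path_inverts_other {I I' : FPIdal C} {J J' : FPIdal D} (L : FPIdal D)
    (h : L.loc.Inverts J.toIdal) (h' : L.loc.Inverts J'.toIdal) (H : TensorFunctor I.Loc J.Loc)
    (π : J'.toIdal.map J.R ≅ (I'.toIdal.map I.R).map H.toFunctor) :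
    (path L h H).Inverts I'.toIdal :=
  .comp_of_map (F := I.loc) (.comp_of_map (((h'.of_iso (transIso L J h)).of_comp).of_hom π.hom))

/-- The tensor functor `C_{I₁ ⊗ I₂} ⟶ D_{J₁ ⊗ J₂}` induced by `H₁ : C_{I₁} ⟶ D_{J₁}`. It exists
because, by means of `π₁`, the composition `C ⟶ C_{I₁} ⟶ D_{J₁} ⟶ D_{J₁ ⊗ J₂}` inverts `I₁ ⊗ I₂`. -/
def glue₁ {I₁ I₂ : FPIdal C} {J₁ J₂ : FPIdal D} (H₁ : TensorFunctor I₁.Loc J₁.Loc)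
    (π₁ : J₂.toIdal.map J₁.R ≅ (I₂.toIdal.map I₁.R).map H₁.toFunctor) :
    TensorFunctor (I₁.tensor I₂).Loc (J₁.tensor J₂).Loc :=
  (I₁.tensor I₂).lift (path _ (J₁.inverts_left J₂) H₁)
    ((path_inverts_self _ _ _).tensor (path_inverts_other _ _ (J₁.inverts_right J₂) _ π₁))

/-- The tensor functor `C_{I₁ ⊗ I₂} ⟶ D_{J₁ ⊗ J₂}` induced by `H₂ : C_{I₂} ⟶ D_{J₂}`. -/
def glue₂ {I₁ I₂ : FPIdal C} {J₁ J₂ : FPIdal D} (H₂ : TensorFunctor I₂.Loc J₂.Loc)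
    (π₂ : J₁.toIdal.map J₂.R ≅ (I₁.toIdal.map I₂.R).map H₂.toFunctor) :
    TensorFunctor (I₁.tensor I₂).Loc (J₁.tensor J₂).Loc :=
  (I₁.tensor I₂).lift (path _ (J₁.inverts_right J₂) H₂)
    ((path_inverts_other _ _ (J₁.inverts_left J₂) _ π₂).tensor (path_inverts_self _ _ _))

/-- The morphism `(D_J ⟶ D_L) H R_I ⟶ g^* (D_{J'} ⟶ D_{L'}) H' R_I` induced by `η : H ⟶ f^* H'`. -/
def pathMap {I : FPIdal C} {J J' L L' : FPIdal D} (h : L.loc.Inverts J.toIdal)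
    (h' : L'.loc.Inverts J'.toIdal) {H : TensorFunctor I.Loc J.Loc}
    {H' : TensorFunctor I.Loc J'.Loc} (f : J.toIdal ⟶ J'.toIdal) (g : L.toIdal ⟶ L'.toIdal)
    (η : H ⟶ H'.comp (pull f)) : path L h H ⟶ (path L' h' H').comp (pull g) :=
  I.loc.whiskerLeft (TensorFunctor.whiskerRight η (trans L J h) ≫
    (TensorFunctor.assoc _ _ _).hom ≫
    H'.whiskerLeft ((transComp L J J' h _ (h.of_hom f)).hom ≫
      (transComp L L' J' _ h' (h.of_hom f)).inv) ≫
    (TensorFunctor.assoc _ _ _).inv) ≫ (TensorFunctor.assoc _ _ _).inv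

/-- The morphism of tensor functors `C_{I₁ ⊗ I₂} ⟶ D_{J₁ ⊗ J₂}` induced by `η : H₁ ⟶ f₁^* H₁'`; its
target is the composition of `(f₁ ⊗ f₂)^*` with the functor induced by `H₁'`. -/
def glueMap₁ {I₁ I₂ : FPIdal C} {J₁ J₂ J₁' J₂' : FPIdal D} {H : TensorFunctor I₁.Loc J₁.Loc}
    {H' : TensorFunctor I₁.Loc J₁'.Loc}
    (π : J₂.toIdal.map J₁.R ≅ (I₂.toIdal.map I₁.R).map H.toFunctor)
    (π' : J₂'.toIdal.map J₁'.R ≅ (I₂.toIdal.map I₁.R).map H'.toFunctor)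
    (f₁ : J₁.toIdal ⟶ J₁'.toIdal) (f₂ : J₂.toIdal ⟶ J₂'.toIdal) (η : H ⟶ H'.comp (pull f₁)) :
    glue₁ H π ⟶ (glue₁ H' π').comp
      (pull (FPIdal.tensorHom f₁ f₂)) :=
  FPIdal.liftMap _ (pathMap _ _ f₁ _ η) _ (.comp ((path_inverts_self _ _ _).tensor
    (path_inverts_other _ _ (J₁'.inverts_right J₂') _ π')) _) ≫
    (FPIdal.liftCompIso _ _ _ _ _).hom

/-- The morphism of tensor functors `C_{I₁ ⊗ I₂} ⟶ D_{J₁ ⊗ J₂}` induced by `η : H₂ ⟶ f₂^* H₂'`. -/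
def glueMap₂ {I₁ I₂ : FPIdal C} {J₁ J₂ J₁' J₂' : FPIdal D} {H : TensorFunctor I₂.Loc J₂.Loc}
    {H' : TensorFunctor I₂.Loc J₂'.Loc}
    (π : J₁.toIdal.map J₂.R ≅ (I₁.toIdal.map I₂.R).map H.toFunctor)
    (π' : J₁'.toIdal.map J₂'.R ≅ (I₁.toIdal.map I₂.R).map H'.toFunctor)
    (f₁ : J₁.toIdal ⟶ J₁'.toIdal) (f₂ : J₂.toIdal ⟶ J₂'.toIdal) (η : H ⟶ H'.comp (pull f₂)) :
    glue₂ H π ⟶ (glue₂ H' π').comp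
      (pull (FPIdal.tensorHom f₁ f₂)) :=
  FPIdal.liftMap _ (pathMap _ _ f₂ _ η) _ (.comp ((path_inverts_other _ _
    (J₁'.inverts_left J₂') _ π').tensor (path_inverts_self _ _ _)) _) ≫
    (FPIdal.liftCompIso _ _ _ _ _).hom

/-- A local datum with respect to the idals `I₁` and `I₂` of `C`: a finitely presentable idal cover
`J₁`, `J₂` of `D`, cocontinuous tensor functors `Hᵢ : C_{Iᵢ} ⟶ D_{Jᵢ}` preserving finitely presentable
objects, isomorphisms of idals `π₁ : R_{J₁} J₂ ≅ H₁ (R_{I₁} I₂)` and `π₂ : R_{J₂} J₁ ≅ H₂ (R_{I₂} I₁)`,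
and an isomorphism `δ` between the two induced tensor functors `C_{I₁ ⊗ I₂} ⟶ D_{J₁ ⊗ J₂}`. -/
structure LocalDatum (I₁ I₂ : FPIdal C) (D : Type u₂) [Category.{v} D] [MonoidalCategory D]
    [SymmetricCategory D] [LFPTensorCategory D] where
  J₁ : FPIdal D
  J₂ : FPIdal D
  cover : J₁.toIdal.IsCover J₂.toIdal
  H₁ : TensorFunctor I₁.Loc J₁.Loc
  H₂ : TensorFunctor I₂.Loc J₂.Loc
  fp₁ : TensorFunctor.preservesFP H₁
  fp₂ : TensorFunctor.preservesFP H₂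
  π₁ : J₂.toIdal.map J₁.R ≅ (I₂.toIdal.map I₁.R).map H₁.toFunctor
  π₂ : J₁.toIdal.map J₂.R ≅ (I₁.toIdal.map I₂.R).map H₂.toFunctor
  δ : glue₁ H₁ π₁ ≅ glue₂ H₂ π₂

namespace LocalDatum

variable {I₁ I₂ : FPIdal C}

/-- Morphisms of local data: morphisms of idals `fᵢ : Jᵢ ⟶ Jᵢ'` and morphisms of tensor functors
`ηᵢ : Hᵢ ⟶ fᵢ^* Hᵢ'` which are compatible with `π₁`, `π₂` and `δ`. -/
@[ext]
structure Hom (X Y : LocalDatum I₁ I₂ D) where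
  f₁ : X.J₁.toIdal ⟶ Y.J₁.toIdal
  f₂ : X.J₂.toIdal ⟶ Y.J₂.toIdal
  η₁ : X.H₁ ⟶ Y.H₁.comp (pull f₁)
  η₂ : X.H₂ ⟶ Y.H₂.comp (pull f₂)
  comm₁ : X.π₁.hom.hom ≫ η₁.hom.app (I₁.R.obj I₂.obj) =
    X.J₁.R.map f₂.hom ≫
      (transIso X.J₁ Y.J₁ (X.J₁.loc_inverts.of_hom f₁)).hom.hom.app Y.J₂.obj ≫
        (pull f₁).toFunctor.map Y.π₁.hom.hom
  comm₂ : X.π₂.hom.hom ≫ η₂.hom.app (I₂.R.obj I₁.obj) =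
    X.J₂.R.map f₁.hom ≫
      (transIso X.J₂ Y.J₂ (X.J₂.loc_inverts.of_hom f₂)).hom.hom.app Y.J₁.obj ≫
        (pull f₂).toFunctor.map Y.π₂.hom.hom
  comm : X.δ.hom ≫ glueMap₂ X.π₂ Y.π₂ f₁ f₂ η₂ =
    glueMap₁ X.π₁ Y.π₁ f₁ f₂ η₁ ≫ TensorFunctor.whiskerRight Y.δ.hom _

end LocalDatum

end

end Gluing

section DatumCategory

open FPIdal

variable {C : Type u₁} [Category.{v} C] [MonoidalCategory C] [SymmetricCategory C]
  [LFPTensorCategory C]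
  {D : Type u₂} [Category.{v} D] [MonoidalCategory D] [SymmetricCategory D] [LFPTensorCategory D]

noncomputable section

namespace FPIdal

/-- The isomorphism `R_L A ≅ R_L (R_J A)`. -/
def cIso (L J : FPIdal D) (h : L.loc.Inverts J.toIdal) (A : D) :
    L.R.obj A ≅ L.R.obj (J.incl.obj (J.R.obj A)) where
  hom := (transIso L J h).hom.hom.app A
  inv := (transIso L J h).inv.hom.app A
  hom_inv_id := congrArg (fun t => t.hom.app A) (transIso L J h).hom_inv_id
  inv_hom_id := congrArg (fun t => t.hom.app A) (transIso L J h).inv_hom_id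

lemma transIso_hom_eq (L J : FPIdal D) (h : L.loc.Inverts J.toIdal) (A : D) :
    (transIso L J h).hom.hom.app A = (cIso L J h A).hom := rfl

lemma transComp_hom_app (J J' J'' : FPIdal D) (h : J.loc.Inverts J'.toIdal)
    (h' : J'.loc.Inverts J''.toIdal) (h'' : J.loc.Inverts J''.toIdal) (M : J''.Loc) :
    (transComp J J' J'' h h' h'').hom.hom.app M = (cIso J J' h (J''.incl.obj M)).inv := by
  change 𝟙 _ ≫ (transIso J J' h).inv.hom.app _ = _
  rw [Category.id_comp]
  rfl

lemma transComp_inv_app' (J J' J'' : FPIdal D) (h : J.loc.Inverts J'.toIdal)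
    (h' : J'.loc.Inverts J''.toIdal) (h'' : J.loc.Inverts J''.toIdal) (M : J''.Loc) :
    (transComp J J' J'' h h' h'').inv.hom.app M = (cIso J J' h (J''.incl.obj M)).hom :=
  transComp_inv_app ..

lemma cIso_hom (L J : FPIdal D) (h : L.loc.Inverts J.toIdal) (A : D) :
    (cIso L J h A).hom = L.R.map (J.adj.unit.app A) := rfl

lemma map_R (L J : FPIdal D) (h : L.loc.Inverts J.toIdal) {A B : D} (g : A ⟶ B) :
    L.R.map (J.incl.map (J.R.map g)) = (cIso L J h A).inv ≫ L.R.map g ≫ (cIso L J h B).hom := by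
  rw [Iso.eq_inv_comp]
  exact ((transIso L J h).hom.hom.naturality g).symm

lemma map_cIso_hom (L J J' : FPIdal D) (h : L.loc.Inverts J.toIdal) (h' : J.loc.Inverts J'.toIdal)
    (h'' : L.loc.Inverts J'.toIdal) (A : D) :
    L.R.map (J.incl.map (cIso J J' h' A).hom) =
      (cIso L J h A).inv ≫ (cIso L J' h'' A).hom ≫ (cIso L J h _).hom :=
  map_R ..

lemma map_cIso_inv (L J J' : FPIdal D) (h : L.loc.Inverts J.toIdal) (h' : J.loc.Inverts J'.toIdal)
    (h'' : L.loc.Inverts J'.toIdal) (A : D) :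
    L.R.map (J.incl.map (cIso J J' h' A).inv) =
      (cIso L J h _).inv ≫ (cIso L J' h'' A).inv ≫ (cIso L J h A).hom := by
  rw [← cancel_epi (L.R.map (J.incl.map (cIso J J' h' A).hom)), ← Functor.map_comp,
    ← Functor.map_comp, Iso.hom_inv_id, map_cIso_hom L J J' h h' h'']
  simp

lemma cIso_self_hom_comp (J : FPIdal D) (h : J.loc.Inverts J.toIdal) (A : D) :
    (cIso J J h A).hom ≫ J.adj.counit.app (J.R.obj A) = 𝟙 _ :=
  J.adj.left_triangle_components A

/-- The isomorphism `R_J M ≅ M` for `M` in `D_J`. -/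
def dIso (J : FPIdal D) (M : J.Loc) : J.R.obj (J.incl.obj M) ≅ M where
  hom := J.adj.counit.app M
  inv := (transId J J.loc_inverts).inv.hom.app M
  hom_inv_id := congrArg (fun t => t.hom.app M) (transId J J.loc_inverts).hom_inv_id
  inv_hom_id := congrArg (fun t => t.hom.app M) (transId J J.loc_inverts).inv_hom_id

lemma dIso_inv_R (J : FPIdal D) (h : J.loc.Inverts J.toIdal) (A : D) :
    (dIso J (J.R.obj A)).inv = (cIso J J h A).hom := by
  rw [← Category.comp_id (dIso J (J.R.obj A)).inv, Iso.inv_comp_eq, ← Iso.comp_inv_eq,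
    Category.id_comp, ← cancel_epi (cIso J J h A).hom, Iso.hom_inv_id]
  exact (cIso_self_hom_comp J h A).symm

lemma incl_dIso_inv (J : FPIdal D) (M : J.Loc) :
    J.incl.map (dIso J M).inv = J.adj.unit.app (J.incl.obj M) := by
  rw [← cancel_mono (J.incl.map (dIso J M).hom), ← Functor.map_comp, Iso.inv_hom_id,
    CategoryTheory.Functor.map_id]
  exact (J.adj.right_triangle_components M).symm

lemma map_dIso_inv (L J : FPIdal D) (h : L.loc.Inverts J.toIdal) (M : J.Loc) :
    L.R.map (J.incl.map (dIso J M).inv) = (cIso L J h (J.incl.obj M)).hom := by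
  rw [incl_dIso_inv]
  rfl

lemma dIso_inv_naturality (J : FPIdal D) {M N : J.Loc} (f : M ⟶ N) :
    (dIso J M).inv ≫ J.R.map (J.incl.map f) = f ≫ (dIso J N).inv := by
  rw [Iso.inv_comp_eq, ← Category.assoc, Iso.eq_comp_inv]
  exact J.adj.counit.naturality f

end FPIdal

variable {I : FPIdal C} {J J' J'' L L' L'' : FPIdal D}

/-- The composition of morphisms `H ⟶ f^* H'` and `H' ⟶ f'^* H''`. -/
def pullComp {H : TensorFunctor I.Loc J.Loc} {H' : TensorFunctor I.Loc J'.Loc}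
    {H'' : TensorFunctor I.Loc J''.Loc} {f : J.toIdal ⟶ J'.toIdal} {f' : J'.toIdal ⟶ J''.toIdal}
    (η : H ⟶ H'.comp (pull f)) (θ : H' ⟶ H''.comp (pull f')) : H ⟶ H''.comp (pull (f ≫ f')) :=
  η ≫ TensorFunctor.whiskerRight θ (pull f) ≫ (TensorFunctor.assoc _ _ _).hom ≫
    H''.whiskerLeft (transComp J J' J'' _ _ _).hom

/-- The identity morphism `H ⟶ id^* H`. -/
def pullId (H : TensorFunctor I.Loc J.Loc) : H ⟶ H.comp (pull (𝟙 J.toIdal)) :=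
  (TensorFunctor.rightUnitor H).inv ≫
    H.whiskerLeft (transId J (J.loc_inverts.of_hom (𝟙 J.toIdal))).inv

lemma pullId_app (H : TensorFunctor I.Loc J.Loc) (M : I.Loc) :
    (pullId H).hom.app M = (dIso J (H.toFunctor.obj M)).inv := by
  change 𝟙 _ ≫ (transId J _).inv.hom.app _ = _
  rw [Category.id_comp]
  rfl

lemma pullComp_app {H : TensorFunctor I.Loc J.Loc} {H' : TensorFunctor I.Loc J'.Loc}
    {H'' : TensorFunctor I.Loc J''.Loc} {f : J.toIdal ⟶ J'.toIdal} {f' : J'.toIdal ⟶ J''.toIdal}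
    (η : H ⟶ H'.comp (pull f)) (θ : H' ⟶ H''.comp (pull f')) (M : I.Loc) :
    (pullComp η θ).hom.app M = η.hom.app M ≫ J.R.map (J'.incl.map (θ.hom.app M)) ≫
      (cIso J J' (J.loc_inverts.of_hom f) (J''.incl.obj (H''.toFunctor.obj M))).inv := by
  change _ ≫ _ ≫ 𝟙 _ ≫ (transComp J J' J'' _ _ _).hom.hom.app _ = _
  rw [Category.id_comp, transComp_hom_app]
  rfl

lemma pathMap_app (h : L.loc.Inverts J.toIdal)
    (h' : L'.loc.Inverts J'.toIdal) {H : TensorFunctor I.Loc J.Loc}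
    {H' : TensorFunctor I.Loc J'.Loc} (f : J.toIdal ⟶ J'.toIdal) (g : L.toIdal ⟶ L'.toIdal)
    (η : H ⟶ H'.comp (pull f)) (X : C) : (pathMap h h' f g η).hom.app X =
      L.R.map (J.incl.map (η.hom.app (I.R.obj X))) ≫ (cIso L J h _).inv ≫
        (cIso L L' (L.loc_inverts.of_hom g)
          (J'.incl.obj (H'.toFunctor.obj (I.R.obj X)))).hom := by
  change (_ ≫ 𝟙 _ ≫ ((transComp L J J' _ _ _).hom.hom.app _ ≫
    (transComp L L' J' _ _ _).inv.hom.app _) ≫ 𝟙 _) ≫ 𝟙 _ = _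
  rw [Category.id_comp, Category.comp_id, Category.comp_id, transComp_hom_app, transComp_inv_app']
  rfl

lemma pathMap_comp_aux (h : L.loc.Inverts J.toIdal) (h' : L'.loc.Inverts J'.toIdal)
    (hJ : J.loc.Inverts J'.toIdal) (hL : L.loc.Inverts L'.toIdal) (hL' : L'.loc.Inverts L''.toIdal)
    (hL'' : L.loc.Inverts L''.toIdal) (hLJ : L.loc.Inverts J'.toIdal)
    {N : J.Loc} {M : J'.Loc} {P : D} (a : N ⟶ J.R.obj (J'.incl.obj M)) (b : M ⟶ J'.R.obj P) :
    L.R.map (J.incl.map (a ≫ J.R.map (J'.incl.map b) ≫ (cIso J J' hJ P).inv)) ≫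
        (cIso L J h P).inv ≫ (cIso L L'' hL'' P).hom =
      (L.R.map (J.incl.map a) ≫ (cIso L J h _).inv ≫ (cIso L L' hL _).hom) ≫
        L.R.map (L'.incl.map (L'.R.map (J'.incl.map b) ≫ (cIso L' J' h' P).inv ≫
          (cIso L' L'' hL' P).hom)) ≫ (cIso L L' hL (L''.incl.obj (L''.R.obj P))).inv := by
  simp only [Functor.map_comp, Category.assoc]
  rw [map_R L J h (J'.incl.map b), map_R L L' hL (J'.incl.map b),
    map_cIso_inv L J J' h hJ hLJ, map_cIso_inv L L' J' hL h' hLJ, map_cIso_hom L L' L'' hL hL' hL'']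
  simp only [Category.assoc, Iso.hom_inv_id_assoc, Iso.hom_inv_id, Category.comp_id]

lemma pathMap_comp (h : L.loc.Inverts J.toIdal)
    (h' : L'.loc.Inverts J'.toIdal) (h'' : L''.loc.Inverts J''.toIdal)
    {H : TensorFunctor I.Loc J.Loc}
    {H' : TensorFunctor I.Loc J'.Loc} {H'' : TensorFunctor I.Loc J''.Loc}
    (f : J.toIdal ⟶ J'.toIdal) (f' : J'.toIdal ⟶ J''.toIdal)
    (g : L.toIdal ⟶ L'.toIdal) (g' : L'.toIdal ⟶ L''.toIdal) (g'' : L.toIdal ⟶ L''.toIdal)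
    (η : H ⟶ H'.comp (pull f)) (θ : H' ⟶ H''.comp (pull f')) (X : C) :
    (pathMap h h'' (f ≫ f') g'' (pullComp η θ)).hom.app X =
      (pathMap h h' f g η).hom.app X ≫ L.R.map (L'.incl.map ((pathMap h' h'' f' g' θ).hom.app X)) ≫
      (cIso L L' (L.loc_inverts.of_hom g) (L''.incl.obj ((path L'' h'' H'').toFunctor.obj X))).inv := by
  rw [pathMap_app, pathMap_app, pathMap_app, pullComp_app]
  exact pathMap_comp_aux h h' (J.loc_inverts.of_hom f) (L.loc_inverts.of_hom g)
    (L'.loc_inverts.of_hom g') (L.loc_inverts.of_hom g'') (h.of_hom f) _ _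

lemma pathMap_id_aux (h : L.loc.Inverts J.toIdal) (h' : L.loc.Inverts L.toIdal) (M : J.Loc) :
    L.R.map (J.incl.map (dIso J M).inv) ≫ (cIso L J h (J.incl.obj M)).inv ≫
      (cIso L L h' (J.incl.obj M)).hom = (dIso L (L.R.obj (J.incl.obj M))).inv := by
  rw [map_dIso_inv L J h, Iso.hom_inv_id_assoc, dIso_inv_R]

lemma pathMap_id (h : L.loc.Inverts J.toIdal) (H : TensorFunctor I.Loc J.Loc)
    (g : L.toIdal ⟶ L.toIdal) (X : C) :
    (pathMap h h (𝟙 _) g (pullId H)).hom.app X = (dIso L ((path L h H).toFunctor.obj X)).inv := by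
  rw [pathMap_app, pullId_app]
  exact pathMap_id_aux _ _ _

section

variable {I₁ I₂ : FPIdal C} {J₁ J₂ J₁' J₂' : FPIdal D}

lemma glueMap₁_app {H : TensorFunctor I₁.Loc J₁.Loc} {H' : TensorFunctor I₁.Loc J₁'.Loc}
    (π : J₂.toIdal.map J₁.R ≅ (I₂.toIdal.map I₁.R).map H.toFunctor)
    (π' : J₂'.toIdal.map J₁'.R ≅ (I₂.toIdal.map I₁.R).map H'.toFunctor)
    (f₁ : J₁.toIdal ⟶ J₁'.toIdal) (f₂ : J₂.toIdal ⟶ J₂'.toIdal) (η : H ⟶ H'.comp (pull f₁))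
    (M : (I₁.tensor I₂).Loc) : (glueMap₁ π π' f₁ f₂ η).hom.app M =
      (pathMap (L := J₁.tensor J₂) (L' := J₁'.tensor J₂') (J₁.inverts_left J₂)
        (J₁'.inverts_left J₂') f₁ (FPIdal.tensorHom f₁ f₂) η).hom.app
        ((I₁.tensor I₂).incl.obj M) :=
  Category.comp_id _

lemma glueMap₂_app {H : TensorFunctor I₂.Loc J₂.Loc} {H' : TensorFunctor I₂.Loc J₂'.Loc}
    (π : J₁.toIdal.map J₂.R ≅ (I₁.toIdal.map I₂.R).map H.toFunctor)
    (π' : J₁'.toIdal.map J₂'.R ≅ (I₁.toIdal.map I₂.R).map H'.toFunctor)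
    (f₁ : J₁.toIdal ⟶ J₁'.toIdal) (f₂ : J₂.toIdal ⟶ J₂'.toIdal) (η : H ⟶ H'.comp (pull f₂))
    (M : (I₁.tensor I₂).Loc) : (glueMap₂ π π' f₁ f₂ η).hom.app M =
      (pathMap (L := J₁.tensor J₂) (L' := J₁'.tensor J₂') (J₁.inverts_right J₂)
        (J₁'.inverts_right J₂') f₂ (FPIdal.tensorHom f₁ f₂) η).hom.app
        ((I₁.tensor I₂).incl.obj M) :=
  Category.comp_id _

end

namespace LocalDatum

variable {I₁ I₂ : FPIdal C}

lemma hom_ext_aux {X Y : LocalDatum I₁ I₂ D} {f g : Hom X Y} (h₁ : f.f₁ = g.f₁) (h₂ : f.f₂ = g.f₂)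
    (h₃ : ∀ M, f.η₁.hom.app M = g.η₁.hom.app M) (h₄ : ∀ M, f.η₂.hom.app M = g.η₂.hom.app M) :
    f = g := by
  obtain ⟨f₁, f₂, η₁, η₂, _, _, _⟩ := f
  obtain ⟨g₁, g₂, θ₁, θ₂, _, _, _⟩ := g
  obtain rfl : f₁ = g₁ := h₁
  obtain rfl : f₂ = g₂ := h₂
  obtain rfl : η₁ = θ₁ := TensorFunctor.hom_ext h₃
  obtain rfl : η₂ = θ₂ := TensorFunctor.hom_ext h₄
  rfl

lemma comm_id_aux {J : FPIdal D} {A : D} {M : J.Loc} (p : J.R.obj A ⟶ M)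
    (h : J.loc.Inverts J.toIdal) : p ≫ (dIso J M).inv =
      J.R.map (𝟙 A) ≫ (cIso J J h A).hom ≫ J.R.map (J.incl.map p) := by
  rw [CategoryTheory.Functor.map_id, Category.id_comp, ← dIso_inv_R, dIso_inv_naturality]

/-- The identity of a local datum. -/
def Hom.id (X : LocalDatum I₁ I₂ D) : Hom X X where
  f₁ := 𝟙 _
  f₂ := 𝟙 _
  η₁ := pullId _
  η₂ := pullId _
  comm₁ := by
    rw [pullId_app, transIso_hom_eq]
    exact comm_id_aux _ _
  comm₂ := by
    rw [pullId_app, transIso_hom_eq]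
    exact comm_id_aux _ _
  comm := by
    ext M
    change X.δ.hom.hom.app M ≫ (glueMap₂ _ _ _ _ _).hom.app M =
      (glueMap₁ _ _ _ _ _).hom.app M ≫
        (X.J₁.tensor X.J₂).R.map ((X.J₁.tensor X.J₂).incl.map (X.δ.hom.hom.app M))
    rw [glueMap₁_app, glueMap₂_app, pathMap_id, pathMap_id]
    exact (dIso_inv_naturality _ _).symm

lemma comm_comp_aux {J J' J'' : FPIdal D} {A A' A'' : D} {M : J.Loc} {M' : J'.Loc} {M'' : J''.Loc}
    {h : J.loc.Inverts J'.toIdal} {h' : J'.loc.Inverts J''.toIdal}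
    (h'' : J.loc.Inverts J''.toIdal)
    {f : A ⟶ A'} {f' : A' ⟶ A''} {p : J.R.obj A ⟶ M} {p' : J'.R.obj A' ⟶ M'}
    {p'' : J''.R.obj A'' ⟶ M''} {η : M ⟶ J.R.obj (J'.incl.obj M')}
    {θ : M' ⟶ J'.R.obj (J''.incl.obj M'')}
    (e : p ≫ η = J.R.map f ≫ (cIso J J' h A').hom ≫ J.R.map (J'.incl.map p'))
    (e' : p' ≫ θ = J'.R.map f' ≫ (cIso J' J'' h' A'').hom ≫ J'.R.map (J''.incl.map p'')) :
    p ≫ η ≫ J.R.map (J'.incl.map θ) ≫ (cIso J J' h (J''.incl.obj M'')).inv =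
      J.R.map (f ≫ f') ≫ (cIso J J'' h'' A'').hom ≫ J.R.map (J''.incl.map p'') := by
  rw [reassoc_of% e, ← Functor.map_comp_assoc, ← Functor.map_comp, e', Functor.map_comp,
    Functor.map_comp, Functor.map_comp, Functor.map_comp, map_R J J' h f',
    map_R J J' h (J''.incl.map p''), map_cIso_hom J J' J'' h h' h'']
  simp

lemma comm_comp_aux' {L L' L'' : FPIdal D} {A B : L.Loc} {A' B' : L'.Loc} {A'' B'' : L''.Loc}
    (h : L.loc.Inverts L'.toIdal)
    {δ : A ⟶ B} {δ' : A' ⟶ B'} {δ'' : A'' ⟶ B''}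
    {a : A ⟶ L.R.obj (L'.incl.obj A')} {b : B ⟶ L.R.obj (L'.incl.obj B')}
    {a' : A' ⟶ L'.R.obj (L''.incl.obj A'')} {b' : B' ⟶ L'.R.obj (L''.incl.obj B'')}
    (e : δ ≫ b = a ≫ L.R.map (L'.incl.map δ'))
    (e' : δ' ≫ b' = a' ≫ L'.R.map (L''.incl.map δ'')) :
    δ ≫ b ≫ L.R.map (L'.incl.map b') ≫ (cIso L L' h (L''.incl.obj B'')).inv =
      (a ≫ L.R.map (L'.incl.map a') ≫ (cIso L L' h (L''.incl.obj A'')).inv) ≫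
        L.R.map (L''.incl.map δ'') := by
  rw [reassoc_of% e, ← Functor.map_comp_assoc, ← Functor.map_comp, e', Functor.map_comp,
    Functor.map_comp, map_R L L' h]
  simp

/-- The composition of morphisms of local data. -/
def Hom.comp {X Y Z : LocalDatum I₁ I₂ D} (f : Hom X Y) (g : Hom Y Z) : Hom X Z where
  f₁ := f.f₁ ≫ g.f₁
  f₂ := f.f₂ ≫ g.f₂
  η₁ := pullComp f.η₁ g.η₁
  η₂ := pullComp f.η₂ g.η₂
  comm₁ := by
    rw [pullComp_app, transIso_hom_eq]
    exact comm_comp_aux (h' := Y.J₁.loc_inverts.of_hom g.f₁) _ f.comm₁ g.comm₁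
  comm₂ := by
    rw [pullComp_app, transIso_hom_eq]
    exact comm_comp_aux (h' := Y.J₂.loc_inverts.of_hom g.f₂) _ f.comm₂ g.comm₂
  comm := by
    ext M
    change X.δ.hom.hom.app M ≫ (glueMap₂ _ _ _ _ _).hom.app M =
      (glueMap₁ _ _ _ _ _).hom.app M ≫
        (X.J₁.tensor X.J₂).R.map ((Z.J₁.tensor Z.J₂).incl.map (Z.δ.hom.hom.app M))
    have e := congrArg (fun t => t.hom.app M) f.comm
    have e' := congrArg (fun t => t.hom.app M) g.comm
    rw [glueMap₁_app, glueMap₂_app,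
      pathMap_comp _ (Y.J₁.inverts_left Y.J₂) _ _ _ (FPIdal.tensorHom f.f₁ f.f₂)
        (FPIdal.tensorHom g.f₁ g.f₂),
      pathMap_comp _ (Y.J₁.inverts_right Y.J₂) _ _ _ (FPIdal.tensorHom f.f₁ f.f₂)
        (FPIdal.tensorHom g.f₁ g.f₂)]
    rw [← glueMap₁_app X.π₁ Y.π₁, ← glueMap₁_app Y.π₁ Z.π₁, ← glueMap₂_app X.π₂ Y.π₂,
      ← glueMap₂_app Y.π₂ Z.π₂]
    exact comm_comp_aux' _ e e'

lemma id_comp_aux {M : J.Loc} {P : D} (h : J.loc.Inverts J.toIdal) (t : M ⟶ J.R.obj P) :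
    (dIso J M).inv ≫ J.R.map (J.incl.map t) ≫ (cIso J J h P).inv = t := by
  rw [← Category.assoc, Iso.comp_inv_eq, dIso_inv_naturality, dIso_inv_R]

lemma comp_id_aux {M : J.Loc} {N : J'.Loc} (h : J.loc.Inverts J'.toIdal)
    (t : M ⟶ J.R.obj (J'.incl.obj N)) :
    t ≫ J.R.map (J'.incl.map (dIso J' N).inv) ≫ (cIso J J' h (J'.incl.obj N)).inv = t := by
  rw [map_dIso_inv J J' h, Iso.hom_inv_id, Category.comp_id]

lemma assoc_aux {J''' : FPIdal D} {A : J.Loc} {A' : J'.Loc} {A'' : J''.Loc} {A''' : J'''.Loc}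
    (h : J.loc.Inverts J'.toIdal) (h' : J'.loc.Inverts J''.toIdal) (h'' : J.loc.Inverts J''.toIdal)
    (r : A ⟶ J.R.obj (J'.incl.obj A')) (s : A' ⟶ J'.R.obj (J''.incl.obj A''))
    (t : A'' ⟶ J''.R.obj (J'''.incl.obj A''')) :
    (r ≫ J.R.map (J'.incl.map s) ≫ (cIso J J' h (J''.incl.obj A'')).inv) ≫
      J.R.map (J''.incl.map t) ≫ (cIso J J'' h'' (J'''.incl.obj A''')).inv =
    r ≫ J.R.map (J'.incl.map (s ≫ J'.R.map (J''.incl.map t) ≫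
      (cIso J' J'' h' (J'''.incl.obj A''')).inv)) ≫ (cIso J J' h (J'''.incl.obj A''')).inv := by
  simp only [Functor.map_comp, Category.assoc]
  rw [map_R J J' h, map_cIso_inv J J' J'' h h' h'']
  simp

instance : Category (LocalDatum I₁ I₂ D) where
  Hom := Hom
  id := Hom.id
  comp := Hom.comp
  id_comp f := by
    refine hom_ext_aux (Category.id_comp _) (Category.id_comp _) (fun M => ?_) fun M => ?_
    · exact (pullComp_app (pullId _) f.η₁ M).trans
        ((congrArg (· ≫ _) (pullId_app _ M)).trans (id_comp_aux _ _))
    · exact (pullComp_app (pullId _) f.η₂ M).trans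
        ((congrArg (· ≫ _) (pullId_app _ M)).trans (id_comp_aux _ _))
  comp_id {X Y} f := by
    refine hom_ext_aux (Category.comp_id _) (Category.comp_id _) (fun M => ?_) fun M => ?_
    · refine (pullComp_app f.η₁ (pullId _) M).trans ?_
      rw [pullId_app]
      exact comp_id_aux _ _
    · refine (pullComp_app f.η₂ (pullId _) M).trans ?_
      rw [pullId_app]
      exact comp_id_aux _ _
  assoc {W X Y Z} f g h := by
    refine hom_ext_aux (Category.assoc _ _ _) (Category.assoc _ _ _) (fun M => ?_) fun M => ?_
    · refine (pullComp_app (pullComp f.η₁ g.η₁) h.η₁ M).trans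
        (.trans ?_ (pullComp_app f.η₁ (pullComp g.η₁ h.η₁) M).symm)
      rw [pullComp_app, pullComp_app]
      exact assoc_aux _ _ _ _ _ _
    · refine (pullComp_app (pullComp f.η₂ g.η₂) h.η₂ M).trans
        (.trans ?_ (pullComp_app f.η₂ (pullComp g.η₂ h.η₂) M).symm)
      rw [pullComp_app, pullComp_app]
      exact assoc_aux _ _ _ _ _ _

end LocalDatum

end

end DatumCategory

section Restriction

open FPIdal

variable {C : Type u₁} [Category.{v} C] [MonoidalCategory C] [SymmetricCategory C]
  [LFPTensorCategory C]
  {D : Type u₂} [Category.{v} D] [MonoidalCategory D] [SymmetricCategory D]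

namespace FPIdal

open Cardinal in
attribute [local instance] fact_isRegular_aleph0 in
lemma isFinitelyPresentable_R (J : FPIdal C) (X : C) (hX : IsFinitelyPresentable.{v} X) :
    IsFinitelyPresentable.{v} (J.R.obj X) := by
  have := J.isFinitelyAccessible_ι
  have : J.incl.IsCardinalAccessible ℵ₀ := this
  exact J.adj.isCardinalPresentable_leftAdjoint_obj ℵ₀ X

open Cardinal in
attribute [local instance] fact_isRegular_aleph0 in
/-- Every finitely presentable object of `C_J` is a retract of some `R_J X` with `X` finitely
presentable. -/
lemma exists_retract (J : FPIdal C) (M : J.Loc) (hM : IsFinitelyPresentable.{v} M) :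
    ∃ X : C, IsFinitelyPresentable.{v} X ∧ Nonempty (Retract M (J.R.obj X)) := by
  have := LFPTensorCategory.locallyFinitelyPresentable (C := C)
  obtain ⟨P, _, hP⟩ := HasCardinalFilteredGenerator.exists_small_generator C ℵ₀
  obtain ⟨A, _, _, ⟨p⟩⟩ := hP.exists_colimitsOfShape (J.incl.obj M)
  have hc := isColimitOfPreserves J.R p.isColimit
  obtain ⟨a, s, hs⟩ := IsCardinalPresentable.exists_hom_of_isColimit ℵ₀ hc
    (inv (J.adj.counit.app M))
  have ha : IsFinitelyPresentable.{v} (p.diag.obj a) :=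
    hP.le_isCardinalPresentable _ (p.prop_diag_obj a)
  refine ⟨_, ha, ⟨⟨s, J.R.map (p.ι.app a) ≫ J.adj.counit.app M, ?_⟩⟩⟩
  have hs' : s ≫ J.R.map (p.ι.app a) = inv (J.adj.counit.app M) := hs
  rw [reassoc_of% hs', IsIso.inv_hom_id]

open Cardinal in
attribute [local instance] fact_isRegular_aleph0 in
lemma lift_preservesFP (J : FPIdal C) (F : TensorFunctor C D) (h : F.Inverts J.toIdal)
    (hF : TensorFunctor.preservesFP F) : TensorFunctor.preservesFP (J.lift F h) := by
  intro M hM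
  obtain ⟨X, hX, ⟨r⟩⟩ := J.exists_retract M hM
  have h₁ : IsFinitelyPresentable.{v} (F.toFunctor.obj X) := hF X hX
  have h₂ : IsFinitelyPresentable.{v} ((J.lift F h).toFunctor.obj (J.R.obj X)) :=
    isCardinalPresentable_of_iso ((J.liftFunctorIso F h).app X) ℵ₀
  exact (r.map (J.lift F h).toFunctor).isCardinalPresentable ℵ₀

end FPIdal

/-- The morphism of idals induced by a morphism of tensor functors. -/
def TensorFunctor.Hom.idal {F G : TensorFunctor C D} (τ : F ⟶ G) (I : Idal C) :
    I.map F.toFunctor ⟶ I.map G.toFunctor where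
  hom := τ.hom.app I.obj
  w := by
    change τ.hom.app I.obj ≫ G.toFunctor.map I.hom ≫ Functor.OplaxMonoidal.η G.toFunctor =
      F.toFunctor.map I.hom ≫ Functor.OplaxMonoidal.η F.toFunctor
    rw [← τ.hom.naturality_assoc]
    congr 1
    rw [← cancel_epi (Functor.LaxMonoidal.ε F.toFunctor), Functor.Monoidal.ε_η,
      NatTrans.IsMonoidal.unit_assoc, Functor.Monoidal.ε_η]

lemma Idal.IsCover.map {I J : Idal C} (h : I.IsCover J) (F : TensorFunctor C D) :
    (I.map F.toFunctor).IsCover (J.map F.toFunctor) := by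
  refine (IsPushout.map F.toFunctor h).of_iso (Functor.Monoidal.μIso F.toFunctor _ _).symm
    (Iso.refl _) (Iso.refl _) (Functor.Monoidal.εIso F.toFunctor).symm ?_ ?_ ?_ ?_
  · change F.toFunctor.map (I.obj ◁ J.hom ≫ (ρ_ I.obj).hom) ≫ 𝟙 _ =
      Functor.OplaxMonoidal.δ F.toFunctor _ _ ≫
      (F.toFunctor.obj I.obj ◁ (F.toFunctor.map J.hom ≫ Functor.OplaxMonoidal.η F.toFunctor) ≫
        (ρ_ _).hom)
    rw [Category.comp_id, F.toFunctor.map_comp, Functor.Monoidal.map_whiskerLeft,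
      Functor.Monoidal.map_rightUnitor]
    simp
  · change F.toFunctor.map (I.hom ▷ J.obj ≫ (λ_ J.obj).hom) ≫ 𝟙 _ =
      Functor.OplaxMonoidal.δ F.toFunctor _ _ ≫
      ((F.toFunctor.map I.hom ≫ Functor.OplaxMonoidal.η F.toFunctor) ▷ F.toFunctor.obj J.obj  ≫
        (λ_ _).hom)
    rw [Category.comp_id, F.toFunctor.map_comp, Functor.Monoidal.map_whiskerRight,
      Functor.Monoidal.map_leftUnitor]
    simp
  · exact (Category.id_comp _).symm
  · exact (Category.id_comp _).symm

end Restriction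

section RestrictionFunctor

open FPIdal

variable {C : Type u₁} [Category.{v} C] [MonoidalCategory C] [SymmetricCategory C]
  {D : Type u₂} [Category.{v} D] [MonoidalCategory D] [SymmetricCategory D]
  {E : Type u} [Category.{v} E] [MonoidalCategory E] [SymmetricCategory E]
  {E' : Type w} [Category.{v} E'] [MonoidalCategory E'] [SymmetricCategory E']

lemma Idal.map_map_hom (I : Idal C) (F : TensorFunctor C D) (G : TensorFunctor D E) :
    ((I.map F.toFunctor).map G.toFunctor).hom = (I.map (F.comp G).toFunctor).hom := by
  change G.toFunctor.map (F.toFunctor.map I.hom ≫ Functor.OplaxMonoidal.η F.toFunctor) ≫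
    Functor.OplaxMonoidal.η G.toFunctor = G.toFunctor.map (F.toFunctor.map I.hom) ≫
      G.toFunctor.map (Functor.OplaxMonoidal.η F.toFunctor) ≫ Functor.OplaxMonoidal.η G.toFunctor
  rw [G.toFunctor.map_comp, Category.assoc]

lemma iso_hom_inv_app {F G : TensorFunctor C D} (e : F ≅ G) (X : C) :
    e.hom.hom.app X ≫ e.inv.hom.app X = 𝟙 _ :=
  congrArg (fun t => t.hom.app X) e.hom_inv_id

lemma iso_inv_hom_app {F G : TensorFunctor C D} (e : F ≅ G) (X : C) :
    e.inv.hom.app X ≫ e.hom.hom.app X = 𝟙 _ :=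
  congrArg (fun t => t.hom.app X) e.inv_hom_id

/-- A square of tensor functors, commuting up to isomorphism, induces isomorphisms of idals. -/
def Idal.mapSquareIso (I : Idal C) {F : TensorFunctor C D} {G : TensorFunctor D E}
    {F' : TensorFunctor C E'} {G' : TensorFunctor E' E} (e : F.comp G ≅ F'.comp G') :
    (I.map F.toFunctor).map G.toFunctor ≅ (I.map F'.toFunctor).map G'.toFunctor where
  hom := ⟨e.hom.hom.app I.obj, by
    rw [Idal.map_map_hom, Idal.map_map_hom]
    exact (e.hom.idal I).w⟩
  inv := ⟨e.inv.hom.app I.obj, by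
    rw [Idal.map_map_hom, Idal.map_map_hom]
    exact (e.inv.idal I).w⟩
  hom_inv_id := Idal.Hom.ext (congrArg (fun t => t.hom.app I.obj) e.hom_inv_id)
  inv_hom_id := Idal.Hom.ext (congrArg (fun t => t.hom.app I.obj) e.inv_hom_id)

variable [LFPTensorCategory C] [LFPTensorCategory D]

lemma id_cancel₁ {A : Type u₁} [Category.{v} A] {X Y Z : A} (f : X ⟶ Y) (g : Y ⟶ Z) : f ≫ 𝟙 _ ≫ g ≫ 𝟙 _ = f ≫ g := by simp

lemma id_cancel₂ {A : Type u₁} [Category.{v} A] {X Y Z : A} (f : X ⟶ Y) (g : Y ⟶ Z) : (f ≫ g ≫ 𝟙 _) ≫ 𝟙 _ = f ≫ g := by simp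

noncomputable section

section

variable (F : TensorFunctor C D) (hF : TensorFunctor.preservesFP F) (I : FPIdal C)

lemma restr_inverts : (F.comp (I.map F hF).loc).Inverts I.toIdal :=
  .comp_of_map (I.map F hF).loc_inverts

/-- The functor `C_I ⟶ D_{F(I)}` induced by `F`. -/
def restr : TensorFunctor I.Loc (I.map F hF).Loc :=
  I.lift (F.comp (I.map F hF).loc) (restr_inverts F hF I)

/-- The isomorphism `R_{F(I)} ∘ F ≅ F_I ∘ R_I`. -/
def restrIso : F.comp (I.map F hF).loc ≅ I.loc.comp (restr F hF I) :=
  I.liftIso _ (restr_inverts F hF I)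

lemma restr_preservesFP : TensorFunctor.preservesFP (restr F hF I) :=
  lift_preservesFP _ _ _ fun X hX => isFinitelyPresentable_R _ _ (hF X hX)

/-- For `J = F(I)` and an idal `L` whose localization inverts `J`, the composition
`C ⟶ C_I ⟶ D_J ⟶ D_L` is isomorphic to `R_L ∘ F`. -/
def restrPathIso (L : FPIdal D) (h : L.loc.Inverts (I.map F hF).toIdal) :
    F.comp L.loc ≅ path L h (restr F hF I) :=
  F.whiskerLeftIso (transIso L (I.map F hF) h) ≪≫ (TensorFunctor.assoc _ _ _).symm ≪≫
    TensorFunctor.whiskerRightIso (restrIso F hF I) (trans L (I.map F hF) h) ≪≫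
    TensorFunctor.assoc _ _ _

lemma restrPathIso_hom_app (L : FPIdal D) (h : L.loc.Inverts (I.map F hF).toIdal) (X : C) :
    (restrPathIso F hF I L h).hom.hom.app X = (cIso L (I.map F hF) h (F.toFunctor.obj X)).hom ≫
      L.R.map ((I.map F hF).incl.map ((I.map F hF).R.map (F.toFunctor.map (I.adj.unit.app X)))) := by
  exact id_cancel₁ _ _

end

/-- The local datum associated to a cocontinuous tensor functor. -/
def restrictObj (I₁ I₂ : FPIdal C) (hI : I₁.toIdal.IsCover I₂.toIdal) (F : TensorFunctor C D)
    (hF : TensorFunctor.preservesFP F) : LocalDatum I₁ I₂ D where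
  J₁ := I₁.map F hF
  J₂ := I₂.map F hF
  cover := hI.map F
  H₁ := restr F hF I₁
  H₂ := restr F hF I₂
  fp₁ := restr_preservesFP F hF I₁
  fp₂ := restr_preservesFP F hF I₂
  π₁ := I₂.toIdal.mapSquareIso (restrIso F hF I₁)
  π₂ := I₁.toIdal.mapSquareIso (restrIso F hF I₂)
  δ := (I₁.tensor I₂).liftMapIso ((restrPathIso F hF I₁ _ _).symm ≪≫ restrPathIso F hF I₂ _ _) _ _

variable {F G : TensorFunctor C D} (hF : TensorFunctor.preservesFP F)
  (hG : TensorFunctor.preservesFP G)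

/-- The morphism of idals `F(I) ⟶ G(I)`. -/
def mapIdal (τ : F ⟶ G) (I : FPIdal C) : (I.map F hF).toIdal ⟶ (I.map G hG).toIdal :=
  τ.idal I.toIdal

/-- The morphism `F_I ⟶ f^* G_I` induced by `τ : F ⟶ G`, where `f : F(I) ⟶ G(I)` is the component
of `τ` at `I`. -/
def restrMap (τ : F ⟶ G) (I : FPIdal C) : restr F hF I ⟶ (restr G hG I).comp
    (pull (mapIdal hF hG τ I)) :=
  FPIdal.liftMap _ (TensorFunctor.whiskerRight τ (I.map F hF).loc ≫
      G.whiskerLeft (transIso (I.map F hF) (I.map G hG) _).hom ≫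
      (TensorFunctor.assoc _ _ _).inv) _ ((restr_inverts G hG I).comp _) ≫
    (FPIdal.liftCompIso _ _ _ _ _).hom

lemma restrMap_app (τ : F ⟶ G) (I : FPIdal C) (M : I.Loc) :
    (restrMap hF hG τ I).hom.app M = (I.map F hF).R.map (τ.hom.app (I.incl.obj M)) ≫
      (cIso (I.map F hF) (I.map G hG) ((I.map F hF).loc_inverts.of_hom (mapIdal hF hG τ I))
        (G.toFunctor.obj (I.incl.obj M))).hom := by
  exact id_cancel₂ _ _

lemma restrPath_aux {J J' L L' : FPIdal D} (h : L.loc.Inverts J.toIdal)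
    (h' : L'.loc.Inverts J'.toIdal) (hJ : J.loc.Inverts J'.toIdal) (hL : L.loc.Inverts L'.toIdal)
    (hLJ : L.loc.Inverts J'.toIdal)
    {A A' B B' : D} {a : A ⟶ A'} {b : B ⟶ B'} {t : A ⟶ B} {t' : A' ⟶ B'} (e : a ≫ t' = t ≫ b) :
    ((cIso L J h A).hom ≫ L.R.map (J.incl.map (J.R.map a))) ≫
      L.R.map (J.incl.map (J.R.map t' ≫ (cIso J J' hJ B').hom)) ≫ (cIso L J h _).inv ≫
        (cIso L L' hL (J'.incl.obj (J'.R.obj B'))).hom =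
    L.R.map t ≫ (cIso L L' hL B).hom ≫ L.R.map (L'.incl.map
      ((cIso L' J' h' B).hom ≫ L'.R.map (J'.incl.map (J'.R.map b)))) := by
  simp only [Functor.map_comp, Category.assoc]
  rw [map_R L J h, map_R L J h, map_cIso_hom L J J' h hJ hLJ, map_cIso_hom L L' J' hL h' hLJ,
    map_R L L' hL, map_R L J' hLJ]
  simp only [Category.assoc, Iso.hom_inv_id_assoc]
  rw [← Functor.map_comp_assoc, e, Functor.map_comp_assoc]

lemma restrPath_comm (τ : F ⟶ G) (I : FPIdal C) {L L' : FPIdal D} (g : L.toIdal ⟶ L'.toIdal)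
    (h : L.loc.Inverts (I.map F hF).toIdal) (h' : L'.loc.Inverts (I.map G hG).toIdal) (X : C) :
    (restrPathIso F hF I L h).hom.hom.app X ≫
      (pathMap h h' (mapIdal hF hG τ I) g (restrMap hF hG τ I)).hom.app X =
    L.R.map (τ.hom.app X) ≫ (cIso L L' (L.loc_inverts.of_hom g) _).hom ≫
      L.R.map (L'.incl.map ((restrPathIso G hG I L' h').hom.hom.app X)) := by
  rw [restrPathIso_hom_app, restrPathIso_hom_app, pathMap_app, restrMap_app]
  exact restrPath_aux h h' _ _ (h.of_hom (mapIdal hF hG τ I))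
    (τ.hom.naturality (I.adj.unit.app X))

lemma restr_comm_aux {J J' : FPIdal D} (h : J.loc.Inverts J'.toIdal)
    {A A' B B' : D} {a : A ⟶ A'} {b : B ⟶ B'} {t : A ⟶ B} {t' : A' ⟶ B'} (e : a ≫ t' = t ≫ b) :
    J.R.map a ≫ J.R.map t' ≫ (cIso J J' h B').hom =
      J.R.map t ≫ (cIso J J' h B).hom ≫ J.R.map (J'.incl.map (J'.R.map b)) := by
  rw [map_R J J' h, Iso.hom_inv_id_assoc, ← Functor.map_comp_assoc, e, Functor.map_comp_assoc]

lemma restr_comm_aux' {L L' : FPIdal D} {A₁ A₂ B : L.Loc} {A₁' A₂' B' : L'.Loc}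
    {p₁ : B ⟶ A₁} {p₁' : A₁ ⟶ B} (hp₁ : p₁' ≫ p₁ = 𝟙 _) {p₂ : B ⟶ A₂}
    {q₁ : B' ⟶ A₁'} {q₁' : A₁' ⟶ B'} (hq₁ : q₁ ≫ q₁' = 𝟙 _) {q₂ : B' ⟶ A₂'}
    {m₁ : A₁ ⟶ L.R.obj (L'.incl.obj A₁')} {m₂ : A₂ ⟶ L.R.obj (L'.incl.obj A₂')}
    {t : B ⟶ L.R.obj (L'.incl.obj B')}
    (h₁ : p₁ ≫ m₁ = t ≫ L.R.map (L'.incl.map q₁))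
    (h₂ : p₂ ≫ m₂ = t ≫ L.R.map (L'.incl.map q₂)) :
    (p₁' ≫ p₂) ≫ m₂ = m₁ ≫ L.R.map (L'.incl.map (q₁' ≫ q₂)) := by
  have : m₁ = p₁' ≫ t ≫ L.R.map (L'.incl.map q₁) := by rw [← h₁, reassoc_of% hp₁]
  rw [this, Category.assoc, h₂, Category.assoc, Category.assoc, ← Functor.map_comp,
    ← Functor.map_comp, reassoc_of% hq₁]

/-- The morphism of local data associated to a morphism of tensor functors. -/
def restrictMap (I₁ I₂ : FPIdal C) (hI : I₁.toIdal.IsCover I₂.toIdal) (τ : F ⟶ G) :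
    LocalDatum.Hom (restrictObj I₁ I₂ hI F hF) (restrictObj I₁ I₂ hI G hG) where
  f₁ := mapIdal hF hG τ I₁
  f₂ := mapIdal hF hG τ I₂
  η₁ := restrMap hF hG τ I₁
  η₂ := restrMap hF hG τ I₂
  comm₁ := by
    rw [restrMap_app, transIso_hom_eq]
    exact restr_comm_aux _ (τ.hom.naturality (I₁.adj.unit.app I₂.obj))
  comm₂ := by
    rw [restrMap_app, transIso_hom_eq]
    exact restr_comm_aux _ (τ.hom.naturality (I₂.adj.unit.app I₁.obj))
  comm := by
    ext M
    change (restrictObj I₁ I₂ hI F hF).δ.hom.hom.app M ≫ (glueMap₂ _ _ _ _ _).hom.app M =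
      (glueMap₁ _ _ _ _ _).hom.app M ≫
        ((I₁.map F hF).tensor (I₂.map F hF)).R.map
          (((I₁.map G hG).tensor (I₂.map G hG)).incl.map
            ((restrictObj I₁ I₂ hI G hG).δ.hom.hom.app M))
    refine (congrArg (_ ≫ ·) (glueMap₂_app _ _ _ _ _ M)).trans
      (Eq.trans ?_ (congrArg (· ≫ _) (glueMap₁_app _ _ _ _ _ M).symm))
    exact restr_comm_aux'
      (iso_inv_hom_app (restrPathIso F hF I₁ _ (inverts_left _ (I₂.map F hF))) _)
      (iso_hom_inv_app (restrPathIso G hG I₁ _ (inverts_left _ (I₂.map G hG))) _)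
      ((restrPath_comm hF hG τ I₁
        (FPIdal.tensorHom (mapIdal hF hG τ I₁) (mapIdal hF hG τ I₂)) _ _ _).trans
          (Category.assoc _ _ _).symm)
      ((restrPath_comm hF hG τ I₂
        (FPIdal.tensorHom (mapIdal hF hG τ I₁) (mapIdal hF hG τ I₂)) _ _ _).trans
          (Category.assoc _ _ _).symm)

lemma restr_id_aux {J : FPIdal D} (h : J.loc.Inverts J.toIdal) (A : D) :
    J.R.map (𝟙 A) ≫ (cIso J J h A).hom = (dIso J (J.R.obj A)).inv := by
  rw [CategoryTheory.Functor.map_id, Category.id_comp, dIso_inv_R]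

lemma restr_comp_aux {J J' J'' : FPIdal D} (h : J.loc.Inverts J'.toIdal)
    (h' : J'.loc.Inverts J''.toIdal) (h'' : J.loc.Inverts J''.toIdal) {A A' A'' : D}
    (t : A ⟶ A') (t' : A' ⟶ A'') :
    J.R.map (t ≫ t') ≫ (cIso J J'' h'' A'').hom =
      (J.R.map t ≫ (cIso J J' h A').hom) ≫
        J.R.map (J'.incl.map (J'.R.map t' ≫ (cIso J' J'' h' A'').hom)) ≫
          (cIso J J' h (J''.incl.obj (J''.R.obj A''))).inv := by
  simp only [Functor.map_comp, Category.assoc]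
  rw [map_R J J' h, map_cIso_hom J J' J'' h h' h'']
  simp

/-- The functor from the category of cocontinuous tensor functors `C ⟶ D` preserving finitely
presentable objects to the category of local data. It maps `F` to the idals `F(I₁)`, `F(I₂)`, the
induced functors `C_{Iᵢ} ⟶ D_{F(Iᵢ)}` and the canonical isomorphisms. -/
def restrict (I₁ I₂ : FPIdal C) (hI : I₁.toIdal.IsCover I₂.toIdal) (D : Type u₂) [Category.{v} D]
    [MonoidalCategory D] [SymmetricCategory D] [LFPTensorCategory D] :
    (TensorFunctor.preservesFP (C := C) (D := D)).FullSubcategory ⥤ LocalDatum I₁ I₂ D where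
  obj F := restrictObj I₁ I₂ hI F.obj F.property
  map {F G} τ := restrictMap F.property G.property I₁ I₂ hI τ.hom
  map_id F := by
    refine LocalDatum.hom_ext_aux rfl rfl (fun M => ?_) fun M => ?_
    · exact (restrMap_app F.property F.property (𝟙 F.obj) I₁ M).trans
        ((restr_id_aux _ _).trans (pullId_app (restr F.obj F.property I₁) M).symm)
    · exact (restrMap_app F.property F.property (𝟙 F.obj) I₂ M).trans
        ((restr_id_aux _ _).trans (pullId_app (restr F.obj F.property I₂) M).symm)
  map_comp {F G H} σ τ := by
    refine LocalDatum.hom_ext_aux rfl rfl (fun M => ?_) fun M => ?_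
    · refine (restrMap_app F.property H.property (σ.hom ≫ τ.hom) I₁ M).trans
        (Eq.trans ?_ (pullComp_app (restrMap F.property G.property σ.hom I₁)
          (restrMap G.property H.property τ.hom I₁) M).symm)
      rw [restrMap_app, restrMap_app]
      exact restr_comp_aux _ _ _ _ _
    · refine (restrMap_app F.property H.property (σ.hom ≫ τ.hom) I₂ M).trans
        (Eq.trans ?_ (pullComp_app (restrMap F.property G.property σ.hom I₂)
          (restrMap G.property H.property τ.hom I₂) M).symm)
      rw [restrMap_app, restrMap_app]
      exact restr_comp_aux _ _ _ _ _

end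

end RestrictionFunctor

section LinearCase

open FPIdal

variable (K : Type w) [CommRing K]
  {C : Type u₁} [Category.{v} C] [MonoidalCategory C] [SymmetricCategory C]
  [LFPTensorCategory C] [Preadditive C] [Linear K C]
  {D : Type u₂} [Category.{v} D] [MonoidalCategory D] [SymmetricCategory D] [LFPTensorCategory D]
  [Preadditive D] [Linear K D]

noncomputable section

namespace FPIdal

variable (J : FPIdal C)

instance : Preadditive J.Loc := inferInstanceAs (Preadditive J.isLocal.FullSubcategory)

instance : Linear K J.Loc := inferInstanceAs (Linear K J.isLocal.FullSubcategory)

instance : J.incl.Additive where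
  map_add := rfl

instance : J.incl.Linear K where
  map_smul _ _ := rfl

instance : J.R.Additive := J.adj.left_adjoint_additive

instance : J.R.Linear K where
  map_smul f r := by
    apply (J.adj.homEquiv _ _).injective
    rw [Adjunction.homEquiv_unit, Adjunction.homEquiv_unit, J.incl.map_smul, Linear.comp_smul,
      Adjunction.unit_naturality, Adjunction.unit_naturality, Linear.smul_comp]

end FPIdal

/-- The `K`-linear tensor functors. -/
def TensorFunctor.isLinear : ObjectProperty (TensorFunctor C D) := fun F =>
  F.toFunctor.Additive ∧ F.toFunctor.Linear K

/-- The local data whose functors are `K`-linear. -/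
def LocalDatum.isLinear {I₁ I₂ : FPIdal C} : ObjectProperty (LocalDatum I₁ I₂ D) := fun X =>
  TensorFunctor.isLinear K X.H₁ ∧ TensorFunctor.isLinear K X.H₂

lemma restr_isLinear (F : TensorFunctor C D) (hF : TensorFunctor.preservesFP F)
    (h : TensorFunctor.isLinear K F) (I : FPIdal C) :
    TensorFunctor.isLinear K (restr F hF I) := by
  obtain ⟨_, _⟩ := h
  exact ⟨inferInstanceAs (I.incl ⋙ F.toFunctor ⋙ (I.map F hF).R).Additive,
    inferInstanceAs ((I.incl ⋙ F.toFunctor ⋙ (I.map F hF).R).Linear K)⟩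

variable (D) in
/-- The functor from the category of cocontinuous `K`-linear tensor functors preserving finitely
presentable objects to the category of local data with `K`-linear functors. -/
def restrictLinear (I₁ I₂ : FPIdal C) (hI : I₁.toIdal.IsCover I₂.toIdal) :
    (TensorFunctor.preservesFP (C := C) (D := D) ⊓ TensorFunctor.isLinear K).FullSubcategory ⥤
      (LocalDatum.isLinear (D := D) (I₁ := I₁) (I₂ := I₂) K).FullSubcategory :=
  ObjectProperty.lift _ (ObjectProperty.ιOfLE inf_le_left ⋙ restrict I₁ I₂ hI D) fun F =>
    ⟨restr_isLinear K F.obj F.property.1 F.property.2 I₁,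
      restr_isLinear K F.obj F.property.1 F.property.2 I₂⟩

end

end LinearCase

end TensorLoc

open TensorLoc

/-!
The localization of a locally finitely presentable tensor category at a finitely presentable idal
`J` behaves like the restriction of quasi-coherent sheaves to an open subset, and a cover `J₁`, `J₂`
like an open cover, so that objects, morphisms and tensor functors satisfy descent.

*Exactness.* Call `X ⊗ J ⟶ X` and its iterates refinements of `X`. Tensoring with `J` has a right
adjoint `HOM(J, -)` by the adjoint functor theorem, and since `J` is finitely presentable, the
colimit of `M ⟶ HOM(J, M) ⟶ HOM(J, HOM(J, M)) ⟶ ⋯` is `J`-local. It is therefore the localization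
of `M`, and every morphism from a finitely presentable object to it lifts to `M` after a refinement,
uniquely up to a further one. Hence the morphisms inverted by the localization are the ones which
are bijective up to refinement on finitely presentable objects (`FPIdal.localEquiv_iff_locBij`). This
description shows that they are stable under base change (`FPIdal.localEquiv_of_isPullback`), that
the localization at `J` preserves the local objects of other idals (`FPIdal.isLocal_R`), and that
the localizations at the idals of a cover are jointly conservative
(`FPIdal.isIso_of_localEquiv_of_isCover`).

*Descent.* Let `L = J₁ ⊗ J₂`. If `A₁` is `J₁`-local, `A₂` is `J₂`-local, and `A₁ ⟶ Q ⟵ A₂` are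
localizations at `L`, then `A₂ ⟶ Q` is also the localization at `J₁`, and by base change so is
`A₁ ×_Q A₂ ⟶ A₁` (`FPIdal.IsMeet.localEquiv_fst`). Conversely every object is the pullback of its
localizations (`FPIdal.isPullback_unit`), so that morphisms are glued from morphisms between the
localizations which agree on the overlap (`FPIdal.exists_hom_of_isCover`), uniquely
(`FPIdal.hom_ext_of_isCover`).

*Full faithfulness.* A morphism of local data between the restrictions of `F` and `G` amounts to
morphisms `R_{J_i} F ⟶ R_{J_i} G` with `J_i = F(I_i)` which agree on the overlap. By descent these
are induced by a unique `F ⟶ G`. The morphisms of idals `f_i` carry no further information: the two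
candidates for `f_i` agree after localization at `J_i` because both idals are inverted there, and at
the other idal by the compatibility with the `π_j`.

*Essential surjectivity.* Given a local datum, the pullback of the two functors `C ⟶ D_{J_i} ⟶ D`
over the overlap is a pullback of lax monoidal functors. Its structure morphisms are locally
isomorphisms, hence isomorphisms, and it is cocontinuous and preserves finitely presentable objects
since these properties are local (`exists_glue`). The isomorphisms `J_i ≅ H(I_i)` are glued from
the canonical one at `J_i` and the one given by `π_j` at `J_j` (`exists_restrictObj_iso`).

Linearity of a functor is again a local property (`isLinear_of_isCover`).
-/

set_option linter.unusedSectionVars false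

namespace TensorLoc

/-! ### The adjoint functor theorem for locally finitely presentable categories -/

section AdjointFunctor

open Cardinal Opposite

attribute [local instance] fact_isRegular_aleph0

/-- Let `P` be a small generating set of finitely presentable objects. The colimit of the `X` in `P`,
indexed by the morphisms `F X ⟶ A`, is a solution set for `A`, since every object of `C` is a filtered
colimit of objects of `P`. -/
lemma solutionSetCondition_op {C : Type u₁} [Category.{v} C] [IsLocallyFinitelyPresentable.{v} C]
    {E : Type u₂} [Category.{v} E] (F : C ⥤ E) [PreservesColimitsOfSize.{v, v} F] :
    SolutionSetCondition.{v} F.op := by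
  obtain ⟨P, _, hP⟩ := HasCardinalFilteredGenerator.exists_small_generator C (ℵ₀ : Cardinal.{v})
  intro A
  have : EssentiallySmall.{v} (CostructuredArrow (P.ι ⋙ F) A.unop) :=
    essentiallySmall_of_small_of_locallySmall _
  have : HasColimitsOfShape (CostructuredArrow (P.ι ⋙ F) A.unop) C :=
    hasColimitsOfShape_of_equivalence (equivSmallModel.{v} _).symm
  have : PreservesColimitsOfShape (CostructuredArrow (P.ι ⋙ F) A.unop) F :=
    preservesColimitsOfShape_of_equiv (equivSmallModel.{v} _).symm F
  let K : CostructuredArrow (P.ι ⋙ F) A.unop ⥤ C := CostructuredArrow.proj _ _ ⋙ P.ι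
  let hK := isColimitOfPreserves F (colimit.isColimit K)
  let s : Cocone (K ⋙ F) := Cocone.mk A.unop
    { app := fun a => a.hom
      naturality := fun a b f => (CostructuredArrow.w f).trans (Category.comp_id _).symm }
  refine ⟨PUnit, fun _ => op (colimit K), fun _ => (hK.desc s).op, fun X h => ⟨⟨⟩, ?_⟩⟩
  obtain ⟨J, _, _, ⟨p⟩⟩ := hP.exists_colimitsOfShape X.unop
  let q (j : J) : CostructuredArrow (P.ι ⋙ F) A.unop :=
    CostructuredArrow.mk (Y := ⟨p.diag.obj j, p.prop_diag_obj j⟩) (F.map (p.ι.app j) ≫ h.unop)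
  let m {i j : J} (f : i ⟶ j) : q i ⟶ q j := CostructuredArrow.homMk ⟨p.diag.map f⟩ (by
    change F.map (p.diag.map f) ≫ F.map (p.ι.app j) ≫ h.unop = F.map (p.ι.app i) ≫ h.unop
    rw [← Functor.map_comp_assoc]
    congr 2
    exact (p.ι.naturality f).trans (Category.comp_id _))
  refine ⟨(p.isColimit.desc (Cocone.mk (colimit K)
    { app := fun j => colimit.ι K (q j)
      naturality := fun i j f => ?_ })).op, Quiver.Hom.unop_inj ?_⟩
  · exact (colimit.w K (m f)).trans (Category.comp_id _).symm
  · refine (isColimitOfPreserves F p.isColimit).hom_ext fun j => ?_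
    change F.map (p.ι.app j) ≫ F.map (p.isColimit.desc (Cocone.mk (colimit K) _)) ≫ hK.desc s =
      F.map (p.ι.app j) ≫ h.unop
    rw [← Functor.map_comp_assoc, p.isColimit.fac]
    exact hK.fac s (q j)

lemma isLeftAdjoint_of_cocontinuous {C : Type u₁} [Category.{v} C]
    [IsLocallyFinitelyPresentable.{v} C]
    {E : Type u₂} [Category.{v} E] (F : C ⥤ E) [PreservesColimitsOfSize.{v, v} F] :
    F.IsLeftAdjoint := by
  have : HasColimits C := inferInstance
  have : PreservesLimitsOfSize.{v, v} F.op := preservesLimitsOfSize_op F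
  have := isRightAdjoint_of_preservesLimits_of_solutionSetCondition F.op (solutionSetCondition_op F)
  exact ⟨F.op.leftAdjoint.unop, ⟨(Adjunction.ofIsRightAdjoint F.op).unop⟩⟩

/-- The constant diagram functor has a right adjoint by the adjoint functor theorem. -/
lemma hasPullbacks_of_locallyFinitelyPresentable (C : Type u₁) [Category.{v} C]
    [IsLocallyFinitelyPresentable.{v} C] : HasPullbacks C := by
  have : PreservesColimitsOfSize.{v, v} (Functor.const WalkingCospan : C ⥤ _) := inferInstance
  exact hasLimitsOfShape_iff_isLeftAdjoint_const.2
    (isLeftAdjoint_of_cocontinuous (Functor.const WalkingCospan : C ⥤ _))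

end AdjointFunctor

/-! ### Refinements and locally bijective morphisms -/

section LocallyBijective

open Cardinal

attribute [local instance] fact_isRegular_aleph0

variable {C : Type u₁} [Category.{v} C] [MonoidalCategory C]

namespace Idal

lemma act_naturality (I : Idal C) {X Y : C} (f : X ⟶ Y) :
    f ▷ I.obj ≫ I.act Y = I.act X ≫ f :=
  I.actNat.naturality f

lemma act_naturality_assoc (I : Idal C) {X Y Z : C} (f : X ⟶ Y) (g : Y ⟶ Z) :
    f ▷ I.obj ≫ I.act Y ≫ g = I.act X ≫ f ≫ g := by
  rw [← Category.assoc, act_naturality, Category.assoc]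

/-- The defining property of an idal, tensored with an object `X`. This makes
`M ⟶ HOM(J, M)` compatible with the actions, see `ev_toIhom` and `hullStep_toIhom`. -/
lemma act_whiskerRight (I : Idal C) (X : C) :
    I.act X ▷ I.obj = I.act (X ⊗ I.obj) := by
  have h := (α_ X I.obj I.obj).hom ≫= congrArg (X ◁ ·) I.comm
  simp only [MonoidalCategory.whiskerLeft_comp] at h
  simp only [act, comp_whiskerRight]
  simp at h
  simp [h]

end Idal

variable [SymmetricCategory C] [LFPTensorCategory C]

namespace FPIdal

/-- The compositions of morphisms of the form `X ⊗ J ⟶ X`. -/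
inductive Refinement (J : FPIdal C) : ∀ {X' X : C}, (X' ⟶ X) → Prop
  | act (X : C) : Refinement J (J.act X)
  | comp {X'' X' X : C} {p : X'' ⟶ X'} {q : X' ⟶ X} :
      Refinement J p → Refinement J q → Refinement J (p ≫ q)

variable {J : FPIdal C}

lemma Refinement.fp {X' X : C} {p : X' ⟶ X} (h : J.Refinement p)
    (hX : IsFinitelyPresentable.{v} X) : IsFinitelyPresentable.{v} X' := by
  induction h with
  | act X => exact LFPTensorCategory.tensor_fp _ _ hX J.fp
  | comp _ _ h h' => exact h (h' hX)

lemma Refinement.localEquiv {X' X : C} {p : X' ⟶ X} (h : J.Refinement p) : J.localEquiv p := by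
  induction h with
  | act X => exact J.localEquiv_act X
  | comp _ _ h h' => exact J.localEquiv.comp_mem _ _ h h'

/-- Refinements are stable under base change, in a weak sense. -/
lemma Refinement.exists_baseChange {X' X : C} {p : X' ⟶ X} (h : J.Refinement p) {Y : C}
    (f : Y ⟶ X) : ∃ (Y' : C) (q : Y' ⟶ Y) (f' : Y' ⟶ X'), J.Refinement q ∧ q ≫ f = f' ≫ p := by
  induction h generalizing Y with
  | act X => exact ⟨_, J.act Y, f ▷ J.obj, .act Y, (J.act_naturality f).symm⟩
  | comp _ _ h h' =>
    obtain ⟨Y', q, f', hq, e⟩ := h' f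
    obtain ⟨Y'', q', f'', hq', e'⟩ := h f'
    exact ⟨Y'', q' ≫ q, f'', hq'.comp hq, by rw [Category.assoc, e, reassoc_of% e']⟩

/-- A morphism `f : M ⟶ N` such that every `a : X ⟶ N` with `X` finitely presentable lifts to `M`
after restriction along a refinement of `X`, and such that two lifts agree after such a
restriction. These are the morphisms inverted by the localization at `J`, see
`localEquiv_iff_locBij`. -/
structure LocBij (J : FPIdal C) {M N : C} (f : M ⟶ N) : Prop where
  surj : ∀ (X : C), IsFinitelyPresentable.{v} X → ∀ a : X ⟶ N,
    ∃ (X' : C) (p : X' ⟶ X) (b : X' ⟶ M), J.Refinement p ∧ b ≫ f = p ≫ a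
  inj : ∀ (X : C), IsFinitelyPresentable.{v} X → ∀ b b' : X ⟶ M, b ≫ f = b' ≫ f →
    ∃ (X' : C) (p : X' ⟶ X), J.Refinement p ∧ p ≫ b = p ≫ b'

lemma LocBij.comp {M N P : C} {f : M ⟶ N} {g : N ⟶ P} (hf : J.LocBij f) (hg : J.LocBij g) :
    J.LocBij (f ≫ g) where
  surj X hX a := by
    obtain ⟨X', p, b, hp, hb⟩ := hg.surj X hX a
    obtain ⟨X'', q, c, hq, hc⟩ := hf.surj _ (hp.fp hX) b
    exact ⟨X'', q ≫ p, c, hq.comp hp, by rw [reassoc_of% hc, hb, Category.assoc]⟩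
  inj X hX b b' h := by
    obtain ⟨X', p, hp, e⟩ := hg.inj X hX (b ≫ f) (b' ≫ f) (by simpa using h)
    obtain ⟨X'', q, hq, e'⟩ := hf.inj _ (hp.fp hX) (p ≫ b) (p ≫ b') (by simpa using e)
    exact ⟨X'', q ≫ p, hq.comp hp, by simpa using e'⟩

/-- Two out of three. For injectivity, the two morphisms to the middle object are lifted along `f`
before the injectivity of `f ≫ g` is applied. -/
lemma LocBij.of_comp_left {M N P : C} {f : M ⟶ N} {g : N ⟶ P} (hf : J.LocBij f)
    (hfg : J.LocBij (f ≫ g)) : J.LocBij g where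
  surj X hX a := by
    obtain ⟨X', p, b, hp, hb⟩ := hfg.surj X hX a
    exact ⟨X', p, b ≫ f, hp, by simpa using hb⟩
  inj X hX b b' h := by
    obtain ⟨X', p, c, hp, hc⟩ := hf.surj X hX b
    obtain ⟨X'', q, d, hq, hd⟩ := hf.surj _ (hp.fp hX) (p ≫ b')
    obtain ⟨X₃, r, hr, e⟩ := hfg.inj _ (hq.fp (hp.fp hX)) (q ≫ c) d (by
      rw [reassoc_of% hd, Category.assoc, reassoc_of% hc, h])
    refine ⟨X₃, r ≫ q ≫ p, hr.comp (hq.comp hp), ?_⟩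
    have e' := e =≫ f
    simp only [Category.assoc, hc, hd] at e'
    simpa using e'

lemma LocBij.of_comp_right {M N P : C} {f : M ⟶ N} {g : N ⟶ P} (hg : J.LocBij g)
    (hfg : J.LocBij (f ≫ g)) : J.LocBij f where
  surj X hX a := by
    obtain ⟨X', p, b, hp, hb⟩ := hfg.surj X hX (a ≫ g)
    obtain ⟨X'', q, hq, e⟩ := hg.inj _ (hp.fp hX) (b ≫ f) (p ≫ a) (by simpa using hb)
    exact ⟨X'', q ≫ p, q ≫ b, hq.comp hp, by simpa using e⟩
  inj X hX b b' h := hfg.inj X hX b b' (by simp only [← Category.assoc, h])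

lemma LocBij.of_isIso (J : FPIdal C) {M N : C} (f : M ⟶ N) [IsIso f] : J.LocBij f where
  surj X hX a := ⟨_, J.act X, J.act X ≫ a ≫ inv f, .act X, by simp⟩
  inj X hX b b' h := ⟨_, J.act X, .act X, by rw [(cancel_mono f).1 h]⟩

/-- A morphism `f : M ⟶ N` is locally bijective if the action `N ⊗ J ⟶ N` factors through it, in
a way compatible with the action on `M`. -/
lemma LocBij.of_lift {M N : C} {f : M ⟶ N} (g : N ⊗ J.obj ⟶ M) (h : f ▷ J.obj ≫ g = J.act M)
    (h' : g ≫ f = J.act N) : J.LocBij f where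
  surj X hX a :=
    ⟨_, J.act X, a ▷ J.obj ≫ g, .act X, by rw [Category.assoc, h', Idal.act_naturality]⟩
  inj X hX b b' e := ⟨_, J.act X, .act X, by
    rw [← J.act_naturality, ← J.act_naturality, ← h, ← comp_whiskerRight_assoc, e,
      comp_whiskerRight_assoc]⟩

/-- The analogue of `LocBij.of_lift` for morphisms inverted by the localization. -/
lemma localEquiv_of_lift {M N : C} {f : M ⟶ N} (g : N ⊗ J.obj ⟶ M)
    (h : f ▷ J.obj ≫ g = J.act M) (h' : g ≫ f = J.act N) : J.localEquiv f := by
  -- The image of `g` under the localization is split epi by the first equation and mono by the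
  -- second one, since both composites with it become isomorphisms.
  have h₁ : IsIso (J.reflector.map (f ▷ J.obj ≫ g)) := by
    rw [h, ← localEquiv_iff]; exact J.localEquiv_act M
  have h₂ : IsIso (J.reflector.map (g ≫ f)) := by
    rw [h', ← localEquiv_iff]; exact J.localEquiv_act N
  rw [Functor.map_comp] at h₁ h₂
  have : IsSplitEpi (J.reflector.map g) := ⟨⟨inv (J.reflector.map (f ▷ J.obj) ≫ J.reflector.map g) ≫
    J.reflector.map (f ▷ J.obj), by simp⟩⟩
  have : Mono (J.reflector.map g) := mono_of_mono _ (J.reflector.map f)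
  have : IsIso (J.reflector.map g) := isIso_of_mono_of_isSplitEpi _
  rw [localEquiv_iff]
  exact IsIso.of_isIso_comp_left (J.reflector.map g) _

lemma mono_of_injective_of_fp {M N : C} (f : M ⟶ N) (h : ∀ X, IsFinitelyPresentable.{v} X →
    Function.Injective (fun a : X ⟶ M => a ≫ f)) : Mono f := by
  have := LFPTensorCategory.locallyFinitelyPresentable (C := C)
  obtain ⟨P, _, hP⟩ := HasCardinalFilteredGenerator.exists_small_generator C (ℵ₀ : Cardinal.{v})
  exact ⟨fun a b e => hP.isStrongGenerator.isSeparating _ _ fun X hX c =>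
    h X (hP.le_isCardinalPresentable _ hX) (by simp [e])⟩

/-- Isomorphisms are detected by the finitely presentable objects. -/
lemma isIso_of_bijective_of_fp {M N : C} (f : M ⟶ N) (h : ∀ X, IsFinitelyPresentable.{v} X →
    Function.Bijective (fun a : X ⟶ M => a ≫ f)) : IsIso f := by
  have := LFPTensorCategory.locallyFinitelyPresentable (C := C)
  obtain ⟨P, _, hP⟩ := HasCardinalFilteredGenerator.exists_small_generator C (ℵ₀ : Cardinal.{v})
  have : Mono f := mono_of_injective_of_fp f fun X hX => (h X hX).1
  exact hP.isStrongGenerator.isIso_of_mono f fun X hX =>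
    (h X (hP.le_isCardinalPresentable _ hX)).2

/-- Local objects are detected by the finitely presentable objects. -/
lemma isLocal_of_fp {M : C} (h : ∀ X, IsFinitelyPresentable.{v} X →
    Function.Bijective (fun a : X ⟶ M => J.act X ≫ a)) : J.isLocal M := by
  have := LFPTensorCategory.locallyFinitelyPresentable (C := C)
  have := LFPTensorCategory.tensorRight_cocontinuous J.obj
  obtain ⟨P, _, hP⟩ := HasCardinalFilteredGenerator.exists_small_generator C (ℵ₀ : Cardinal.{v})
  have key (X : C) : Function.Bijective (fun a : X ⟶ M => J.act X ≫ a) := by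
    obtain ⟨A, _, _, ⟨p⟩⟩ := hP.exists_colimitsOfShape X
    exact J.bijective_of_isColimit M p.isColimit fun a =>
      h _ (hP.le_isCardinalPresentable _ (p.prop_diag_obj a))
  intro X Y f hf
  -- The morphism `f` is one of the `J.act Z`, up to an equality of objects.
  have hf' : ∃ Z, Arrow.mk f = Arrow.mk (J.act Z) := (MorphismProperty.ofHoms_iff _ _).1 hf
  obtain ⟨Z, hZ⟩ := hf'
  obtain rfl : Y = Z := congrArg Comma.right hZ
  obtain rfl : X = _ := congrArg Comma.left hZ
  obtain rfl : f = J.act Y := (Arrow.mk_inj _ _).1 hZ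
  exact key Y

lemma isLocal_bijective {M : C} (h : J.isLocal M) (X : C) :
    Function.Bijective (fun a : X ⟶ M => J.act X ≫ a) :=
  h _ ⟨X⟩

lemma bijective_of_localEquiv {M : C} (h : J.isLocal M) {X Y : C} {f : X ⟶ Y}
    (hf : J.localEquiv f) : Function.Bijective (fun a : Y ⟶ M => f ≫ a) :=
  hf M h

lemma isLocal_incl (M : J.Loc) : J.isLocal (J.incl.obj M) := M.property

/-- A locally bijective morphism between local objects is an isomorphism. -/
lemma LocBij.isIso {M N : C} {f : M ⟶ N} (hf : J.LocBij f) (hM : J.isLocal M)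
    (hN : J.isLocal N) : IsIso f := by
  refine isIso_of_bijective_of_fp f fun X hX => ⟨fun b b' e => ?_, fun a => ?_⟩
  · obtain ⟨X', p, hp, e'⟩ := hf.inj X hX b b' e
    exact (bijective_of_localEquiv hM hp.localEquiv).1 e'
  · obtain ⟨X', p, b, hp, e⟩ := hf.surj X hX a
    obtain ⟨c, hc⟩ := (bijective_of_localEquiv hM hp.localEquiv).2 b
    refine ⟨c, (bijective_of_localEquiv hN hp.localEquiv).1 ?_⟩
    dsimp at hc ⊢
    rw [← e, reassoc_of% hc]

end FPIdal

end LocallyBijective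

/-! ### Construction of the localization from iterated internal homs -/

section Sequence

open Cardinal

attribute [local instance] fact_isRegular_aleph0

variable {C : Type u₁} [Category.{v} C] [MonoidalCategory C] [SymmetricCategory C]
  [LFPTensorCategory C]

namespace FPIdal

variable (J : FPIdal C)

lemma isLeftAdjoint_tensorRight : (tensorRight J.obj).IsLeftAdjoint := by
  have := LFPTensorCategory.locallyFinitelyPresentable (C := C)
  have := LFPTensorCategory.tensorRight_cocontinuous J.obj
  exact isLeftAdjoint_of_cocontinuous _

/-- The internal hom `HOM(J, M)`. -/
noncomputable def ihomObj (M : C) : C :=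
  have := J.isLeftAdjoint_tensorRight
  (tensorRight J.obj).rightAdjoint.obj M

/-- The universal property of the internal hom. -/
noncomputable def ihomEquiv (X M : C) : (X ⊗ J.obj ⟶ M) ≃ (X ⟶ J.ihomObj M) :=
  have := J.isLeftAdjoint_tensorRight
  (Adjunction.ofIsLeftAdjoint (tensorRight J.obj)).homEquiv X M

lemma ihomEquiv_naturality_left {X Y M : C} (f : X ⟶ Y) (g : Y ⊗ J.obj ⟶ M) :
    J.ihomEquiv X M (f ▷ J.obj ≫ g) = f ≫ J.ihomEquiv Y M g :=
  have := J.isLeftAdjoint_tensorRight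
  (Adjunction.ofIsLeftAdjoint (tensorRight J.obj)).homEquiv_naturality_left f g

/-- The evaluation `HOM(J, M) ⊗ J ⟶ M`. -/
noncomputable def ev (M : C) : J.ihomObj M ⊗ J.obj ⟶ M := (J.ihomEquiv _ _).symm (𝟙 _)

lemma whiskerRight_ev {X M : C} (f : X ⟶ J.ihomObj M) :
    f ▷ J.obj ≫ J.ev M = (J.ihomEquiv _ _).symm f := by
  apply (J.ihomEquiv _ _).injective
  rw [ihomEquiv_naturality_left, ev, Equiv.apply_symm_apply, Equiv.apply_symm_apply,
    Category.comp_id]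

lemma ihom_ext {X M : C} {f g : X ⟶ J.ihomObj M}
    (h : f ▷ J.obj ≫ J.ev M = g ▷ J.obj ≫ J.ev M) : f = g := by
  rw [whiskerRight_ev, whiskerRight_ev] at h
  exact (J.ihomEquiv _ _).symm.injective h

/-- The morphism `M ⟶ HOM(J, M)`. -/
noncomputable def toIhom (M : C) : M ⟶ J.ihomObj M := J.ihomEquiv _ _ (J.act M)

lemma toIhom_ev (M : C) : J.toIhom M ▷ J.obj ≫ J.ev M = J.act M := by
  rw [whiskerRight_ev, toIhom, Equiv.symm_apply_apply]

lemma ev_toIhom (M : C) : J.ev M ≫ J.toIhom M = J.act (J.ihomObj M) := by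
  apply J.ihom_ext
  rw [comp_whiskerRight_assoc, toIhom_ev, Idal.act_whiskerRight, Idal.act_naturality]

variable {J} in
/-- The properties of the morphism `M ⟶ HOM(J, M)` from which the localization at `J` is built. -/
structure HullStep {M N : C} (f : M ⟶ N) : Prop where
  exists_lift : ∃ g : N ⊗ J.obj ⟶ M, f ▷ J.obj ≫ g = J.act M ∧ g ≫ f = J.act N
  ext : ∀ {X : C} {a b : X ⟶ M}, J.act X ≫ a = J.act X ≫ b → a ≫ f = b ≫ f
  exists_extension : ∀ {X : C} (a : X ⊗ J.obj ⟶ M), ∃ b : X ⟶ N, J.act X ≫ b = a ≫ f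

/-- The morphism `M ⟶ HOM(J, M)` has all the properties of `HullStep`; these are transported along
the adjunction between `- ⊗ J` and `HOM(J, -)`. -/
lemma hullStep_toIhom (M : C) : HullStep (J := J) (J.toIhom M) where
  exists_lift := ⟨J.ev M, J.toIhom_ev M, J.ev_toIhom M⟩
  ext {X a b} e := J.ihom_ext (by
    rw [comp_whiskerRight_assoc, toIhom_ev, Idal.act_naturality, e,
      comp_whiskerRight_assoc, toIhom_ev, Idal.act_naturality])
  exists_extension {X} a := ⟨J.ihomEquiv _ _ a, J.ihom_ext (by
    rw [comp_whiskerRight_assoc, whiskerRight_ev, Equiv.symm_apply_apply,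
      comp_whiskerRight_assoc, toIhom_ev, Idal.act_naturality, Idal.act_whiskerRight])⟩

/-- The iterated internal homs `HOM(J, ⋯ HOM(J, M))`. -/
noncomputable def iter (M : C) : ℕ → C
  | 0 => M
  | n + 1 => J.ihomObj (iter M n)

variable {J}

section

variable {F : ℕ ⥤ C} (hF : ∀ n, HullStep (J := J) (F.map (homOfLE (Nat.le_succ n))))
  {c : Cocone F} (hc : IsColimit c)

include hF in
lemma locBij_map_of_hullStep (n : ℕ) : J.LocBij (F.map (homOfLE n.zero_le)) := by
  induction n with
  | zero =>
    rw [show homOfLE (Nat.zero_le 0) = 𝟙 0 from rfl, CategoryTheory.Functor.map_id]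
    exact .of_isIso J _
  | succ n h =>
    rw [← homOfLE_comp n.zero_le n.le_succ, Functor.map_comp]
    obtain ⟨g, h₁, h₂⟩ := (hF n).exists_lift
    exact h.comp (.of_lift g h₁ h₂)

include hF in
lemma localEquiv_map_of_hullStep (n : ℕ) : J.localEquiv (F.map (homOfLE n.zero_le)) := by
  induction n with
  | zero =>
    rw [show homOfLE (Nat.zero_le 0) = 𝟙 0 from rfl, CategoryTheory.Functor.map_id]
    exact J.localEquiv.id_mem _
  | succ n h =>
    rw [← homOfLE_comp n.zero_le n.le_succ, Functor.map_comp]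
    obtain ⟨g, h₁, h₂⟩ := (hF n).exists_lift
    exact J.localEquiv.comp_mem _ _ h (localEquiv_of_lift g h₁ h₂)

include hF hc

/-- The colimit of such a sequence is local. A morphism from `X ⊗ J`, which is finitely presentable
together with `X`, factors through a stage of the sequence, and extends to `X` at the next one. -/
lemma isLocal_of_hullStep : J.isLocal c.pt := by
  have hcf : IsCardinalFiltered ℕ (ℵ₀ : Cardinal.{v}) := by
    rw [isCardinalFiltered_aleph0_iff]; infer_instance
  refine isLocal_of_fp fun X hX => ⟨fun a b e => ?_, fun a => ?_⟩
  · obtain ⟨n, a, rfl⟩ := IsCardinalPresentable.exists_hom_of_isColimit ℵ₀ hc a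
    obtain ⟨m, b, rfl⟩ := IsCardinalPresentable.exists_hom_of_isColimit ℵ₀ hc b
    have hX' := LFPTensorCategory.tensor_fp _ _ hX J.fp
    obtain ⟨k, u, v, e'⟩ := IsCardinalPresentable.exists_eq_of_isColimit ℵ₀ hc (J.act X ≫ a)
      (J.act X ≫ b) (by simpa using e)
    simp only [Category.assoc] at e'
    simpa only [Category.assoc, c.w] using (hF k).ext e' =≫ c.ι.app (k + 1)
  · have hX' := LFPTensorCategory.tensor_fp _ _ hX J.fp
    obtain ⟨n, a, rfl⟩ := IsCardinalPresentable.exists_hom_of_isColimit ℵ₀ hc a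
    obtain ⟨b, hb⟩ := (hF n).exists_extension a
    refine ⟨b ≫ c.ι.app (n + 1), ?_⟩
    dsimp only
    rw [reassoc_of% hb, c.w]

lemma locBij_ι_of_hullStep : J.LocBij (c.ι.app 0) := by
  have hcf : IsCardinalFiltered ℕ (ℵ₀ : Cardinal.{v}) := by
    rw [isCardinalFiltered_aleph0_iff]; infer_instance
  constructor
  · intro X hX a
    obtain ⟨n, a, rfl⟩ := IsCardinalPresentable.exists_hom_of_isColimit ℵ₀ hc a
    obtain ⟨X', p, b, hp, e⟩ := (locBij_map_of_hullStep hF n).surj X hX a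
    exact ⟨X', p, b, hp, by rw [← c.w (homOfLE n.zero_le), reassoc_of% e]⟩
  · intro X hX b b' e
    obtain ⟨n, u, e⟩ := IsCardinalPresentable.exists_eq_of_isColimit' ℵ₀ hc b b' e
    exact (locBij_map_of_hullStep hF n).inj X hX b b' e

/-- The localization is cocontinuous and turns the sequence into one of isomorphisms. -/
lemma localEquiv_ι_of_hullStep : J.localEquiv (c.ι.app 0) := by
  have : PreservesColimitsOfShape ℕ J.R :=
    preservesColimitsOfShape_of_equiv (equivSmallModel.{v} ℕ).symm J.R
  have h : (F ⋙ J.R).IsEventuallyConstantFrom 0 := fun n f =>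
    (J.localEquiv_iff _).1 (localEquiv_map_of_hullStep hF n)
  exact (J.localEquiv_iff _).2 (h.isIso_ι_of_isColimit (isColimitOfPreserves J.R hc))

end

variable (J)

/-- The unit is an isomorphism at every object of `C` which is `J`-local. -/
lemma isIso_unit_of_isLocal {M : C} (hM : J.isLocal M) : IsIso (J.adj.unit.app M) := by
  have h := incl_dIso_inv J (⟨M, hM⟩ : J.isLocal.FullSubcategory)
  have h' : IsIso (J.adj.unit.app (J.incl.obj (⟨M, hM⟩ : J.isLocal.FullSubcategory))) := by
    rw [← h]; exact Functor.map_isIso J.incl (dIso J _).inv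
  exact h'

lemma unit_naturality {M N : C} (f : M ⟶ N) :
    f ≫ J.adj.unit.app N = J.adj.unit.app M ≫ J.incl.map (J.R.map f) :=
  J.adj.unit.naturality f

lemma localEquiv_iff_isIso_R {M N : C} (f : M ⟶ N) : J.localEquiv f ↔ IsIso (J.R.map f) :=
  J.localEquiv_iff f

variable {J} in
/-- If `M` admits a locally bijective local equivalence to some local object, then this object is
the localization of `M`, so that the unit at `M` is locally bijective. -/
lemma LocBij.unit_of_isLocal {M N : C} {f : M ⟶ N} (h : J.LocBij f) (hf : J.localEquiv f)
    (hN : J.isLocal N) : J.LocBij (J.adj.unit.app M) := by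
  have : IsIso (J.R.map f) := (J.localEquiv_iff_isIso_R _).1 hf
  have := J.isIso_unit_of_isLocal hN
  refine .of_comp_right (.of_isIso J (J.incl.map (J.R.map f))) ?_
  erw [← J.unit_naturality]
  exact h.comp (.of_isIso J _)

/-- The unit of the localization at `J` is locally bijective. -/
lemma locBij_unit (M : C) : J.LocBij (J.adj.unit.app M) := by
  have := LFPTensorCategory.locallyFinitelyPresentable (C := C)
  have : HasColimitsOfShape ℕ C :=
    hasColimitsOfShape_of_equivalence (equivSmallModel.{v} ℕ).symm
  let F : ℕ ⥤ C := Functor.ofSequence (X := J.iter M) fun n => J.toIhom (J.iter M n)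
  have hF (n : ℕ) : HullStep (J := J) (F.map (homOfLE (Nat.le_succ n))) := by
    have : F.map (homOfLE (Nat.le_succ n)) = J.toIhom (J.iter M n) :=
      Functor.ofSequence_map_homOfLE_succ ..
    rw [this]
    exact J.hullStep_toIhom _
  have hc : IsColimit (colimit.cocone F) := colimit.isColimit _
  exact (locBij_ι_of_hullStep hF hc).unit_of_isLocal (localEquiv_ι_of_hullStep hF hc)
    (isLocal_of_hullStep hF hc)

variable {J} in
/-- The morphisms inverted by the localization at `J` are the locally bijective ones. -/
lemma localEquiv_iff_locBij {M N : C} {f : M ⟶ N} : J.localEquiv f ↔ J.LocBij f := by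
  rw [localEquiv_iff_isIso_R]
  constructor
  · intro h
    refine .of_comp_right (J.locBij_unit N) ?_
    rw [unit_naturality]
    exact (J.locBij_unit M).comp (.of_isIso J _)
  · intro h
    have : J.LocBij (J.incl.map (J.R.map f)) :=
      .of_comp_left (J.locBij_unit M) (by
        erw [← unit_naturality]
        exact h.comp (J.locBij_unit N))
    have := this.isIso (J.isLocal_incl _) (J.isLocal_incl _)
    exact isIso_of_fully_faithful J.incl _

end FPIdal

end Sequence

/-! ### Exactness of the localization and joint conservativity -/

section Consequences

variable {C : Type u₁} [Category.{v} C] [MonoidalCategory C] [SymmetricCategory C]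
  [LFPTensorCategory C]

namespace FPIdal

lemma localEquiv_unit (J : FPIdal C) (M : C) : J.localEquiv (J.adj.unit.app M) :=
  localEquiv_iff_locBij.2 (J.locBij_unit M)

/-- Local equivalences are stable under base change, i.e. the localization is left exact. -/
lemma localEquiv_of_isPullback {J : FPIdal C} {P M N Q : C} {f' : P ⟶ M} {g' : P ⟶ N} {g : M ⟶ Q}
    {f : N ⟶ Q} (sq : IsPullback f' g' g f) (hf : J.localEquiv f) : J.localEquiv f' := by
  rw [localEquiv_iff_locBij] at hf ⊢
  constructor
  · intro X hX a
    obtain ⟨X', p, b, hp, e⟩ := hf.surj X hX (a ≫ g)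
    exact ⟨X', p, sq.lift (p ≫ a) b (by rw [e, Category.assoc]), hp, sq.lift_fst _ _ _⟩
  · intro X hX b b' e
    obtain ⟨X', p, hp, e'⟩ := hf.inj X hX (b ≫ g') (b' ≫ g') (by
      rw [Category.assoc, Category.assoc, ← sq.w, reassoc_of% e])
    exact ⟨X', p, hp, sq.hom_ext (by simp [e]) (by simpa using e')⟩

/-- A refinement of `X ⊗ Z` is refined by `X' ⊗ Z` for some refinement `X'` of `X`. -/
lemma Refinement.exists_whiskerRight {J : FPIdal C} {Y' Y : C} {r : Y' ⟶ Y} (h : J.Refinement r)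
    {X Z : C} (g : X ⊗ Z ⟶ Y) : ∃ (X' : C) (p : X' ⟶ X) (s : X' ⊗ Z ⟶ Y'),
      J.Refinement p ∧ s ≫ r = p ▷ Z ≫ g := by
  induction h generalizing X with
  | act Y =>
    refine ⟨_, J.act X, ((α_ _ _ _).hom ≫ X ◁ (β_ _ _).hom ≫ (α_ _ _ _).inv) ≫ g ▷ J.obj,
      .act X, ?_⟩
    rw [Category.assoc, Idal.act_naturality, ← Category.assoc]
    congr 1
    simp only [Idal.act, Category.assoc, comp_whiskerRight]
    rw [← associator_inv_naturality_right_assoc]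
    rw [← MonoidalCategory.whiskerLeft_comp_assoc, ← BraidedCategory.braiding_naturality_left]
    simp
  | comp _ _ h₁ h₂ =>
    obtain ⟨X₂, p₂, s₂, hp₂, e₂⟩ := h₂ g
    obtain ⟨X₁, p₁, s₁, hp₁, e₁⟩ := h₁ s₂
    exact ⟨X₁, p₁ ≫ p₂, s₁, hp₁.comp hp₂, by
      rw [reassoc_of% e₁, e₂, comp_whiskerRight, Category.assoc]⟩

/-- The localization at `J` preserves the local objects of other idals. -/
lemma isLocal_R {I : FPIdal C} (J : FPIdal C) {M : C} (hM : I.isLocal M) :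
    I.isLocal (J.incl.obj (J.R.obj M)) := by
  have hu := J.locBij_unit M
  have hL := J.isLocal_incl (J.R.obj M)
  have hI (X : C) := isLocal_bijective hM X
  refine isLocal_of_fp fun X hX => ⟨fun a b e => ?_, fun a => ?_⟩
  -- Injectivity: `a` and `b` are lifted to `M` on a common refinement `X₂`. The lifts agree on a
  -- refinement of `X₂ ⊗ I`, which may be taken of the form `X₄ ⊗ I` with a refinement `X₄` of `X₂`.
  -- They agree on `X₄` since `M` is local for `I`.
  · dsimp at e
    obtain ⟨X₁, p, a', hp, ha⟩ := hu.surj X hX a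
    obtain ⟨X₂, q, b', hq, hb⟩ := hu.surj _ (hp.fp hX) (p ≫ b)
    have hX₂ := hq.fp (hp.fp hX)
    obtain ⟨X₃, r, hr, e'⟩ := hu.inj _ (LFPTensorCategory.tensor_fp _ _ hX₂ I.fp)
      (I.act X₂ ≫ q ≫ a') (I.act X₂ ≫ b') (by
        simp only [Category.assoc]
        rw [ha, hb, ← Idal.act_naturality_assoc, ← Idal.act_naturality_assoc,
          ← Idal.act_naturality_assoc, ← Idal.act_naturality_assoc, e])
    obtain ⟨X₄, p', s, hp', e''⟩ := hr.exists_whiskerRight (𝟙 _)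
    have e₃ : p' ≫ q ≫ a' = p' ≫ b' := (hI X₄).1 (by
      dsimp only
      rw [← Idal.act_naturality_assoc, ← Idal.act_naturality_assoc I.toIdal p' b',
        ← Category.comp_id (p' ▷ _), ← e'', Category.assoc, e', Category.assoc])
    refine (bijective_of_localEquiv hL (hp'.comp (hq.comp hp)).localEquiv).1 ?_
    have e₄ := e₃ =≫ J.adj.unit.app M
    simp only [Category.assoc, ha, hb] at e₄
    simpa using e₄
  -- Surjectivity: `a` lifts to `M` on a refinement of `X ⊗ I`, which may be taken of the form
  -- `X' ⊗ I`. The lift extends to `X'`, and the extension descends along the refinement to `X`.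
  · obtain ⟨Y, r, b, hr, e⟩ := hu.surj _ (LFPTensorCategory.tensor_fp _ _ hX I.fp) a
    obtain ⟨X', p, s, hp, e'⟩ := hr.exists_whiskerRight (𝟙 _)
    rw [Category.comp_id] at e'
    obtain ⟨c, hc⟩ := (hI X').2 (s ≫ b)
    obtain ⟨d, hd⟩ := (bijective_of_localEquiv hL hp.localEquiv).2 (c ≫ J.adj.unit.app M)
    have hp' : J.localEquiv (p ▷ I.obj) :=
      MorphismProperty.IsMonoidal.whiskerRight _ hp.localEquiv _
    refine ⟨d, (bijective_of_localEquiv hL hp').1 ?_⟩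
    dsimp at hc hd ⊢
    rw [Idal.act_naturality_assoc, hd, reassoc_of% hc, e, reassoc_of% e']

end FPIdal

namespace Idal

/-- Morphisms out of `X` are determined by their restrictions to `X ⊗ I` and `X ⊗ J`, since
tensoring with `X` preserves the pushout square of the cover. -/
lemma IsCover.hom_ext {I J : Idal C} (h : I.IsCover J) {X M : C} {a b : X ⟶ M}
    (hI : I.act X ≫ a = I.act X ≫ b) (hJ : J.act X ≫ a = J.act X ≫ b) : a = b := by
  have := LFPTensorCategory.tensorLeft_cocontinuous X
  have sq := IsPushout.map (tensorLeft X) h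
  rw [← cancel_epi (ρ_ X).hom]
  refine sq.hom_ext ?_ ?_
  · simpa [act] using hI
  · simpa [act] using hJ

lemma IsCover.exists_hom {I J : Idal C} (h : I.IsCover J) {X M : C} (a : X ⊗ I.obj ⟶ M)
    (b : X ⊗ J.obj ⟶ M) (e : X ◁ (I.fst J).hom ≫ a = X ◁ (I.snd J).hom ≫ b) :
    ∃ c : X ⟶ M, I.act X ≫ c = a ∧ J.act X ≫ c = b := by
  have := LFPTensorCategory.tensorLeft_cocontinuous X
  have sq := IsPushout.map (tensorLeft X) h
  refine ⟨(ρ_ X).inv ≫ sq.desc a b e, ?_, ?_⟩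
  · simp [act]
  · simp [act]

end Idal

namespace FPIdal

variable {I J : FPIdal C}

variable (h : I.toIdal.IsCover J.toIdal)

include h

lemma hom_ext_of_refinement_right {X' X M : C} {a b : X ⟶ M} {q : X' ⟶ X} (hq : J.Refinement q)
    (e : I.act X ≫ a = I.act X ≫ b) (e' : q ≫ a = q ≫ b) : a = b := by
  induction hq with
  | act X => exact h.hom_ext e e'
  | comp _ _ h₁ h₂ =>
    refine h₂ e (h₁ ?_ (by simpa using e'))
    rw [← Idal.act_naturality_assoc, ← Idal.act_naturality_assoc, e]

/-- Morphisms out of `X` are determined by their restrictions to refinements with respect to the two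
idals of a cover. -/
lemma hom_ext_of_refinement {X X' X'' M : C} {a b : X ⟶ M} {p : X' ⟶ X} {q : X'' ⟶ X}
    (hp : I.Refinement p) (hq : J.Refinement q) (e : p ≫ a = p ≫ b) (e' : q ≫ a = q ≫ b) :
    a = b := by
  induction hp generalizing X'' with
  | act X => exact hom_ext_of_refinement_right h hq e e'
  | @comp _ _ _ p₁ p₂ _ _ h₁ h₂ =>
    obtain ⟨Y, q', f', hq', e''⟩ := hq.exists_baseChange p₂
    refine h₂ hq (h₁ hq' (by simpa using e) ?_) e'
    rw [reassoc_of% e'', reassoc_of% e'', e']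

lemma exists_lift_of_refinement_right {X' X M N : C} {f : M ⟶ N} [Mono f] {a : X ⟶ N} {q : X' ⟶ X}
    (hq : J.Refinement q) (e : ∃ b, I.act X ≫ a = b ≫ f) (e' : ∃ b, q ≫ a = b ≫ f) :
    ∃ b, a = b ≫ f := by
  induction hq with
  | act X =>
    obtain ⟨b, hb⟩ := e
    obtain ⟨b', hb'⟩ := e'
    obtain ⟨c, hc, hc'⟩ := h.exists_hom b b' (by
      have w : (I.toIdal.fst J.toIdal).hom ≫ I.hom = (I.toIdal.snd J.toIdal).hom ≫ J.hom :=
        (I.toIdal.fst J.toIdal).w.trans (I.toIdal.snd J.toIdal).w.symm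
      rw [← cancel_mono f, Category.assoc, Category.assoc, ← hb, ← hb', Idal.act, Idal.act,
        Category.assoc, Category.assoc, ← MonoidalCategory.whiskerLeft_comp_assoc, w,
        MonoidalCategory.whiskerLeft_comp_assoc])
    exact ⟨c, h.hom_ext (by rw [hb, reassoc_of% hc]) (by rw [hb', reassoc_of% hc'])⟩
  | @comp _ _ _ p q _ _ h₁ h₂ =>
    obtain ⟨b, hb⟩ := e
    refine h₂ ⟨b, hb⟩ (h₁ ⟨q ▷ I.obj ≫ b, ?_⟩ (by simpa using e'))
    rw [← Idal.act_naturality_assoc, hb, Category.assoc]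

/-- A morphism factors through a subobject if it does so on refinements with respect to the two
idals of a cover. -/
lemma exists_lift_of_refinement {X X' X'' M N : C} {f : M ⟶ N} [Mono f] {a : X ⟶ N} {p : X' ⟶ X}
    {q : X'' ⟶ X} (hp : I.Refinement p) (hq : J.Refinement q) (e : ∃ b, p ≫ a = b ≫ f)
    (e' : ∃ b, q ≫ a = b ≫ f) : ∃ b, a = b ≫ f := by
  induction hp generalizing X'' with
  | act X => exact exists_lift_of_refinement_right h hq e e'
  | @comp _ _ _ p₁ p₂ _ _ h₁ h₂ =>
    obtain ⟨Y, q', f', hq', e''⟩ := hq.exists_baseChange p₂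
    refine h₂ hq (h₁ hq' (by simpa using e) ?_) e'
    obtain ⟨b, hb⟩ := e'
    exact ⟨f' ≫ b, by rw [reassoc_of% e'', hb, Category.assoc]⟩

/-- The localizations at the idals of a cover are jointly conservative. -/
lemma isIso_of_localEquiv_of_isCover {M N : C} {f : M ⟶ N} (hI : I.localEquiv f)
    (hJ : J.localEquiv f) : IsIso f := by
  rw [localEquiv_iff_locBij] at hI hJ
  -- Injectivity comes first, because local lifts along `f` are glued only once `f` is known to be
  -- a monomorphism.
  have inj (X : C) (hX : IsFinitelyPresentable.{v} X) (a b : X ⟶ M) (e : a ≫ f = b ≫ f) :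
      a = b := by
    obtain ⟨_, p, hp, e₁⟩ := hI.inj X hX a b e
    obtain ⟨_, q, hq, e₂⟩ := hJ.inj X hX a b e
    exact hom_ext_of_refinement h hp hq e₁ e₂
  have : Mono f := mono_of_injective_of_fp f fun X hX a b => inj X hX a b
  refine isIso_of_bijective_of_fp f fun X hX => ⟨fun a b => inj X hX a b, fun a => ?_⟩
  obtain ⟨_, p, b, hp, e₁⟩ := hI.surj X hX a
  obtain ⟨_, q, b', hq, e₂⟩ := hJ.surj X hX a
  obtain ⟨c, hc⟩ := exists_lift_of_refinement h hp hq ⟨b, e₁.symm⟩ ⟨b', e₂.symm⟩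
  exact ⟨c, hc.symm⟩

end FPIdal

end Consequences

/-! ### Descent for objects and morphisms -/

section Descent

open Cardinal

attribute [local instance] fact_isRegular_aleph0

variable {D : Type u₂} [Category.{v} D] [MonoidalCategory D] [SymmetricCategory D]
  [LFPTensorCategory D]

namespace FPIdal

/-- A further localization inverts more morphisms. -/
lemma localEquiv_le_of_inverts {J L : FPIdal D} (h : L.loc.Inverts J.toIdal) {X Y : D}
    {f : X ⟶ Y} (hf : J.localEquiv f) : L.localEquiv f :=
  (L.localEquiv_iff_isIso_R f).2 (J.isInvertedBy L.R h.isIso_act f hf)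

lemma localEquiv_comp {J : FPIdal D} {X Y Z : D} {f : X ⟶ Y} {g : Y ⟶ Z} (hf : J.localEquiv f)
    (hg : J.localEquiv g) : J.localEquiv (f ≫ g) :=
  J.localEquiv.comp_mem _ _ hf hg

lemma localEquiv_of_precomp {J : FPIdal D} {X Y Z : D} {f : X ⟶ Y} {g : Y ⟶ Z}
    (hf : J.localEquiv f) (hfg : J.localEquiv (f ≫ g)) : J.localEquiv g := by
  rw [localEquiv_iff_isIso_R] at *
  rw [Functor.map_comp] at hfg
  exact IsIso.of_isIso_comp_left (J.R.map f) _

lemma localEquiv_of_postcomp {J : FPIdal D} {X Y Z : D} {f : X ⟶ Y} {g : Y ⟶ Z}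
    (hg : J.localEquiv g) (hfg : J.localEquiv (f ≫ g)) : J.localEquiv f := by
  rw [localEquiv_iff_isIso_R] at *
  rw [Functor.map_comp] at hfg
  exact IsIso.of_isIso_comp_right _ (J.R.map g)

lemma localEquiv_of_isIso (J : FPIdal D) {X Y : D} (f : X ⟶ Y) [IsIso f] : J.localEquiv f := by
  rw [localEquiv_iff_isIso_R]; infer_instance

/-- The action of `I ⊗ J` is the composition of the actions of `J` and `I`. -/
lemma isLocal_tensor {I J : FPIdal D} {M : D} (hI : I.isLocal M) (hJ : J.isLocal M) :
    (I.tensor J).isLocal M := by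
  refine isLocal_of_fp fun X _ => ?_
  have e : (I.tensor J).act X = (α_ X I.obj J.obj).inv ≫ J.act (X ⊗ I.obj) ≫ I.act X := by
    have key {A B : D} (a : A ⟶ 𝟙_ D) (b : B ⟶ 𝟙_ D) : X ◁ ((A ◁ b ≫ (ρ_ A).hom) ≫ a) ≫ (ρ_ X).hom =
        (α_ X A B).inv ≫ ((X ⊗ A) ◁ b ≫ (ρ_ (X ⊗ A)).hom) ≫ X ◁ a ≫ (ρ_ X).hom := by
      simp
    change X ◁ (I.toIdal.tensor J.toIdal).hom ≫ (ρ_ X).hom = _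
    rw [← (I.toIdal.fst J.toIdal).w]
    exact key _ _
  have h := (isLocal_bijective hJ (X ⊗ I.obj)).comp (isLocal_bijective hI X)
  have h' : Function.Bijective (fun a : (X ⊗ I.obj) ⊗ J.obj ⟶ M => (α_ X I.obj J.obj).inv ≫ a) :=
    ⟨fun a b e => by simpa using e, fun a => ⟨(α_ X I.obj J.obj).hom ≫ a, by simp⟩⟩
  have h'' := h'.comp h
  have e' : (fun a : X ⟶ M => (I.tensor J).act X ≫ a) = (fun a => (α_ X I.obj J.obj).inv ≫ a) ∘
      (fun a => J.act (X ⊗ I.obj) ≫ a) ∘ fun a => I.act X ≫ a := by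
    funext a
    rw [e]
    exact (Category.assoc _ _ _).trans (congrArg _ (Category.assoc _ _ _))
  exact e' ▸ h''

/-- The idal `L` plays the role of the intersection of `I` and `J`: the localization at `L` inverts
both, and the objects which are local for both are local for `L`. -/
structure IsMeet (I J L : FPIdal D) : Prop where
  left : L.loc.Inverts I.toIdal
  right : L.loc.Inverts J.toIdal
  isLocal : ∀ {M : D}, I.isLocal M → J.isLocal M → L.isLocal M

lemma isMeet_tensor (I J : FPIdal D) : IsMeet I J (I.tensor J) where
  left := inverts_left I J
  right := inverts_right I J
  isLocal := isLocal_tensor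

lemma IsMeet.symm {I J L : FPIdal D} (h : IsMeet I J L) : IsMeet J I L where
  left := h.right
  right := h.left
  isLocal hI hJ := h.isLocal hJ hI

/-- If `M` is local for `J`, then the localization of `M` at `I` is local for both idals by
`isLocal_R`, and hence agrees with the localization of `M` at `L`. -/
lemma IsMeet.localEquiv_of_isLocal {I J L : FPIdal D} (h : IsMeet I J L) {M Q : D} {f : M ⟶ Q}
    (hM : J.isLocal M) (hQ : L.isLocal Q) (hf : L.localEquiv f) : I.localEquiv f := by
  have hN : L.isLocal (I.incl.obj (I.R.obj M)) := h.isLocal (I.isLocal_incl _) (isLocal_R I hM)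
  have hu : L.localEquiv (I.adj.unit.app M) := localEquiv_le_of_inverts h.left (I.localEquiv_unit M)
  obtain ⟨g, hg⟩ := (bijective_of_localEquiv hN hf).2 (I.adj.unit.app M)
  dsimp at hg
  have hg' : L.localEquiv g := localEquiv_of_precomp hf (by rw [hg]; exact hu)
  have : IsIso g := (localEquiv_iff_locBij.1 hg').isIso hQ hN
  refine localEquiv_of_postcomp (I.localEquiv_of_isIso g) ?_
  rw [hg]
  exact I.localEquiv_unit M

variable {J₁ J₂ L : FPIdal D}

/-- Descent: given objects `A₁` and `A₂` which are local for `J₁` and `J₂` with a common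
localization `Q` on the overlap, their pullback localizes to `A₁` and `A₂`. -/
lemma IsMeet.localEquiv_fst (hL : IsMeet J₁ J₂ L) {P A₁ A₂ Q : D} {p₁ : P ⟶ A₁} {p₂ : P ⟶ A₂}
    {f₁ : A₁ ⟶ Q} {f₂ : A₂ ⟶ Q} (sq : IsPullback p₁ p₂ f₁ f₂) (h₂ : J₂.isLocal A₂)
    (hQ : L.isLocal Q) (hf₂ : L.localEquiv f₂) : J₁.localEquiv p₁ :=
  localEquiv_of_isPullback sq (hL.localEquiv_of_isLocal h₂ hQ hf₂)

lemma IsMeet.localEquiv_snd (hL : IsMeet J₁ J₂ L) {P A₁ A₂ Q : D} {p₁ : P ⟶ A₁} {p₂ : P ⟶ A₂}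
    {f₁ : A₁ ⟶ Q} {f₂ : A₂ ⟶ Q} (sq : IsPullback p₁ p₂ f₁ f₂) (h₁ : J₁.isLocal A₁)
    (hQ : L.isLocal Q) (hf₁ : L.localEquiv f₁) : J₂.localEquiv p₂ :=
  hL.symm.localEquiv_fst sq.flip h₁ hQ hf₁

/-- An object `A` with localizations `A₁` and `A₂`, which become isomorphic to `Q` on the overlap,
is their pullback: the comparison morphism is locally an isomorphism. -/
lemma isPullback_of_localEquiv (h : J₁.toIdal.IsCover J₂.toIdal) (hL : IsMeet J₁ J₂ L)
    {A A₁ A₂ Q : D} {p₁ : A ⟶ A₁} {p₂ : A ⟶ A₂} {f₁ : A₁ ⟶ Q} {f₂ : A₂ ⟶ Q}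
    (w : p₁ ≫ f₁ = p₂ ≫ f₂) (h₁ : J₁.isLocal A₁) (h₂ : J₂.isLocal A₂) (hQ : L.isLocal Q)
    (hf₁ : L.localEquiv f₁) (hf₂ : L.localEquiv f₂)
    (hp₁ : J₁.localEquiv p₁) (hp₂ : J₂.localEquiv p₂) : IsPullback p₁ p₂ f₁ f₂ := by
  have := LFPTensorCategory.locallyFinitelyPresentable (C := D)
  have := hasPullbacks_of_locallyFinitelyPresentable D
  have sq := IsPullback.of_hasPullback f₁ f₂
  let g : A ⟶ pullback f₁ f₂ := pullback.lift p₁ p₂ w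
  have hg₁ : J₁.localEquiv g := localEquiv_of_postcomp (hL.localEquiv_fst sq h₂ hQ hf₂)
    (by rw [pullback.lift_fst]; exact hp₁)
  have hg₂ : J₂.localEquiv g := localEquiv_of_postcomp (hL.localEquiv_snd sq h₁ hQ hf₁)
    (by rw [pullback.lift_snd]; exact hp₂)
  have : IsIso g := isIso_of_localEquiv_of_isCover h hg₁ hg₂
  exact sq.of_iso (asIso g).symm (Iso.refl _) (Iso.refl _) (Iso.refl _)
    (by simpa using pullback.lift_fst ..) (by simpa using pullback.lift_snd ..) (by simp) (by simp)

/-- The morphism `R_J A ⟶ R_L A` in `D`, where the localization at `L` is a localization of the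
one at `J`. -/
noncomputable def overlapMap (L J : FPIdal D) (h : L.loc.Inverts J.toIdal) (A : D) :
    J.incl.obj (J.R.obj A) ⟶ L.incl.obj (L.R.obj A) :=
  L.adj.unit.app (J.incl.obj (J.R.obj A)) ≫ L.incl.map (cIso L J h A).inv

lemma unit_overlapMap (L J : FPIdal D) (h : L.loc.Inverts J.toIdal) (A : D) :
    J.adj.unit.app A ≫ overlapMap L J h A = L.adj.unit.app A := by
  rw [overlapMap]
  erw [← Category.assoc, unit_naturality]
  rw [Category.assoc, ← Functor.map_comp]
  erw [← cIso_hom L J h, Iso.hom_inv_id, CategoryTheory.Functor.map_id, Category.comp_id]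
  rfl

lemma localEquiv_overlapMap (L J : FPIdal D) (h : L.loc.Inverts J.toIdal) (A : D) :
    L.localEquiv (overlapMap L J h A) :=
  localEquiv_comp (L.localEquiv_unit _) (L.localEquiv_of_isIso _)

/-- Every object is the pullback of its localizations over the one at the overlap. -/
lemma isPullback_unit (h : J₁.toIdal.IsCover J₂.toIdal) (hL : IsMeet J₁ J₂ L) (A : D) :
    IsPullback (J₁.adj.unit.app A) (J₂.adj.unit.app A) (overlapMap L J₁ hL.left A)
      (overlapMap L J₂ hL.right A) :=
  isPullback_of_localEquiv h hL ((unit_overlapMap ..).trans (unit_overlapMap ..).symm)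
    (isLocal_incl _) (isLocal_incl _) (isLocal_incl _) (localEquiv_overlapMap _ _ _ _)
    (localEquiv_overlapMap _ _ _ _) (localEquiv_unit _ _) (localEquiv_unit _ _)

lemma unit_incl_map_injective (J : FPIdal D) {X : D} {M : J.Loc} {s t : J.R.obj X ⟶ M}
    (h : J.adj.unit.app X ≫ J.incl.map s = J.adj.unit.app X ≫ J.incl.map t) : s = t := by
  apply (J.adj.homEquiv _ _).injective
  rw [Adjunction.homEquiv_unit, Adjunction.homEquiv_unit]
  exact h

lemma R_map_injective_iff (J : FPIdal D) {X A : D} {a b : X ⟶ A} :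
    J.R.map a = J.R.map b ↔ a ≫ J.adj.unit.app A = b ≫ J.adj.unit.app A := by
  rw [unit_naturality, unit_naturality]
  refine ⟨fun h => by rw [h], fun h => ?_⟩
  exact J.unit_incl_map_injective h

/-- The localizations at the idals of a cover are jointly faithful. -/
lemma hom_ext_of_isCover (h : J₁.toIdal.IsCover J₂.toIdal) {X A : D} {a b : X ⟶ A}
    (h₁ : J₁.R.map a = J₁.R.map b) (h₂ : J₂.R.map a = J₂.R.map b) : a = b :=
  (isPullback_unit h (isMeet_tensor J₁ J₂) A).hom_ext (J₁.R_map_injective_iff.1 h₁)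
    (J₂.R_map_injective_iff.1 h₂)

/-- The morphism `R_L X ⟶ R_L A` induced by a morphism `R_J X ⟶ R_J A`. -/
noncomputable def onOverlap (L J : FPIdal D) (h : L.loc.Inverts J.toIdal) {X A : D}
    (t : J.R.obj X ⟶ J.R.obj A) : L.R.obj X ⟶ L.R.obj A :=
  (cIso L J h X).hom ≫ L.R.map (J.incl.map t) ≫ (cIso L J h A).inv

lemma onOverlap_R_map (L J : FPIdal D) (h : L.loc.Inverts J.toIdal) {X A : D} (t : X ⟶ A) :
    onOverlap L J h (J.R.map t) = L.R.map t := by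
  simp [onOverlap, map_R L J h]

lemma onOverlap_comp (L J : FPIdal D) (h : L.loc.Inverts J.toIdal) {X A B : D}
    (s : J.R.obj X ⟶ J.R.obj A) (t : J.R.obj A ⟶ J.R.obj B) :
    onOverlap L J h (s ≫ t) = onOverlap L J h s ≫ onOverlap L J h t := by
  simp [onOverlap]

lemma onOverlap_comp_R_map (L J : FPIdal D) (h : L.loc.Inverts J.toIdal) {X A B : D}
    (s : J.R.obj X ⟶ J.R.obj A) (t : A ⟶ B) :
    onOverlap L J h (s ≫ J.R.map t) = onOverlap L J h s ≫ L.R.map t := by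
  rw [onOverlap_comp, onOverlap_R_map]

/-- Morphisms are glued from morphisms between the localizations. -/
lemma exists_hom_of_isCover (h : J₁.toIdal.IsCover J₂.toIdal) (hL : IsMeet J₁ J₂ L) {X A : D}
    (t₁ : J₁.R.obj X ⟶ J₁.R.obj A) (t₂ : J₂.R.obj X ⟶ J₂.R.obj A)
    (e : onOverlap L J₁ hL.left t₁ = onOverlap L J₂ hL.right t₂) :
    ∃ t : X ⟶ A, J₁.R.map t = t₁ ∧ J₂.R.map t = t₂ := by
  have key (J : FPIdal D) (hJ : L.loc.Inverts J.toIdal) (t : J.R.obj X ⟶ J.R.obj A) :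
      (J.adj.unit.app X ≫ J.incl.map t) ≫ overlapMap L J hJ A = L.adj.unit.app X ≫
        L.incl.map (onOverlap L J hJ t) := by
    -- The transpose `X ⟶ R_J A` of `t`, followed by `R_J A ⟶ R_L A`, is the transpose of the
    -- restriction of `t` to the overlap.
    simp only [Functor.map_comp, overlapMap, onOverlap, Category.assoc]
    rw [cIso_hom]
    erw [← reassoc_of% L.unit_naturality (J.adj.unit.app X),
      reassoc_of% L.unit_naturality (J.incl.map t)]
  have key' (J : FPIdal D) (t : J.R.obj X ⟶ J.R.obj A) (s : X ⟶ A)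
      (hs : s ≫ J.adj.unit.app A = J.adj.unit.app X ≫ J.incl.map t) : J.R.map s = t :=
    J.unit_incl_map_injective ((J.unit_naturality s).symm.trans hs)
  have sq := isPullback_unit h hL A
  refine ⟨sq.lift (J₁.adj.unit.app X ≫ J₁.incl.map t₁) (J₂.adj.unit.app X ≫ J₂.incl.map t₂) ?_,
    key' _ _ _ (sq.lift_fst _ _ _), key' _ _ _ (sq.lift_snd _ _ _)⟩
  rw [key, key, e]

/-- Finite presentability in terms of elements: morphisms to filtered colimits factor through a
stage, and the equality of two such factorizations is attained at a later stage. -/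
lemma isFinitelyPresentable_of_exists {A : D} (h : ∀ (K : Type v) [SmallCategory K] [IsFiltered K]
    (F : K ⥤ D) (c : Cocone F), IsColimit c →
      (∀ a : A ⟶ c.pt, ∃ k, ∃ b : A ⟶ F.obj k, b ≫ c.ι.app k = a) ∧
      ∀ (k : K) (a b : A ⟶ F.obj k), a ≫ c.ι.app k = b ≫ c.ι.app k →
        ∃ (l : K) (f : k ⟶ l), a ≫ F.map f = b ≫ F.map f) : IsFinitelyPresentable.{v} A := by
  rw [isFinitelyPresentable_iff_preservesFilteredColimits]
  refine ⟨fun K _ _ => ⟨fun {F} => ⟨fun {c} hc => ?_⟩⟩⟩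
  obtain ⟨h₁, h₂⟩ := h K F c hc
  refine ⟨Types.FilteredColimit.isColimitOf' _ _ (fun a => ?_) fun k a b e => h₂ k a b e⟩
  obtain ⟨k, b, hb⟩ := h₁ a
  exact ⟨k, b, hb.symm⟩

lemma isFinitelyPresentable_trans {L J : FPIdal D} (h : L.loc.Inverts J.toIdal) (M : J.Loc)
    (hM : IsFinitelyPresentable.{v} M) :
    IsFinitelyPresentable.{v} (L.R.obj (J.incl.obj M)) :=
  J.lift_preservesFP L.loc h (fun X hX => L.isFinitelyPresentable_R X hX) M hM

/-- Being finitely presentable is local with respect to an idal cover. -/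
lemma isFinitelyPresentable_of_isCover (h : J₁.toIdal.IsCover J₂.toIdal) {A : D}
    (h₁ : IsFinitelyPresentable.{v} (J₁.R.obj A)) (h₂ : IsFinitelyPresentable.{v} (J₂.R.obj A)) :
    IsFinitelyPresentable.{v} A := by
  have hL := isMeet_tensor J₁ J₂
  set L := J₁.tensor J₂
  have hA : IsFinitelyPresentable.{v} (L.R.obj A) := by
    have := isFinitelyPresentable_trans hL.left _ h₁
    exact isCardinalPresentable_of_iso (cIso L J₁ hL.left A).symm ℵ₀
  refine isFinitelyPresentable_of_exists fun K _ _ F c hc => ⟨fun a => ?_, fun k a b e => ?_⟩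
  · have hc₁ := isColimitOfPreserves J₁.R hc
    have hc₂ := isColimitOfPreserves J₂.R hc
    have hcL := isColimitOfPreserves L.R hc
    obtain ⟨k₁, t₁, e₁⟩ := IsFinitelyPresentable.exists_hom_of_isColimit hc₁ (J₁.R.map a)
    obtain ⟨k₂, t₂, e₂⟩ := IsFinitelyPresentable.exists_hom_of_isColimit hc₂ (J₂.R.map a)
    have e₁' : t₁ ≫ J₁.R.map (c.ι.app k₁) = J₁.R.map a := e₁
    have e₂' : t₂ ≫ J₂.R.map (c.ι.app k₂) = J₂.R.map a := e₂
    -- The local factorizations agree on the overlap at a later stage, since `R_L A` is finitely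
    -- presentable as well; there they are glued.
    obtain ⟨l, f₁, f₂, e⟩ := IsFinitelyPresentable.exists_eq_of_isColimit hcL
      (onOverlap L J₁ hL.left t₁) (onOverlap L J₂ hL.right t₂) (by
        have h₁ := onOverlap_comp_R_map L J₁ hL.left t₁ (c.ι.app k₁)
        have h₂ := onOverlap_comp_R_map L J₂ hL.right t₂ (c.ι.app k₂)
        rw [e₁', onOverlap_R_map] at h₁
        rw [e₂', onOverlap_R_map] at h₂
        exact h₁.symm.trans h₂)
    obtain ⟨t, ht₁, ht₂⟩ := exists_hom_of_isCover h hL (t₁ ≫ J₁.R.map (F.map f₁))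
      (t₂ ≫ J₂.R.map (F.map f₂)) (by rw [onOverlap_comp_R_map, onOverlap_comp_R_map]; exact e)
    refine ⟨l, t, hom_ext_of_isCover h ?_ ?_⟩
    · rw [Functor.map_comp, ht₁, Category.assoc, ← Functor.map_comp, c.w, e₁']
    · rw [Functor.map_comp, ht₂, Category.assoc, ← Functor.map_comp, c.w, e₂']
  · have hc₁ := isColimitOfPreserves J₁.R hc
    have hc₂ := isColimitOfPreserves J₂.R hc
    have hK : IsCardinalFiltered K (ℵ₀ : Cardinal.{v}) := by
      rw [isCardinalFiltered_aleph0_iff]; infer_instance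
    have map_eq (J : FPIdal D) {l : K} {a b : A ⟶ F.obj l} (e : a ≫ c.ι.app l = b ≫ c.ι.app l) :
        J.R.map a ≫ (J.R.mapCocone c).ι.app l = J.R.map b ≫ (J.R.mapCocone c).ι.app l :=
      (J.R.map_comp _ _).symm.trans ((congrArg J.R.map e).trans (J.R.map_comp _ _))
    obtain ⟨l₁, f₁, e₁⟩ := IsCardinalPresentable.exists_eq_of_isColimit' ℵ₀ hc₁ (J₁.R.map a)
      (J₁.R.map b) (map_eq J₁ e)
    obtain ⟨l₂, f₂, e₂⟩ := IsCardinalPresentable.exists_eq_of_isColimit' ℵ₀ hc₂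
      (J₂.R.map (a ≫ F.map f₁)) (J₂.R.map (b ≫ F.map f₁)) (map_eq J₂ (by simpa using e))
    have e₁' : J₁.R.map (a ≫ F.map f₁) = J₁.R.map (b ≫ F.map f₁) := by
      rw [Functor.map_comp, Functor.map_comp]; exact e₁
    have e₂' : J₂.R.map ((a ≫ F.map f₁) ≫ F.map f₂) = J₂.R.map ((b ≫ F.map f₁) ≫ F.map f₂) := by
      rw [Functor.map_comp, Functor.map_comp J₂.R (b ≫ F.map f₁)]; exact e₂
    refine ⟨l₂, f₁ ≫ f₂, ?_⟩
    rw [Functor.map_comp, ← Category.assoc, ← Category.assoc]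
    exact hom_ext_of_isCover h (by
      rw [J₁.R.map_comp (a ≫ _), e₁', ← J₁.R.map_comp]) e₂'

end FPIdal

end Descent

/-! ### Morphisms between localized tensor functors -/

section LocalizedMorphisms

open FPIdal Functor.LaxMonoidal

variable {C : Type u₁} [Category.{v} C] [MonoidalCategory C] [SymmetricCategory C]
  [LFPTensorCategory C]
  {D : Type u₂} [Category.{v} D] [MonoidalCategory D] [SymmetricCategory D] [LFPTensorCategory D]

variable {F G : TensorFunctor C D}

/-- Morphisms of tensor functors are glued from morphisms between their localizations. -/
lemma exists_hom_of_localizations {J₁ J₂ L : FPIdal D} (h : J₁.toIdal.IsCover J₂.toIdal)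
    (hL : IsMeet J₁ J₂ L) (t₁ : F.comp J₁.loc ⟶ G.comp J₁.loc) (t₂ : F.comp J₂.loc ⟶ G.comp J₂.loc)
    (e : ∀ X, onOverlap L J₁ hL.left (t₁.hom.app X) = onOverlap L J₂ hL.right (t₂.hom.app X)) :
    ∃ τ : F ⟶ G, (∀ X, J₁.R.map (τ.hom.app X) = t₁.hom.app X) ∧
      ∀ X, J₂.R.map (τ.hom.app X) = t₂.hom.app X := by
  -- The components are glued; naturality and monoidality are equations between morphisms of `D`, so
  -- that they hold because they hold locally.
  choose τ h₁ h₂ using fun X => exists_hom_of_isCover h hL (t₁.hom.app X) (t₂.hom.app X) (e X)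
  have nat (J : FPIdal D) (t : F.comp J.loc ⟶ G.comp J.loc)
      (ht : ∀ X, J.R.map (τ X) = t.hom.app X) {X Y : C} (g : X ⟶ Y) :
      J.R.map (F.toFunctor.map g ≫ τ Y) = J.R.map (τ X ≫ G.toFunctor.map g) := by
    rw [Functor.map_comp, Functor.map_comp, ht, ht]
    exact t.hom.naturality g
  have unit (J : FPIdal D) (t : F.comp J.loc ⟶ G.comp J.loc)
      (ht : ∀ X, J.R.map (τ X) = t.hom.app X) :
      J.R.map (ε F.toFunctor ≫ τ (𝟙_ C)) = J.R.map (ε G.toFunctor) := by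
    rw [Functor.map_comp, ht, ← cancel_epi (ε J.R)]
    have := NatTrans.IsMonoidal.unit (τ := t.hom)
    exact (Category.assoc _ _ _).symm.trans this
  have tensor (J : FPIdal D) (t : F.comp J.loc ⟶ G.comp J.loc)
      (ht : ∀ X, J.R.map (τ X) = t.hom.app X) (X Y : C) :
      J.R.map (μ F.toFunctor X Y ≫ τ (X ⊗ Y)) =
        J.R.map ((τ X ⊗ₘ τ Y) ≫ μ G.toFunctor X Y) := by
    rw [Functor.map_comp, Functor.map_comp, ht, ← cancel_epi (μ J.R _ _), ← μ_natural_assoc, ht, ht]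
    have := NatTrans.IsMonoidal.tensor (τ := t.hom) X Y
    exact (Category.assoc _ _ _).symm.trans this
  exact ⟨⟨{ app := τ
            naturality := fun X Y g =>
              hom_ext_of_isCover h (nat J₁ t₁ h₁ g) (nat J₂ t₂ h₂ g) },
          { unit := hom_ext_of_isCover h (unit J₁ t₁ h₁) (unit J₂ t₂ h₂)
            tensor := fun X Y =>
              hom_ext_of_isCover h (tensor J₁ t₁ h₁ X Y) (tensor J₂ t₂ h₂ X Y) }⟩, h₁, h₂⟩

variable (hF : TensorFunctor.preservesFP F) (hG : TensorFunctor.preservesFP G)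

/-- Removes the identities contributed by associativity isomorphisms of tensor functors. -/
lemma id_cancel₃ {A : Type u₁} [Category.{v} A] {X Y Z Z' Z'' : A} (f : X ⟶ Y) (g : Y ⟶ Z)
    (h : Z ⟶ Z') (k : Z' ⟶ Z'') : f ≫ g ≫ 𝟙 _ ≫ h ≫ 𝟙 _ ≫ k = f ≫ g ≫ h ≫ k := by simp

lemma unrestr_aux {J J' : FPIdal D} (h : J.loc.Inverts J'.toIdal) {A A' : J.Loc} {B : D}
    {B' : J'.Loc} (a : A ⟶ A') (b : A' ⟶ J.R.obj (J'.incl.obj B')) {c : J'.R.obj B ⟶ B'} {c' : B' ⟶ J'.R.obj B}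
    (e : c' ≫ c = 𝟙 _) :
    a ≫ b = (a ≫ b ≫ J.R.map (J'.incl.map c') ≫ (cIso J J' h B).inv) ≫
      (cIso J J' h B).hom ≫ J.R.map (J'.incl.map c) := by
  simp only [Category.assoc, Iso.inv_hom_id_assoc]
  rw [← Functor.map_comp, ← Functor.map_comp, e]
  simp

lemma restrPath_unrestr_aux {J J' L L' : FPIdal D} (h : L.loc.Inverts J.toIdal)
    (h' : L'.loc.Inverts J'.toIdal) (hJ : J.loc.Inverts J'.toIdal) (hL : L.loc.Inverts L'.toIdal)
    (hLJ : L.loc.Inverts J'.toIdal) {A A' B B' : D} {a : A ⟶ A'} {b : B ⟶ B'}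
    {t : J.R.obj A ⟶ J.R.obj B} {s : J.R.obj A' ⟶ J.R.obj (J'.incl.obj (J'.R.obj B'))}
    (e : J.R.map a ≫ s = t ≫ (cIso J J' hJ B).hom ≫ J.R.map (J'.incl.map (J'.R.map b))) :
    ((cIso L J h A).hom ≫ L.R.map (J.incl.map (J.R.map a))) ≫
      L.R.map (J.incl.map s) ≫ (cIso L J h _).inv ≫
        (cIso L L' hL (J'.incl.obj (J'.R.obj B'))).hom =
    onOverlap L J h t ≫ (cIso L L' hL B).hom ≫ L.R.map (L'.incl.map
      ((cIso L' J' h' B).hom ≫ L'.R.map (J'.incl.map (J'.R.map b)))) := by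
  have e' := congrArg (fun x => L.R.map (J.incl.map x)) e
  simp only [Functor.map_comp] at e'
  simp only [onOverlap, Functor.map_comp, Category.assoc]
  rw [reassoc_of% e', map_R L J h (J'.incl.map (J'.R.map b)), map_cIso_hom L J J' h hJ hLJ,
    map_cIso_hom L L' J' hL h' hLJ, map_R L L' hL (J'.incl.map (J'.R.map b))]
  simp only [Category.assoc, Iso.hom_inv_id_assoc]

section

variable {hF hG} {I : FPIdal C} {f : (I.map F hF).toIdal ⟶ (I.map G hG).toIdal}

/-- The morphism `R_{F(I)} F ⟶ R_{F(I)} G` corresponding to a morphism `F_I ⟶ f^* G_I`. -/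
noncomputable def unrestrMap (η : restr F hF I ⟶ (restr G hG I).comp (pull f)) :
    F.comp (I.map F hF).loc ⟶ G.comp (I.map F hF).loc :=
  (restrIso F hF I).hom ≫ I.loc.whiskerLeft η ≫ (TensorFunctor.assoc _ _ _).inv ≫
    TensorFunctor.whiskerRight (restrIso G hG I).inv (pull f) ≫ (TensorFunctor.assoc _ _ _).hom ≫
    G.whiskerLeft (transIso (I.map F hF) (I.map G hG) ((I.map F hF).loc_inverts.of_hom f)).inv

lemma unrestrMap_app_aux (η : restr F hF I ⟶ (restr G hG I).comp (pull f)) (X : C) :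
    (unrestrMap η).hom.app X =
      (restrIso F hF I).hom.hom.app X ≫ η.hom.app (I.R.obj X) ≫
        (I.map F hF).R.map ((I.map G hG).incl.map ((restrIso G hG I).inv.hom.app X)) ≫
      (cIso (I.map F hF) (I.map G hG) ((I.map F hF).loc_inverts.of_hom f)
        (G.toFunctor.obj X)).inv := by
  refine Eq.trans ?_ (id_cancel₃ _ _ _ _)
  rfl

/-- The characterizing property of `unrestrMap`: it corresponds to `η` under the canonical
isomorphisms `R_{F(I)} F ≅ F_I R_I` and `R_{G(I)} G ≅ G_I R_I`. -/
lemma unrestrMap_app (η : restr F hF I ⟶ (restr G hG I).comp (pull f)) (X : C) :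
    (restrIso F hF I).hom.hom.app X ≫ η.hom.app (I.R.obj X) = (unrestrMap η).hom.app X ≫
      (cIso (I.map F hF) (I.map G hG) ((I.map F hF).loc_inverts.of_hom f) (G.toFunctor.obj X)).hom ≫
      (I.map F hF).R.map ((I.map G hG).incl.map ((restrIso G hG I).hom.hom.app X)) := by
  rw [unrestrMap_app_aux]
  exact unrestr_aux _ _ _ (iso_inv_hom_app (restrIso G hG I) X)

/-- The compatibility of `unrestrMap` with the localization at the overlap. -/
lemma restrPath_unrestrMap (η : restr F hF I ⟶ (restr G hG I).comp (pull f)) {L L' : FPIdal D}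
    (g : L.toIdal ⟶ L'.toIdal) (h : L.loc.Inverts (I.map F hF).toIdal)
    (h' : L'.loc.Inverts (I.map G hG).toIdal) (X : C) :
    (restrPathIso F hF I L h).hom.hom.app X ≫ (pathMap h h' f g η).hom.app X =
      onOverlap L (I.map F hF) h ((unrestrMap η).hom.app X) ≫
        (cIso L L' (L.loc_inverts.of_hom g) _).hom ≫
          L.R.map (L'.incl.map ((restrPathIso G hG I L' h').hom.hom.app X)) := by
  rw [restrPathIso_hom_app, restrPathIso_hom_app, pathMap_app]
  exact restrPath_unrestr_aux h h' _ _ (h.of_hom f) (unrestrMap_app η X)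

end

end LocalizedMorphisms

/-! ### Full faithfulness -/

section FullyFaithful

open FPIdal Functor.LaxMonoidal

variable {C : Type u₁} [Category.{v} C] [MonoidalCategory C] [SymmetricCategory C]
  [LFPTensorCategory C]
  {D : Type u₂} [Category.{v} D] [MonoidalCategory D] [SymmetricCategory D] [LFPTensorCategory D]

variable {F G : TensorFunctor C D} {hF : TensorFunctor.preservesFP F}
  {hG : TensorFunctor.preservesFP G} {I₁ I₂ : FPIdal C} {hI : I₁.toIdal.IsCover I₂.toIdal}

/-- If `o₁` and `o₂` correspond to `m₁` and `m₂` under isomorphisms `pᵢ`, `qᵢ`, `c`, and the `mᵢ`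
are compatible with the gluing isomorphisms `p₁⁻¹ p₂` and `q₁⁻¹ q₂`, then `o₁ = o₂`. -/
lemma overlap_aux {L L' : FPIdal D} {A₁ A₂ B : L.Loc} {A₁' A₂' B' : L'.Loc}
    {p₁ : B ⟶ A₁} {p₁' : A₁ ⟶ B} (hp₁ : p₁ ≫ p₁' = 𝟙 _) {p₂ : B ⟶ A₂}
    {q₁ : B' ⟶ A₁'} {q₁' : A₁' ⟶ B'} (hq₁ : q₁ ≫ q₁' = 𝟙 _) {q₂ : B' ⟶ A₂'} {q₂' : A₂' ⟶ B'}
    (hq₂ : q₂ ≫ q₂' = 𝟙 _)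
    {m₁ : A₁ ⟶ L.R.obj (L'.incl.obj A₁')} {m₂ : A₂ ⟶ L.R.obj (L'.incl.obj A₂')}
    {Q : L.Loc} {o₁ o₂ : B ⟶ Q} {c : Q ⟶ L.R.obj (L'.incl.obj B')}
    {c' : L.R.obj (L'.incl.obj B') ⟶ Q}
    (hc : c ≫ c' = 𝟙 _)
    (h₁ : p₁ ≫ m₁ = o₁ ≫ c ≫ L.R.map (L'.incl.map q₁))
    (h₂ : p₂ ≫ m₂ = o₂ ≫ c ≫ L.R.map (L'.incl.map q₂))
    (e : (p₁' ≫ p₂) ≫ m₂ = m₁ ≫ L.R.map (L'.incl.map (q₁' ≫ q₂))) : o₁ = o₂ := by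
  have h := p₁ ≫= e
  rw [Category.assoc, reassoc_of% hp₁, h₂, reassoc_of% h₁, ← Functor.map_comp, ← Functor.map_comp,
    reassoc_of% hq₁] at h
  have h' := h =≫ (L.R.map (L'.incl.map q₂') ≫ c')
  simp only [Category.assoc] at h'
  rw [← Functor.map_comp_assoc, ← Functor.map_comp, hq₂] at h'
  simpa [hc] using h'.symm

/-- The compatibility of a morphism of local data with the isomorphisms `δ` says that its two
components agree on the overlap, at the objects which are local for `I₁ ⊗ I₂`. -/
lemma onOverlap_unrestrMap_incl (φ : restrictObj I₁ I₂ hI F hF ⟶ restrictObj I₁ I₂ hI G hG)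
    (M : (I₁.tensor I₂).Loc) :
    onOverlap ((I₁.map F hF).tensor (I₂.map F hF)) (I₁.map F hF) (inverts_left _ _)
      ((unrestrMap φ.η₁).hom.app ((I₁.tensor I₂).incl.obj M)) =
    onOverlap ((I₁.map F hF).tensor (I₂.map F hF)) (I₂.map F hF) (inverts_right _ _)
      ((unrestrMap φ.η₂).hom.app ((I₁.tensor I₂).incl.obj M)) := by
  have e := congrArg (fun t => t.hom.app M) φ.comm
  have e' := (congrArg (_ ≫ ·) (glueMap₂_app _ _ _ _ _ M)).symm.trans
    (e.trans (congrArg (· ≫ _) (glueMap₁_app _ _ _ _ _ M)))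
  exact overlap_aux
      (iso_hom_inv_app (restrPathIso F hF I₁ _ (inverts_left _ (I₂.map F hF))) _)
      (iso_hom_inv_app (restrPathIso G hG I₁ _ (inverts_left _ (I₂.map G hG))) _)
      (iso_hom_inv_app (restrPathIso G hG I₂ _ (inverts_right (I₁.map G hG) _)) _)
      (Iso.hom_inv_id _)
      (restrPath_unrestrMap φ.η₁ (FPIdal.tensorHom φ.f₁ φ.f₂) _ _ _)
      (restrPath_unrestrMap φ.η₂ (FPIdal.tensorHom φ.f₁ φ.f₂) _ _ _) e'

lemma onOverlap_comm {J L : FPIdal D} (h : L.loc.Inverts J.toIdal) {X Y A B : D}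
    {a : X ⟶ Y} {b : A ⟶ B} {t : J.R.obj X ⟶ J.R.obj A} {s : J.R.obj Y ⟶ J.R.obj B}
    (e : J.R.map a ≫ s = t ≫ J.R.map b) :
    L.R.map a ≫ onOverlap L J h s = onOverlap L J h t ≫ L.R.map b := by
  rw [← onOverlap_R_map L J h, ← onOverlap_R_map L J h, ← onOverlap_comp, ← onOverlap_comp, e]

lemma onOverlap_naturality {J L : FPIdal D} (h : L.loc.Inverts J.toIdal)
    (t : F.comp J.loc ⟶ G.comp J.loc) {X Y : C} (g : X ⟶ Y) :
    L.R.map (F.toFunctor.map g) ≫ onOverlap L J h (t.hom.app Y) =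
      onOverlap L J h (t.hom.app X) ≫ L.R.map (G.toFunctor.map g) :=
  onOverlap_comm h (t.hom.naturality g)

/-- The agreement on the overlap at an arbitrary object `X` follows from that at its localization,
because the localization of `D` at the overlap inverts the image of the unit at `X`. -/
lemma onOverlap_unrestrMap (φ : restrictObj I₁ I₂ hI F hF ⟶ restrictObj I₁ I₂ hI G hG) (X : C) :
    onOverlap ((I₁.map F hF).tensor (I₂.map F hF)) (I₁.map F hF) (inverts_left _ _)
      ((unrestrMap φ.η₁).hom.app X) =
    onOverlap ((I₁.map F hF).tensor (I₂.map F hF)) (I₂.map F hF) (inverts_right _ _)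
      ((unrestrMap φ.η₂).hom.app X) := by
  let L := (I₁.map F hF).tensor (I₂.map F hF)
  have h₁ : (G.comp L.loc).Inverts I₁.toIdal :=
    .comp_of_map ((inverts_left (I₁.map F hF) (I₂.map F hF)).of_hom φ.f₁)
  have h₂ : (G.comp L.loc).Inverts I₂.toIdal :=
    .comp_of_map ((inverts_right (I₁.map F hF) (I₂.map F hF)).of_hom φ.f₂)
  have : IsIso (L.R.map (G.toFunctor.map ((I₁.tensor I₂).adj.unit.app X))) :=
    (I₁.tensor I₂).isIso_map_unit (h₁.tensor h₂) X
  rw [← cancel_mono (L.R.map (G.toFunctor.map ((I₁.tensor I₂).adj.unit.app X)))]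
  refine (onOverlap_naturality (L := L) (inverts_left _ _) (unrestrMap φ.η₁) _).symm.trans ?_
  refine Eq.trans ?_ (onOverlap_naturality (L := L) (inverts_right _ _) (unrestrMap φ.η₂) _)
  exact congrArg _ (onOverlap_unrestrMap_incl φ _)

lemma cancel_of_comp_eq_id {A : Type u₁} [Category.{v} A] {X Y Z : A} {p : X ⟶ Y} {p' : Y ⟶ X}
    (h : p' ≫ p = 𝟙 _) {f g : Y ⟶ Z} (e : p ≫ f = p ≫ g) : f = g := by
  simpa [reassoc_of% h] using p' ≫= e

lemma cancel_cIso {J J' : FPIdal D} {h : J.loc.Inverts J'.toIdal} {P : J.Loc} {B : D} {B' : J'.Loc}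
    {s t : P ⟶ J.R.obj B} {q : J'.R.obj B ⟶ B'} {q' : B' ⟶ J'.R.obj B} (hq : q ≫ q' = 𝟙 _)
    (e : s ≫ (cIso J J' h B).hom ≫ J.R.map (J'.incl.map q) =
      t ≫ (cIso J J' h B).hom ≫ J.R.map (J'.incl.map q)) : s = t := by
  have e' := e =≫ (J.R.map (J'.incl.map q') ≫ (cIso J J' h B).inv)
  simp only [Category.assoc] at e'
  rw [← Functor.map_comp_assoc, ← Functor.map_comp, hq] at e'
  simpa using e'

section

variable {I : FPIdal C} {f : (I.map F hF).toIdal ⟶ (I.map G hG).toIdal}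

/-- A morphism out of `F_I` is determined by its components at the objects `R_I X`, because every
local object is of this form up to isomorphism. -/
lemma unrestrMap_injective {η θ : restr F hF I ⟶ (restr G hG I).comp (pull f)}
    (h : ∀ X, (unrestrMap η).hom.app X = (unrestrMap θ).hom.app X) : η = θ := by
  have key (X : C) : η.hom.app (I.R.obj X) = θ.hom.app (I.R.obj X) :=
    cancel_of_comp_eq_id (iso_inv_hom_app (restrIso F hF I) X)
      ((unrestrMap_app η X).trans ((congrArg (· ≫ _) (h X)).trans (unrestrMap_app θ X).symm))
  ext M
  have h₁ := η.hom.naturality (dIso I M).hom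
  have h₂ := θ.hom.naturality (dIso I M).hom
  rw [key] at h₁
  rw [← cancel_epi ((restr F hF I).toFunctor.map (dIso I M).hom)]
  exact h₁.trans h₂.symm

lemma unrestrMap_restrMap (τ : F ⟶ G) (I : FPIdal C) (X : C) :
    (unrestrMap (restrMap hF hG τ I)).hom.app X = (I.map F hF).R.map (τ.hom.app X) := by
  have h := unrestrMap_app (restrMap hF hG τ I) X
  rw [restrMap_app] at h
  exact cancel_cIso (iso_hom_inv_app (restrIso G hG I) X) (h.symm.trans
    (restr_comm_aux _ (τ.hom.naturality (I.adj.unit.app X))))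

lemma restrMap_app_eq {τ : F ⟶ G} (hf : mapIdal hF hG τ I = f)
    (η : restr F hF I ⟶ (restr G hG I).comp (pull f))
    (h : ∀ X, (I.map F hF).R.map (τ.hom.app X) = (unrestrMap η).hom.app X) (M : I.Loc) :
    (restrMap hF hG τ I).hom.app M = η.hom.app M := by
  subst hf
  rw [unrestrMap_injective (η := restrMap hF hG τ I) (θ := η)
    fun X => (unrestrMap_restrMap τ I X).trans (h X)]

end

/-- Two morphisms of idals become equal after a localization which inverts the target. -/
lemma FPIdal.R_map_idal_eq (J : FPIdal D) {K K' : Idal D} (h : J.loc.Inverts K') (f g : K ⟶ K') :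
    J.R.map f.hom = J.R.map g.hom := by
  have : IsIso (J.R.map K'.hom) := h
  rw [← cancel_mono (J.R.map K'.hom), ← Functor.map_comp, ← Functor.map_comp, f.w, g.w]

instance restrict_faithful (I₁ I₂ : FPIdal C) (hI : I₁.toIdal.IsCover I₂.toIdal) :
    (restrict I₁ I₂ hI D).Faithful where
  map_injective {F G} σ τ h := by
    have key : σ.hom = τ.hom := by
      ext X
      refine hom_ext_of_isCover (hI.map F.obj) (J₁ := I₁.map F.obj F.property)
        (J₂ := I₂.map F.obj F.property) ?_ ?_
      · exact (unrestrMap_restrMap σ.hom I₁ X).symm.trans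
          ((congrArg (fun φ : restrictObj I₁ I₂ hI F.obj F.property ⟶
            restrictObj I₁ I₂ hI G.obj G.property => (unrestrMap φ.η₁).hom.app X) h).trans
              (unrestrMap_restrMap τ.hom I₁ X))
      · exact (unrestrMap_restrMap σ.hom I₂ X).symm.trans
          ((congrArg (fun φ : restrictObj I₁ I₂ hI F.obj F.property ⟶
            restrictObj I₁ I₂ hI G.obj G.property => (unrestrMap φ.η₂).hom.app X) h).trans
              (unrestrMap_restrMap τ.hom I₂ X))
    exact InducedCategory.hom_ext key

instance restrict_full (I₁ I₂ : FPIdal C) (hI : I₁.toIdal.IsCover I₂.toIdal) :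
    (restrict I₁ I₂ hI D).Full where
  map_surjective {F G} φ := by
    let φ' : restrictObj I₁ I₂ hI F.obj F.property ⟶ restrictObj I₁ I₂ hI G.obj G.property := φ
    obtain ⟨τ, h₁, h₂⟩ := exists_hom_of_localizations (J₁ := I₁.map F.obj F.property)
      (J₂ := I₂.map F.obj F.property) (hI.map F.obj) (isMeet_tensor _ _) (unrestrMap φ'.η₁)
      (unrestrMap φ'.η₂) (onOverlap_unrestrMap φ')
    -- The morphisms of idals agree locally: at their own idal because the target is inverted there, at
    -- the other one by the compatibility of `φ` with the isomorphisms `π`.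
    have hf₁ : mapIdal F.property G.property τ I₁ = φ'.f₁ := by
      refine Idal.Hom.ext (hom_ext_of_isCover (hI.map F.obj) (J₁ := I₁.map F.obj F.property)
        (J₂ := I₂.map F.obj F.property) ?_ ?_)
      · exact R_map_idal_eq _ ((loc_inverts _).of_hom φ'.f₁) _ _
      · exact (h₂ _).trans (cancel_cIso (iso_hom_inv_app (restrIso G.obj G.property I₂) I₁.obj)
          ((unrestrMap_app φ'.η₂ I₁.obj).symm.trans φ'.comm₂))
    have hf₂ : mapIdal F.property G.property τ I₂ = φ'.f₂ := by
      refine Idal.Hom.ext (hom_ext_of_isCover (hI.map F.obj) (J₁ := I₁.map F.obj F.property)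
        (J₂ := I₂.map F.obj F.property) ?_ ?_)
      · exact (h₁ _).trans (cancel_cIso (iso_hom_inv_app (restrIso G.obj G.property I₁) I₂.obj)
          ((unrestrMap_app φ'.η₁ I₂.obj).symm.trans φ'.comm₁))
      · exact R_map_idal_eq _ ((loc_inverts _).of_hom φ'.f₂) _ _
    exact ⟨ObjectProperty.homMk τ, LocalDatum.hom_ext_aux hf₁ hf₂ (restrMap_app_eq hf₁ _ h₁)
      (restrMap_app_eq hf₂ _ h₂)⟩

end FullyFaithful

/-! ### Pullbacks of lax monoidal functors -/

section PullbackLax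

open Functor.LaxMonoidal

variable {C : Type u₁} [Category.{v} C] [MonoidalCategory C]
  {D : Type u₂} [Category.{v} D] [MonoidalCategory D]

/-- A functor with morphisms `ε` and `μ` as in the definition of a lax monoidal functor, a priori
without any axioms. -/
structure PreLax (F : C ⥤ D) where
  unitHom : 𝟙_ D ⟶ F.obj (𝟙_ C)
  tensorMap : ∀ X Y : C, F.obj X ⊗ F.obj Y ⟶ F.obj (X ⊗ Y)

namespace PreLax

variable {F : C ⥤ D} (s : PreLax F)

/-- A transformation to a lax monoidal functor which is compatible with `ε` and `μ`. -/
structure Compat {A : C ⥤ D} [A.LaxMonoidal] (p : F ⟶ A) : Prop where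
  unit : s.unitHom ≫ p.app (𝟙_ C) = ε A
  tensor : ∀ X Y, s.tensorMap X Y ≫ p.app (X ⊗ Y) = (p.app X ⊗ₘ p.app Y) ≫ μ A X Y

variable {s} {A : C ⥤ D} [A.LaxMonoidal] {p : F ⟶ A} (h : s.Compat p)

include h

lemma Compat.natural_left {X Y : C} (f : X ⟶ Y) (X' : C) :
    (F.map f ▷ F.obj X' ≫ s.tensorMap Y X') ≫ p.app _ =
      (s.tensorMap X X' ≫ F.map (f ▷ X')) ≫ p.app _ := by
  rw [Category.assoc, Category.assoc, h.tensor, p.naturality, reassoc_of% h.tensor X X',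
    ← μ_natural_left, ← tensorHom_id, ← tensorHom_id, tensorHom_comp_tensorHom_assoc,
    tensorHom_comp_tensorHom_assoc, p.naturality]
  simp

lemma Compat.natural_right {X Y : C} (X' : C) (f : X ⟶ Y) :
    (F.obj X' ◁ F.map f ≫ s.tensorMap X' Y) ≫ p.app _ =
      (s.tensorMap X' X ≫ F.map (X' ◁ f)) ≫ p.app _ := by
  rw [Category.assoc, Category.assoc, h.tensor, p.naturality, reassoc_of% h.tensor X' X,
    ← μ_natural_right, ← id_tensorHom, ← id_tensorHom, tensorHom_comp_tensorHom_assoc,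
    tensorHom_comp_tensorHom_assoc, p.naturality]
  simp

lemma Compat.associativity (X Y Z : C) :
    (s.tensorMap X Y ▷ F.obj Z ≫ s.tensorMap (X ⊗ Y) Z ≫ F.map (α_ X Y Z).hom) ≫ p.app _ =
      ((α_ (F.obj X) (F.obj Y) (F.obj Z)).hom ≫ F.obj X ◁ s.tensorMap Y Z ≫
        s.tensorMap X (Y ⊗ Z)) ≫ p.app _ := by
  have h₁ : s.tensorMap X Y ▷ F.obj Z ≫ (p.app (X ⊗ Y) ⊗ₘ p.app Z) =
      ((p.app X ⊗ₘ p.app Y) ⊗ₘ p.app Z) ≫ μ A X Y ▷ A.obj Z := by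
    rw [← tensorHom_id, tensorHom_comp_tensorHom, h.tensor, ← tensorHom_id,
      tensorHom_comp_tensorHom]
    simp
  have h₂ : F.obj X ◁ s.tensorMap Y Z ≫ (p.app X ⊗ₘ p.app (Y ⊗ Z)) =
      (p.app X ⊗ₘ (p.app Y ⊗ₘ p.app Z)) ≫ A.obj X ◁ μ A Y Z := by
    rw [← id_tensorHom, tensorHom_comp_tensorHom, h.tensor, ← id_tensorHom,
      tensorHom_comp_tensorHom]
    simp
  simp only [Category.assoc]
  rw [p.naturality, reassoc_of% h.tensor (X ⊗ Y) Z, reassoc_of% h₁, h.tensor, reassoc_of% h₂,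
    Functor.LaxMonoidal.associativity, associator_naturality_assoc]

lemma Compat.left_unitality (X : C) :
    (λ_ (F.obj X)).hom ≫ p.app X =
      (s.unitHom ▷ F.obj X ≫ s.tensorMap (𝟙_ C) X ≫ F.map (λ_ X).hom) ≫ p.app X := by
  have h₁ : s.unitHom ▷ F.obj X ≫ (p.app (𝟙_ C) ⊗ₘ p.app X) = _ ◁ p.app X ≫ ε A ▷ A.obj X := by
    rw [← h.unit, ← tensorHom_id, tensorHom_comp_tensorHom, ← tensorHom_id, ← id_tensorHom,
      tensorHom_comp_tensorHom]
    simp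
  simp only [Category.assoc]
  rw [p.naturality, reassoc_of% h.tensor, reassoc_of% h₁, ← Functor.LaxMonoidal.left_unitality,
    leftUnitor_naturality]

lemma Compat.right_unitality (X : C) :
    (ρ_ (F.obj X)).hom ≫ p.app X =
      (F.obj X ◁ s.unitHom ≫ s.tensorMap X (𝟙_ C) ≫ F.map (ρ_ X).hom) ≫ p.app X := by
  have h₁ : F.obj X ◁ s.unitHom ≫ (p.app X ⊗ₘ p.app (𝟙_ C)) = p.app X ▷ _ ≫ A.obj X ◁ ε A := by
    rw [← h.unit, ← id_tensorHom, tensorHom_comp_tensorHom, ← tensorHom_id, ← id_tensorHom,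
      tensorHom_comp_tensorHom]
    simp
  simp only [Category.assoc]
  rw [p.naturality, reassoc_of% h.tensor, reassoc_of% h₁, ← Functor.LaxMonoidal.right_unitality,
    rightUnitor_naturality]

omit h

/-- If two compatible transformations are jointly monic, then `ε` and `μ` define a lax monoidal
structure. -/
@[reducible] def laxMonoidal {A' : C ⥤ D} [A'.LaxMonoidal] {p' : F ⟶ A'} (h : s.Compat p)
    (h' : s.Compat p') (mono : ∀ {T : D} {X : C} {f g : T ⟶ F.obj X}, f ≫ p.app X = g ≫ p.app X →
      f ≫ p'.app X = g ≫ p'.app X → f = g) : F.LaxMonoidal where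
  ε := s.unitHom
  μ := s.tensorMap
  μ_natural_left f X' := mono (h.natural_left f X') (h'.natural_left f X')
  μ_natural_right X' f := mono (h.natural_right X' f) (h'.natural_right X' f)
  associativity X Y Z := mono (h.associativity X Y Z) (h'.associativity X Y Z)
  left_unitality X := mono (h.left_unitality X) (h'.left_unitality X)
  right_unitality X := mono (h.right_unitality X) (h'.right_unitality X)

lemma Compat.braided [BraidedCategory C] [BraidedCategory D] {A : C ⥤ D} [A.LaxBraided] {p : F ⟶ A}
    (h : s.Compat p) (X Y : C) : (s.tensorMap X Y ≫ F.map (β_ X Y).hom) ≫ p.app _ =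
      ((β_ (F.obj X) (F.obj Y)).hom ≫ s.tensorMap Y X) ≫ p.app _ := by
  simp only [Category.assoc]
  rw [p.naturality, reassoc_of% h.tensor, h.tensor, Functor.LaxBraided.braided,
    BraidedCategory.braiding_naturality_assoc]

end PreLax

/-- A pointwise pullback of lax monoidal functors carries induced morphisms `ε` and `μ`. -/
lemma exists_preLax {A₁ A₂ Q P : C ⥤ D} [A₁.LaxMonoidal] [A₂.LaxMonoidal] [Q.LaxMonoidal]
    {a₁ : A₁ ⟶ Q} {a₂ : A₂ ⟶ Q} [NatTrans.IsMonoidal a₁] [NatTrans.IsMonoidal a₂]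
    {p₁ : P ⟶ A₁} {p₂ : P ⟶ A₂}
    (sq : ∀ X, IsPullback (p₁.app X) (p₂.app X) (a₁.app X) (a₂.app X)) :
    ∃ s : PreLax P, s.Compat p₁ ∧ s.Compat p₂ := by
  have key (X Y : C) : ((p₁.app X ⊗ₘ p₁.app Y) ≫ μ A₁ X Y) ≫ a₁.app (X ⊗ Y) =
      ((p₂.app X ⊗ₘ p₂.app Y) ≫ μ A₂ X Y) ≫ a₂.app (X ⊗ Y) := by
    rw [Category.assoc, Category.assoc, NatTrans.IsMonoidal.tensor, NatTrans.IsMonoidal.tensor,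
      tensorHom_comp_tensorHom_assoc, tensorHom_comp_tensorHom_assoc, (sq X).w, (sq Y).w]
  have key' : ε A₁ ≫ a₁.app (𝟙_ C) = ε A₂ ≫ a₂.app (𝟙_ C) := by
    rw [NatTrans.IsMonoidal.unit, NatTrans.IsMonoidal.unit]
  exact ⟨⟨(sq _).lift _ _ key', fun X Y => (sq _).lift _ _ (key X Y)⟩,
    ⟨(sq _).lift_fst _ _ key', fun X Y => (sq _).lift_fst _ _ (key X Y)⟩,
    ⟨(sq _).lift_snd _ _ key', fun X Y => (sq _).lift_snd _ _ (key X Y)⟩⟩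

/-- A lax braided functor whose structure morphisms are isomorphisms is braided. -/
@[reducible] noncomputable def braidedOfIsIso [BraidedCategory C] [BraidedCategory D] (F : C ⥤ D)
    [F.LaxBraided] (h₁ : IsIso (ε F)) (h₂ : ∀ X Y, IsIso (μ F X Y)) : F.Braided where
  toMonoidal :=
    { toLaxMonoidal := inferInstance
      toOplaxMonoidal := (Functor.CoreMonoidal.ofLaxMonoidal F).toOplaxMonoidal
      ε_η := (Functor.CoreMonoidal.ofLaxMonoidal F).toMonoidal.ε_η
      η_ε := (Functor.CoreMonoidal.ofLaxMonoidal F).toMonoidal.η_ε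
      μ_δ := (Functor.CoreMonoidal.ofLaxMonoidal F).toMonoidal.μ_δ
      δ_μ := (Functor.CoreMonoidal.ofLaxMonoidal F).toMonoidal.δ_μ }
  braided := Functor.LaxBraided.braided (F := F)

end PullbackLax

/-! ### Monoidal transformations and the localization adjunction -/

section Transpose

open Functor.LaxMonoidal

variable {D : Type u₂} [Category.{v} D] [MonoidalCategory D] [SymmetricCategory D]
  [LFPTensorCategory D]

namespace FPIdal

/-- A morphism `t : R_L A ⟶ Q` which is compatible with unit morphisms has a transpose `A ⟶ Q`
which is compatible with them. -/
lemma unit_ε {L : FPIdal D} {A : D} {e : 𝟙_ D ⟶ A} {Q : L.Loc} {q : 𝟙_ L.Loc ⟶ Q}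
    {t : L.R.obj A ⟶ Q} (h : (ε L.R ≫ L.R.map e) ≫ t = q) :
    e ≫ L.adj.unit.app A ≫ L.incl.map t = ε L.incl ≫ L.incl.map q := by
  have := (inferInstance : L.adj.IsMonoidal)
  have h₀ := NatTrans.IsMonoidal.unit (τ := L.adj.unit)
  rw [← h, Category.assoc, Functor.map_comp, Functor.map_comp]
  have h₁ : ε L.incl ≫ L.incl.map (ε L.R) = L.adj.unit.app (𝟙_ D) := by
    rw [← Functor.LaxMonoidal.comp_ε, ← h₀]
    simp
  rw [reassoc_of% h₁]
  exact (reassoc_of% L.unit_naturality e) _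

/-- Morphisms `R_L A ⟶ Q` which are compatible with a multiplication have transposes `A ⟶ Q` which
are compatible with it. -/
lemma unit_μ {L : FPIdal D} {A B P : D} {m : A ⊗ B ⟶ P} {Q Q' S : L.Loc} {q : Q ⊗ Q' ⟶ S}
    {t : L.R.obj A ⟶ Q} {t' : L.R.obj B ⟶ Q'} {t'' : L.R.obj P ⟶ S}
    (h : (μ L.R A B ≫ L.R.map m) ≫ t'' = (t ⊗ₘ t') ≫ q) :
    m ≫ L.adj.unit.app P ≫ L.incl.map t'' =
      ((L.adj.unit.app A ≫ L.incl.map t) ⊗ₘ (L.adj.unit.app B ≫ L.incl.map t')) ≫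
        μ L.incl Q Q' ≫ L.incl.map q := by
  have := (inferInstance : L.adj.IsMonoidal)
  have h₀ := NatTrans.IsMonoidal.tensor (τ := L.adj.unit) A B
  have h₁ : (L.adj.unit.app A ⊗ₘ L.adj.unit.app B) ≫ μ L.incl _ _ ≫ L.incl.map (μ L.R A B) =
      L.adj.unit.app (A ⊗ B) := by
    rw [← Functor.LaxMonoidal.comp_μ]
    refine h₀.symm.trans ?_
    simp
  have h₂ : ((L.adj.unit.app A ≫ L.incl.map t) ⊗ₘ (L.adj.unit.app B ≫ L.incl.map t')) =
      (L.adj.unit.app A ⊗ₘ L.adj.unit.app B) ≫ (L.incl.map t ⊗ₘ L.incl.map t') :=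
    (tensorHom_comp_tensorHom ..).symm
  rw [h₂, Category.assoc, μ_natural_assoc, ← Functor.map_comp, ← h, Category.assoc,
    Functor.map_comp, Functor.map_comp]
  erw [reassoc_of% h₁]
  exact (reassoc_of% L.unit_naturality m) _

lemma counit_naturality (J : FPIdal D) {M N : J.Loc} (f : M ⟶ N) :
    J.R.map (J.incl.map f) ≫ J.adj.counit.app N = J.adj.counit.app M ≫ f :=
  J.adj.counit.naturality f

/-- The converse of `unit_ε`: the transpose of a morphism compatible with unit morphisms is
compatible with them. -/
lemma ε_counit {J : FPIdal D} {A : D} {e : 𝟙_ D ⟶ A} {M : J.Loc} {p : A ⟶ J.incl.obj M}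
    {q : 𝟙_ J.Loc ⟶ M} (h : e ≫ p = ε J.incl ≫ J.incl.map q) :
    (ε J.R ≫ J.R.map e) ≫ J.R.map p ≫ J.adj.counit.app M = q := by
  rw [Category.assoc, ← Functor.map_comp_assoc, h, Functor.map_comp_assoc,
    counit_naturality, Adjunction.map_ε_comp_counit_app_unit_assoc,
    Functor.Monoidal.ε_η_assoc]

/-- The converse of `unit_μ`: transposes of morphisms compatible with a multiplication are compatible
with it. -/
lemma μ_counit {J : FPIdal D} {A B P : D} {m : A ⊗ B ⟶ P} {M N S : J.Loc} {q : M ⊗ N ⟶ S}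
    {p : A ⟶ J.incl.obj M} {p' : B ⟶ J.incl.obj N} {p'' : P ⟶ J.incl.obj S}
    (h : m ≫ p'' = (p ⊗ₘ p') ≫ μ J.incl M N ≫ J.incl.map q) :
    (μ J.R A B ≫ J.R.map m) ≫ J.R.map p'' ≫ J.adj.counit.app S =
      ((J.R.map p ≫ J.adj.counit.app M) ⊗ₘ (J.R.map p' ≫ J.adj.counit.app N)) ≫ q := by
  rw [Category.assoc, ← Functor.map_comp_assoc, h, Functor.map_comp_assoc,
    Functor.map_comp_assoc, ← μ_natural_assoc,
    counit_naturality, Adjunction.map_μ_comp_counit_app_tensor_assoc,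
    Functor.Monoidal.μ_δ_assoc, tensorHom_comp_tensorHom_assoc]

end FPIdal

end Transpose

/-! ### Descent for tensor functors -/

section Glue

open Functor.LaxMonoidal FPIdal

variable {C : Type u₁} [Category.{v} C] [MonoidalCategory C] [SymmetricCategory C]
  {D : Type u₂} [Category.{v} D] [MonoidalCategory D] [SymmetricCategory D] [LFPTensorCategory D]

/-- For `G : C ⟶ D_J`, the transformation from `G` to `Q : C ⟶ D_L`, both considered as functors
to `D`, which corresponds to a transformation `θ` from the composition of `G` with `D_J ⟶ D_L` to
`Q`. -/
noncomputable def leg {L J : FPIdal D} {h : L.loc.Inverts J.toIdal} {G : TensorFunctor C J.Loc}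
    {Q : TensorFunctor C L.Loc} (θ : G.comp (trans L J h) ⟶ Q) :
    G.toFunctor ⋙ J.incl ⟶ Q.toFunctor ⋙ L.incl where
  app X := L.adj.unit.app (J.incl.obj (G.toFunctor.obj X)) ≫ L.incl.map (θ.hom.app X)
  naturality X Y g := by
    have h₁ := L.unit_naturality (J.incl.map (G.toFunctor.map g))
    have h₂ := congrArg L.incl.map (θ.hom.naturality g)
    rw [Functor.map_comp, Functor.map_comp] at h₂
    exact ((reassoc_of% h₁) _).trans ((congrArg (_ ≫ ·) h₂).trans (Category.assoc _ _ _).symm)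

instance {L J : FPIdal D} {h : L.loc.Inverts J.toIdal} {G : TensorFunctor C J.Loc}
    {Q : TensorFunctor C L.Loc} (θ : G.comp (trans L J h) ⟶ Q) : NatTrans.IsMonoidal (leg θ) where
  unit := by
    have h₁ := NatTrans.IsMonoidal.unit (τ := θ.hom)
    refine unit_ε (t := θ.hom.app (𝟙_ C)) (Eq.trans ?_ h₁)
    refine congrArg (· ≫ _) ?_
    exact (congrArg (ε L.R ≫ ·) (L.R.map_comp _ _)).trans (Category.assoc _ _ _).symm
  tensor X Y := by
    have h₁ := NatTrans.IsMonoidal.tensor (τ := θ.hom) X Y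
    refine unit_μ (t := θ.hom.app X) (t' := θ.hom.app Y) (t'' := θ.hom.app (X ⊗ Y))
      (Eq.trans ?_ h₁)
    refine congrArg (· ≫ _) ?_
    exact (congrArg (μ L.R _ _ ≫ ·) (L.R.map_comp _ _)).trans (Category.assoc _ _ _).symm

lemma localEquiv_leg {L J : FPIdal D} {h : L.loc.Inverts J.toIdal} {G : TensorFunctor C J.Loc}
    {Q : TensorFunctor C L.Loc} (θ : G.comp (trans L J h) ≅ Q) (X : C) :
    L.localEquiv ((leg θ.hom).app X) := by
  have : IsIso (θ.hom.hom.app X) := ⟨θ.inv.hom.app X, iso_hom_inv_app θ X, iso_inv_hom_app θ X⟩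
  have : IsIso (L.incl.map (θ.hom.hom.app X)) := Functor.map_isIso L.incl _
  exact localEquiv_comp (L.localEquiv_unit _) (L.localEquiv_of_isIso (L.incl.map (θ.hom.hom.app X)))

namespace FPIdal

lemma unit_incl_map_comp (L : FPIdal D) {A B : D} {Q : L.Loc} (p : A ⟶ B) (t : L.R.obj B ⟶ Q) :
    L.adj.unit.app A ≫ L.incl.map (L.R.map p ≫ t) = p ≫ L.adj.unit.app B ≫ L.incl.map t := by
  rw [Functor.map_comp]
  exact ((reassoc_of% L.unit_naturality p) _).symm

/-- The transpose `R_J A ⟶ M` of `p : A ⟶ M` becomes `R_L p` after localization at `L`. -/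
lemma cIso_transpose (L J : FPIdal D) (hJ : L.loc.Inverts J.toIdal) {A : D} {M : J.Loc}
    (p : A ⟶ J.incl.obj M) :
    (cIso L J hJ A).hom ≫ L.R.map (J.incl.map (J.R.map p ≫ J.adj.counit.app M)) = L.R.map p := by
  rw [Functor.map_comp, Functor.map_comp, map_R L J hJ]
  simp only [Category.assoc, Iso.hom_inv_id_assoc]
  rw [← map_dIso_inv L J hJ, ← Functor.map_comp, ← J.incl.map_comp]
  have : (dIso J M).inv ≫ J.adj.counit.app M = 𝟙 _ := (dIso J M).inv_hom_id
  rw [this]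
  simp

lemma localEquiv_ε_incl (J : FPIdal D) : J.localEquiv (ε J.incl) := by
  have : ε J.incl = J.adj.unit.app _ ≫ J.incl.map (Functor.OplaxMonoidal.η J.R) :=
    Adjunction.IsMonoidal.leftAdjoint_ε (adj := J.adj)
  rw [this]
  exact localEquiv_comp (J.localEquiv_unit _) (J.localEquiv_of_isIso _)

lemma localEquiv_μ_incl (J : FPIdal D) (M N : J.Loc) : J.localEquiv (μ J.incl M N) := by
  have : μ J.incl M N = J.adj.unit.app _ ≫ J.incl.map (Functor.OplaxMonoidal.δ J.R _ _ ≫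
      (J.adj.counit.app M ⊗ₘ J.adj.counit.app N)) :=
    Adjunction.IsMonoidal.leftAdjoint_μ (adj := J.adj) M N
  rw [this]
  exact localEquiv_comp (J.localEquiv_unit _) (J.localEquiv_of_isIso _)

end FPIdal

section

variable {J : FPIdal D} {G : TensorFunctor C J.Loc} {P : C ⥤ D} {p : P ⟶ G.toFunctor ⋙ J.incl}
  (hp : ∀ X, J.localEquiv (p.app X))

include hp

/-- The unit morphism of a functor is locally an isomorphism if the functor is compatibly localized
to a tensor functor. -/
lemma localEquiv_unitHom {s : PreLax P} (hs : s.Compat p) : J.localEquiv s.unitHom := by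
  refine localEquiv_of_postcomp (hp _) ?_
  rw [hs.unit, Functor.LaxMonoidal.comp_ε]
  exact localEquiv_comp J.localEquiv_ε_incl (J.localEquiv_of_isIso _)

/-- The analogue of `localEquiv_unitHom` for the multiplication. -/
lemma localEquiv_tensorMap {s : PreLax P} (hs : s.Compat p) (X Y : C) :
    J.localEquiv (s.tensorMap X Y) := by
  refine localEquiv_of_postcomp (hp _) ?_
  rw [hs.tensor, Functor.LaxMonoidal.comp_μ]
  exact localEquiv_comp (J.localEquiv.tensorHom_mem _ _ (hp X) (hp Y))
    (localEquiv_comp (J.localEquiv_μ_incl _ _) (J.localEquiv_of_isIso _))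

/-- If `p : P ⟶ G` is a pointwise localization, then `R_J ∘ P ≅ G`. -/
noncomputable def transposeIso : P ⋙ J.R ≅ G.toFunctor :=
  NatIso.ofComponents (fun X =>
    have := (J.localEquiv_iff_isIso_R _).1 (hp X)
    asIso (J.R.map (p.app X) ≫ J.adj.counit.app (G.toFunctor.obj X))) fun {X Y} g => by
      have h₁ := congrArg J.R.map (p.naturality g)
      rw [Functor.map_comp, Functor.map_comp] at h₁
      refine ((reassoc_of% h₁) _).trans ?_
      refine Eq.trans ?_ (Category.assoc _ _ _).symm
      exact congrArg (_ ≫ ·) (counit_naturality J (G.toFunctor.map g))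

end

/-- If `d` becomes a colimit cocone after localization, then the comparison from the colimit to `d`
is inverted by the localization. -/
lemma localEquiv_desc_of_isColimit_mapCocone {J : FPIdal D} {K : Type v} [Category.{v} K]
    {F : K ⥤ D} {c d : Cocone F} (hc : IsColimit c) (hd : IsColimit (J.R.mapCocone d)) :
    J.localEquiv (hc.desc d) := by
  rw [localEquiv_iff_isIso_R]
  have hc' := isColimitOfPreserves J.R hc
  have : J.R.map (hc.desc d) = (hc'.coconePointUniqueUpToIso hd).hom := by
    refine hc'.hom_ext fun k => ?_
    rw [IsColimit.comp_coconePointUniqueUpToIso_hom]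
    refine (J.R.map_comp _ _).symm.trans (congrArg J.R.map (hc.fac d k))
  rw [this]
  infer_instance

/-- A functor is cocontinuous if it is so locally with respect to an idal cover. -/
lemma preservesColimits_of_isCover {J₁ J₂ : FPIdal D} (h : J₁.toIdal.IsCover J₂.toIdal)
    (P : C ⥤ D) [PreservesColimitsOfSize.{v, v} (P ⋙ J₁.R)]
    [PreservesColimitsOfSize.{v, v} (P ⋙ J₂.R)] : PreservesColimitsOfSize.{v, v} P := by
  have := LFPTensorCategory.locallyFinitelyPresentable (C := D)
  refine ⟨fun {K} _ => ⟨fun {F} => ⟨fun {c} hc => ⟨?_⟩⟩⟩⟩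
  have hd := colimit.isColimit (F ⋙ P)
  have h₁ : J₁.localEquiv (hd.desc (P.mapCocone c)) :=
    localEquiv_desc_of_isColimit_mapCocone hd (isColimitOfPreserves (P ⋙ J₁.R) hc)
  have h₂ : J₂.localEquiv (hd.desc (P.mapCocone c)) :=
    localEquiv_desc_of_isColimit_mapCocone hd (isColimitOfPreserves (P ⋙ J₂.R) hc)
  have := isIso_of_localEquiv_of_isCover h h₁ h₂
  exact IsColimit.ofPointIso hd

open Cardinal in
attribute [local instance] fact_isRegular_aleph0 in
/-- Descent for tensor functors: cocontinuous tensor functors `C ⟶ D_{J₁}` and `C ⟶ D_{J₂}` which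
agree on the overlap are glued to a cocontinuous tensor functor `C ⟶ D`. -/
lemma exists_glue {J₁ J₂ L : FPIdal D} (h : J₁.toIdal.IsCover J₂.toIdal) (hL : IsMeet J₁ J₂ L)
    (G₁ : TensorFunctor C J₁.Loc) (G₂ : TensorFunctor C J₂.Loc)
    (h₁ : TensorFunctor.preservesFP G₁) (h₂ : TensorFunctor.preservesFP G₂)
    (θ : G₁.comp (trans L J₁ hL.left) ≅ G₂.comp (trans L J₂ hL.right)) :
    ∃ (H : TensorFunctor C D) (_ : TensorFunctor.preservesFP H) (ψ₁ : H.comp J₁.loc ≅ G₁)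
      (ψ₂ : H.comp J₂.loc ≅ G₂), ∀ X,
        (cIso L J₁ hL.left (H.toFunctor.obj X)).hom ≫
          L.R.map (J₁.incl.map (ψ₁.hom.hom.app X)) ≫ θ.hom.hom.app X =
        (cIso L J₂ hL.right (H.toFunctor.obj X)).hom ≫
          L.R.map (J₂.incl.map (ψ₂.hom.hom.app X)) := by
  have := LFPTensorCategory.locallyFinitelyPresentable (C := D)
  have := hasPullbacks_of_locallyFinitelyPresentable D
  -- The functor is the pullback of the two given ones over their common value on the overlap, for
  -- which the one obtained from `G₂` is chosen.
  let a₁ := leg θ.hom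
  let a₂ := leg (𝟙 (G₂.comp (trans L J₂ hL.right)))
  let P : C ⥤ D := pullback a₁ a₂
  let p₁ : P ⟶ G₁.toFunctor ⋙ J₁.incl := pullback.fst a₁ a₂
  let p₂ : P ⟶ G₂.toFunctor ⋙ J₂.incl := pullback.snd a₁ a₂
  have sq (X : C) : IsPullback (p₁.app X) (p₂.app X) (a₁.app X) (a₂.app X) :=
    (IsPullback.of_hasPullback a₁ a₂).map ((evaluation C D).obj X)
  have hp₁ (X : C) : J₁.localEquiv (p₁.app X) :=
    hL.localEquiv_fst (sq X) (isLocal_incl _) (isLocal_incl _) (localEquiv_leg (Iso.refl _) X)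
  have hp₂ (X : C) : J₂.localEquiv (p₂.app X) :=
    hL.localEquiv_snd (sq X) (isLocal_incl _) (isLocal_incl _) (localEquiv_leg θ X)
  obtain ⟨s, hs₁, hs₂⟩ := exists_preLax sq
  let lax : P.LaxMonoidal := s.laxMonoidal hs₁ hs₂ ((sq _).hom_ext)
  let lax' : P.LaxBraided :=
    { braided := fun X Y => (sq _).hom_ext (hs₁.braided X Y) (hs₂.braided X Y) }
  let H : TensorFunctor C D :=
    { toFunctor := P
      braided := braidedOfIsIso P
        (isIso_of_localEquiv_of_isCover h (localEquiv_unitHom hp₁ hs₁) (localEquiv_unitHom hp₂ hs₂))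
        fun X Y => isIso_of_localEquiv_of_isCover h (localEquiv_tensorMap hp₁ hs₁ X Y)
          (localEquiv_tensorMap hp₂ hs₂ X Y)
      cocontinuous :=
        have := preservesColimits_of_natIso (transposeIso hp₁).symm
        have := preservesColimits_of_natIso (transposeIso hp₂).symm
        preservesColimits_of_isCover h P }
  let ψ₁ : H.comp J₁.loc ≅ G₁ := TensorFunctor.isoMk (transposeIso hp₁)
    ⟨ε_counit hs₁.unit, fun X Y => μ_counit (hs₁.tensor X Y)⟩
  let ψ₂ : H.comp J₂.loc ≅ G₂ := TensorFunctor.isoMk (transposeIso hp₂)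
    ⟨ε_counit hs₂.unit, fun X Y => μ_counit (hs₂.tensor X Y)⟩
  refine ⟨H, fun X hX => isFinitelyPresentable_of_isCover h ?_ ?_, ψ₁, ψ₂, fun X => ?_⟩
  · have := h₁ X hX
    exact isCardinalPresentable_of_iso ((transposeIso hp₁).symm.app X) ℵ₀
  · have := h₂ X hX
    exact isCardinalPresentable_of_iso ((transposeIso hp₂).symm.app X) ℵ₀
  -- The commutativity of the pullback square, transposed along the localization at `L`.
  · have e := (sq X).w
    have e' : L.R.map (p₁.app X) ≫ θ.hom.hom.app X = L.R.map (p₂.app X) ≫ 𝟙 _ := by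
      apply L.unit_incl_map_injective
      exact (unit_incl_map_comp L _ _).trans (e.trans (unit_incl_map_comp L _ _).symm)
    rw [Category.comp_id] at e'
    have k₁ := cIso_transpose L J₁ hL.left (p₁.app X)
    have k₂ := cIso_transpose L J₂ hL.right (p₂.app X)
    exact (Category.assoc _ _ _).symm.trans ((congrArg (· ≫ _) k₁).trans (e'.trans k₂.symm))

end Glue

/-! ### Comparison of a glued tensor functor with a local datum -/

section GlueDatum

open Functor.LaxMonoidal FPIdal

variable {C : Type u₁} [Category.{v} C] [MonoidalCategory C] [SymmetricCategory C]
  [LFPTensorCategory C]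
  {D : Type u₂} [Category.{v} D] [MonoidalCategory D] [SymmetricCategory D] [LFPTensorCategory D]

/-- The isomorphism of tensor functors `C ⟶ D_{J₁ ⊗ J₂}` underlying the isomorphism `δ` of a local
datum. -/
noncomputable def LocalDatum.overlapIso {I₁ I₂ : FPIdal C} (X : LocalDatum I₁ I₂ D) :
    (I₁.loc.comp X.H₁).comp (trans (X.J₁.tensor X.J₂) X.J₁ (inverts_left _ _)) ≅
      (I₂.loc.comp X.H₂).comp (trans (X.J₁.tensor X.J₂) X.J₂ (inverts_right _ _)) :=
  TensorFunctor.assoc _ _ _ ≪≫ (I₁.tensor I₂).liftIso (path _ (inverts_left _ _) X.H₁)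
      ((path_inverts_self _ _ _).tensor (path_inverts_other _ _ (inverts_right _ _) _ X.π₁)) ≪≫
    (I₁.tensor I₂).loc.whiskerLeftIso X.δ ≪≫
      ((I₁.tensor I₂).liftIso (path _ (inverts_right _ _) X.H₂)
        ((path_inverts_other _ _ (inverts_left _ _) _ X.π₂).tensor
          (path_inverts_self _ _ _))).symm ≪≫ (TensorFunctor.assoc _ _ _).symm

lemma overlapIso_aux {A : Type u₁} [Category.{v} A] {X₁ X₂ Y₁ Y₂ : A} {a : X₁ ⟶ Y₁} {b : X₂ ⟶ Y₂}
    {b' : Y₂ ⟶ X₂} (hb : b ≫ b' = 𝟙 _) {d : X₁ ⟶ X₂} {d' : Y₁ ⟶ Y₂} (e : a ≫ d' = d ≫ b) :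
    𝟙 _ ≫ a ≫ d' ≫ b' ≫ 𝟙 _ = d := by
  rw [reassoc_of% e, reassoc_of% hb]
  simp

/-- On local objects `overlapIso` is the given `δ`: the two isomorphisms are related through the
unit, which at a local object is the isomorphism `M ≅ R M`. -/
lemma LocalDatum.overlapIso_hom_app {I₁ I₂ : FPIdal C} (X : LocalDatum I₁ I₂ D)
    (M : (I₁.tensor I₂).Loc) :
    X.overlapIso.hom.hom.app ((I₁.tensor I₂).incl.obj M) = X.δ.hom.hom.app M := by
  have h := X.δ.hom.hom.naturality (dIso (I₁.tensor I₂) M).inv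
  have h' (P : C ⥤ (X.J₁.tensor X.J₂).Loc) : P.map ((I₁.tensor I₂).incl.map (dIso _ M).inv) =
      P.map ((I₁.tensor I₂).adj.unit.app ((I₁.tensor I₂).incl.obj M)) :=
    congrArg P.map (incl_dIso_inv _ M)
  refine overlapIso_aux (iso_hom_inv_app ((I₁.tensor I₂).liftIso
    (path _ (inverts_right _ _) X.H₂) _) _) ?_
  exact (congrArg (· ≫ _) (h' (path _ (inverts_left _ _) X.H₁).toFunctor)).symm.trans
    (h.trans (congrArg (_ ≫ ·) (h' (path _ (inverts_right _ _) X.H₂).toFunctor)))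

namespace FPIdal

/-- Isomorphisms of idals are glued from isomorphisms of their localizations. -/
lemma exists_idalIso {J₁ J₂ L : FPIdal D} (h : J₁.toIdal.IsCover J₂.toIdal) (hL : IsMeet J₁ J₂ L)
    {K K' : Idal D} (hK' : L.loc.Inverts K') (t₁ : J₁.R.obj K.obj ≅ J₁.R.obj K'.obj)
    (w₁ : t₁.hom ≫ J₁.R.map K'.hom = J₁.R.map K.hom) (t₂ : J₂.R.obj K.obj ≅ J₂.R.obj K'.obj)
    (w₂ : t₂.hom ≫ J₂.R.map K'.hom = J₂.R.map K.hom) :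
    ∃ f : K ≅ K', J₁.R.map f.hom.hom = t₁.hom ∧ J₂.R.map f.hom.hom = t₂.hom := by
  have : IsIso (L.R.map K'.hom) := hK'
  have w (J : FPIdal D) (hJ : L.loc.Inverts J.toIdal) (t : J.R.obj K.obj ≅ J.R.obj K'.obj)
      (w : t.hom ≫ J.R.map K'.hom = J.R.map K.hom) :
      onOverlap L J hJ t.hom ≫ L.R.map K'.hom = L.R.map K.hom := by
    rw [← onOverlap_comp_R_map, w, onOverlap_R_map]
  obtain ⟨f, hf₁, hf₂⟩ := exists_hom_of_isCover h hL t₁.hom t₂.hom (by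
    rw [← cancel_mono (L.R.map K'.hom), w J₁ _ _ w₁, w J₂ _ _ w₂])
  have : IsIso f := isIso_of_localEquiv_of_isCover h
    ((J₁.localEquiv_iff_isIso_R f).2 (by rw [hf₁]; infer_instance))
    ((J₂.localEquiv_iff_isIso_R f).2 (by rw [hf₂]; infer_instance))
  have hf : f ≫ K'.hom = K.hom := hom_ext_of_isCover h
    (by rw [Functor.map_comp, hf₁, w₁]) (by rw [Functor.map_comp, hf₂, w₂])
  exact ⟨⟨⟨f, hf⟩, ⟨inv f, by rw [← hf, IsIso.inv_hom_id_assoc]⟩,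
    Idal.Hom.ext (IsIso.hom_inv_id f), Idal.Hom.ext (IsIso.inv_hom_id f)⟩, hf₁, hf₂⟩

/-- Two idals become isomorphic after a localization which inverts both. -/
lemma exists_iso_of_inverts (J : FPIdal D) {K K' : Idal D} (h : J.loc.Inverts K)
    (h' : J.loc.Inverts K') :
    ∃ t : J.R.obj K.obj ≅ J.R.obj K'.obj, t.hom ≫ J.R.map K'.hom = J.R.map K.hom := by
  have h₁ : IsIso (J.R.map K.hom) := h
  have h₂ : IsIso (J.R.map K'.hom) := h'
  exact ⟨asIso (J.R.map K.hom) ≪≫ (asIso (J.R.map K'.hom)).symm, by simp⟩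

/-- An isomorphism between the localizations of idals, where the structure morphism of `K.map J.R`
ends with the isomorphism `R_J 𝟙 ≅ 𝟙`, which is removed here. -/
lemma exists_iso_of_idalIso (J : FPIdal D) {K K' : Idal D} (e : K.map J.R ≅ K'.map J.R) :
    ∃ t : J.R.obj K.obj ≅ J.R.obj K'.obj, t.hom ≫ J.R.map K'.hom = J.R.map K.hom ∧
      t.hom = e.hom.hom := by
  let t : J.R.obj K.obj ≅ J.R.obj K'.obj := ⟨e.hom.hom, e.inv.hom,
    congrArg Idal.Hom.hom e.hom_inv_id, congrArg Idal.Hom.hom e.inv_hom_id⟩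
  have ht : t.hom ≫ J.R.map K'.hom ≫ Functor.OplaxMonoidal.η J.R =
    J.R.map K.hom ≫ Functor.OplaxMonoidal.η J.R := e.hom.w
  exact ⟨t, by rwa [← Category.assoc, cancel_mono] at ht, rfl⟩

end FPIdal

/-- The identity functor is a left unit. -/
def TensorFunctor.leftUnitor (F : TensorFunctor C D) : (TensorFunctor.id C).comp F ≅ F :=
  isoMk (Functor.leftUnitor F.toFunctor)
    (inferInstanceAs (NatTrans.IsMonoidal (Functor.leftUnitor F.toFunctor).hom))

section

variable {H : TensorFunctor C D} {hH : TensorFunctor.preservesFP H} {I : FPIdal C} {J : FPIdal D}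
  {H' : TensorFunctor I.Loc J.Loc} (ψ : H.comp J.loc ≅ I.loc.comp H')
  (f : (I.map H hH).toIdal ⟶ J.toIdal)

/-- The morphism `H_I ⟶ f^* H'` induced by an isomorphism `R_J ∘ H ≅ H' ∘ R_I`. -/
noncomputable def compareMap : restr H hH I ⟶ H'.comp (pull f) :=
  I.liftMap (H.whiskerLeft (transIso (I.map H hH) J ((I.map H hH).loc_inverts.of_hom f)).hom ≫
      (TensorFunctor.assoc _ _ _).inv ≫ TensorFunctor.whiskerRight ψ.hom (pull f) ≫
        (TensorFunctor.assoc _ _ _).hom) _ (I.loc_inverts.comp _) ≫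
    (I.liftCompIso I.loc I.loc_inverts (H'.comp (pull f)) _).hom ≫
      TensorFunctor.whiskerRight (transId I I.loc_inverts).hom (H'.comp (pull f)) ≫
        (TensorFunctor.leftUnitor _).hom

lemma compareMap_aux {A : Type u₁} [Category.{v} A] {X Y Z W : A} (a : X ⟶ Y) (b : Y ⟶ Z)
    (c : Z ⟶ W) : (a ≫ 𝟙 _ ≫ b ≫ 𝟙 _) ≫ 𝟙 _ ≫ c ≫ 𝟙 _ = a ≫ b ≫ c := by simp

lemma compareMap_app (M : I.Loc) : (compareMap ψ f).hom.app M =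
    (cIso (I.map H hH) J ((I.map H hH).loc_inverts.of_hom f) (H.toFunctor.obj (I.incl.obj M))).hom ≫
      (I.map H hH).R.map (J.incl.map (ψ.hom.hom.app (I.incl.obj M))) ≫
      (I.map H hH).R.map (J.incl.map (H'.toFunctor.map (I.adj.counit.app M))) := by
  exact compareMap_aux _ _ _

lemma isIso_compareMap_app (M : I.Loc) : IsIso ((compareMap ψ f).hom.app M) := by
  have h₁ : IsIso (ψ.hom.hom.app (I.incl.obj M)) :=
    ⟨ψ.inv.hom.app _, iso_hom_inv_app ψ _, iso_inv_hom_app ψ _⟩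
  have key {J' J : FPIdal D} (h : J'.loc.Inverts J.toIdal) {B : D} {N P : J.Loc}
      {a : J.R.obj B ⟶ N} {b : N ⟶ P} (_ : IsIso a) (_ : IsIso b) :
      IsIso ((cIso J' J h B).hom ≫ J'.R.map (J.incl.map a) ≫ J'.R.map (J.incl.map b)) := by
    infer_instance
  have h₂ : IsIso (I.adj.counit.app M) := inferInstance
  have h₃ : IsIso (H'.toFunctor.map (I.adj.counit.app M)) := Functor.map_isIso _ _
  rw [compareMap_app]
  exact key _ h₁ h₃

lemma compareMap_R_aux {J' J : FPIdal D} (h : J'.loc.Inverts J.toIdal) {A B : D} {M N : J.Loc}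
    {a : A ⟶ B} {p : J.R.obj A ⟶ M} {q : J.R.obj B ⟶ N} {b : M ⟶ N} {c : N ⟶ M}
    (e : J.R.map a ≫ q = p ≫ b) (hb : b ≫ c = 𝟙 _) :
    J'.R.map a ≫ (cIso J' J h B).hom ≫ J'.R.map (J.incl.map q) ≫ J'.R.map (J.incl.map c) =
      (cIso J' J h A).hom ≫ J'.R.map (J.incl.map p) := by
  have h₁ : J'.R.map a ≫ (cIso J' J h B).hom =
      (cIso J' J h A).hom ≫ J'.R.map (J.incl.map (J.R.map a)) := by
    rw [map_R J' J h, Iso.hom_inv_id_assoc]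
  rw [reassoc_of% h₁, ← Functor.map_comp_assoc, ← J.incl.map_comp, e, ← Functor.map_comp,
    ← J.incl.map_comp, Category.assoc, hb, Category.comp_id]

/-- The characterizing property of `compareMap`: under the canonical isomorphism
`R_{H(I)} H ≅ H_I R_I` it corresponds to `ψ`. -/
lemma restrIso_compareMap (X : C) :
    (restrIso H hH I).hom.hom.app X ≫ (compareMap ψ f).hom.app (I.R.obj X) =
      (cIso (I.map H hH) J ((I.map H hH).loc_inverts.of_hom f) (H.toFunctor.obj X)).hom ≫
        (I.map H hH).R.map (J.incl.map (ψ.hom.hom.app X)) := by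
  rw [compareMap_app]
  refine compareMap_R_aux _ (ψ.hom.hom.naturality (I.adj.unit.app X)) ?_
  refine (H'.toFunctor.map_comp _ _).symm.trans ?_
  exact (congrArg H'.toFunctor.map (I.adj.left_triangle_components X)).trans (H'.toFunctor.map_id _)

lemma restrPath_compare_aux {I' J L L' : FPIdal D} (h' : L'.loc.Inverts I'.toIdal)
    (h : L.loc.Inverts J.toIdal) (hI : I'.loc.Inverts J.toIdal) (hL : L'.loc.Inverts L.toIdal)
    (hLJ : L'.loc.Inverts J.toIdal) {A A' : D} {M : J.Loc} {a : A ⟶ A'}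
    {s : I'.R.obj A' ⟶ I'.R.obj (J.incl.obj M)} {p : J.R.obj A ⟶ M}
    (e : I'.R.map a ≫ s = (cIso I' J hI A).hom ≫ I'.R.map (J.incl.map p)) :
    ((cIso L' I' h' A).hom ≫ L'.R.map (I'.incl.map (I'.R.map a))) ≫
        L'.R.map (I'.incl.map s) ≫ (cIso L' I' h' _).inv ≫ (cIso L' L hL (J.incl.obj M)).hom =
      (cIso L' L hL A).hom ≫ L'.R.map (L.incl.map
        ((cIso L J h A).hom ≫ L.R.map (J.incl.map p))) := by
  have e' := congrArg (fun x => L'.R.map (I'.incl.map x)) e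
  simp only [Functor.map_comp] at e'
  simp only [Functor.map_comp, Category.assoc]
  rw [reassoc_of% e', map_R L' I' h' (J.incl.map p), map_cIso_hom L' I' J h' hI hLJ,
    map_cIso_hom L' L J hL h hLJ, map_R L' L hL (J.incl.map p)]
  simp only [Category.assoc, Iso.hom_inv_id_assoc]

/-- The compatibility of `compareMap` with the localization at the overlap. -/
lemma restrPath_compareMap {L L' : FPIdal D} (g : L'.toIdal ⟶ L.toIdal)
    (h' : L'.loc.Inverts (I.map H hH).toIdal) (h : L.loc.Inverts J.toIdal) (X : C) :
    (restrPathIso H hH I L' h').hom.hom.app X ≫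
        (pathMap h' h f g (compareMap ψ f)).hom.app X =
      (cIso L' L (L'.loc_inverts.of_hom g) (H.toFunctor.obj X)).hom ≫
        L'.R.map (L.incl.map ((cIso L J h (H.toFunctor.obj X)).hom ≫
          L.R.map (J.incl.map (ψ.hom.hom.app X)))) := by
  rw [restrPathIso_hom_app, pathMap_app]
  exact restrPath_compare_aux h' h _ _ (h'.of_hom f) (restrIso_compareMap ψ f X)

end

end GlueDatum

/-! ### Isomorphisms of local data -/

section InvertLocalDatum

open FPIdal

variable {C : Type u₁} [Category.{v} C] [MonoidalCategory C] [SymmetricCategory C]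
  [LFPTensorCategory C]
  {D : Type u₂} [Category.{v} D] [MonoidalCategory D] [SymmetricCategory D] [LFPTensorCategory D]

variable {I : FPIdal C} {J J' : FPIdal D}

/-- The morphism `H' ⟶ g^* H` inverse to a pointwise isomorphism `η : H ⟶ f^* H'`, where `g` is
the inverse of `f`. -/
noncomputable def pullInv {H : TensorFunctor I.Loc J.Loc} {H' : TensorFunctor I.Loc J'.Loc}
    {f : J.toIdal ⟶ J'.toIdal} (η : H ≅ H'.comp (pull f)) (g : J'.toIdal ⟶ J.toIdal) :
    H' ⟶ H.comp (pull g) :=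
  pullId H' ≫ H'.whiskerLeft (transComp J' J J' _ (J.loc_inverts.of_hom f) _).inv ≫
    (TensorFunctor.assoc _ _ _).inv ≫ TensorFunctor.whiskerRight η.inv (pull g)

lemma pullInv_app {H : TensorFunctor I.Loc J.Loc} {H' : TensorFunctor I.Loc J'.Loc}
    {f : J.toIdal ⟶ J'.toIdal} (η : H ≅ H'.comp (pull f)) (g : J'.toIdal ⟶ J.toIdal) (M : I.Loc) :
    (pullInv η g).hom.app M = (dIso J' (H'.toFunctor.obj M)).inv ≫
      (cIso J' J (J'.loc_inverts.of_hom g) (J'.incl.obj (H'.toFunctor.obj M))).hom ≫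
        J'.R.map (J.incl.map (η.inv.hom.app M)) := by
  have e {A : Type u₂} [Category.{v} A] {X Y Z W : A} (a : X ⟶ Y) (b : Y ⟶ Z) (c : Z ⟶ W) :
    a ≫ b ≫ 𝟙 _ ≫ c = a ≫ b ≫ c := by simp
  refine (e _ _ _).trans ((congrArg (· ≫ _) (pullId_app H' M)).trans ?_)
  exact congrArg (fun x => _ ≫ x ≫ _) (transComp_inv_app' ..)

/-- A pointwise isomorphism of tensor functors is an isomorphism. -/
noncomputable def TensorFunctor.isoOfIsIso {A : Type u₁} [Category.{v} A] [MonoidalCategory A]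
    [SymmetricCategory A] {B : Type u₂} [Category.{v} B] [MonoidalCategory B] [SymmetricCategory B]
    {F G : TensorFunctor A B} (τ : F ⟶ G) (h : ∀ X, IsIso (τ.hom.app X)) : F ≅ G :=
  have : IsIso τ.hom := NatIso.isIso_of_isIso_app _
  isoMk (asIso τ.hom) τ.isMonoidal

lemma comp_pullInv_aux {M : J.Loc} {M' : J'.Loc} (h : J.loc.Inverts J'.toIdal)
    (h' : J'.loc.Inverts J.toIdal) (hJ : J.loc.Inverts J.toIdal)
    {η : M ⟶ J.R.obj (J'.incl.obj M')} {θ : J.R.obj (J'.incl.obj M') ⟶ M} (e : η ≫ θ = 𝟙 _) :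
    η ≫ J.R.map (J'.incl.map ((dIso J' M').inv ≫ (cIso J' J h' (J'.incl.obj M')).hom ≫
      J'.R.map (J.incl.map θ))) ≫ (cIso J J' h (J.incl.obj M)).inv = (dIso J M).inv := by
  simp only [Functor.map_comp, Category.assoc]
  rw [map_dIso_inv J J' h, map_cIso_hom J J' J h h' hJ, map_R J J' h]
  simp only [Category.assoc, Iso.hom_inv_id_assoc, Iso.hom_inv_id, Category.comp_id]
  rw [← dIso_inv_R, dIso_inv_naturality, reassoc_of% e]

/-- If the localizations at `L` and `L'` invert each other's idals, then the comparison functor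
between them is faithful. -/
lemma trans_faithful_of_inverts {L L' : FPIdal D} (h' : L'.loc.Inverts L.toIdal) {M N : L'.Loc}
    {a b : M ⟶ N} (e : L.R.map (L'.incl.map a) = L.R.map (L'.incl.map b)) : a = b := by
  have e' := congrArg (fun x => L'.R.map (L.incl.map x)) e
  simp only [map_R L' L h'] at e'
  simp only [Iso.cancel_iso_inv_left, cancel_mono] at e'
  rw [← cancel_mono (dIso L' N).inv, ← dIso_inv_naturality, e', dIso_inv_naturality]

/-- The inverse morphism is compatible with the isomorphisms `π`. -/
lemma comm_inv_aux {A A' : D} {M : J.Loc} {M' : J'.Loc} (h : J.loc.Inverts J'.toIdal)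
    (h' : J'.loc.Inverts J.toIdal) {f : A ⟶ A'} {g : A' ⟶ A} (hfg : f ≫ g = 𝟙 _)
    (hgf : g ≫ f = 𝟙 _)
    {p : J.R.obj A ⟶ M} {p' : J'.R.obj A' ⟶ M'} {η : M ⟶ J.R.obj (J'.incl.obj M')}
    {θ : M' ⟶ J'.R.obj (J.incl.obj M)}
    (hη : η ≫ J.R.map (J'.incl.map θ) ≫ (cIso J J' h (J.incl.obj M)).inv = (dIso J M).inv)
    (e : p ≫ η = J.R.map f ≫ (cIso J J' h A').hom ≫ J.R.map (J'.incl.map p')) :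
    p' ≫ θ = J'.R.map g ≫ (cIso J' J h' A).hom ≫ J'.R.map (J.incl.map p) := by
  apply trans_faithful_of_inverts h'
  have : IsIso (J.R.map f) := ⟨J.R.map g, by rw [← Functor.map_comp, hfg]; simp,
    by rw [← Functor.map_comp, hgf]; simp⟩
  rw [← cancel_epi (J.R.map f ≫ (cIso J J' h A').hom), ← cancel_mono (cIso J J' h _).inv]
  simp only [Functor.map_comp, Category.assoc]
  rw [← reassoc_of% e, hη, map_R J J' h g, map_cIso_hom J J' J h h' J.loc_inverts,
    map_R J J' h (J.incl.map p)]
  simp only [Category.assoc, Iso.hom_inv_id_assoc, Iso.hom_inv_id, Category.comp_id]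
  rw [← Functor.map_comp_assoc, hfg]
  simp only [CategoryTheory.Functor.map_id, Category.id_comp]
  rw [← dIso_inv_R, dIso_inv_naturality]

/-- The inverse morphism is compatible with the isomorphisms `δ`. -/
lemma comm_inv_aux' {L L' : FPIdal D} {A B : L.Loc} {A' B' : L'.Loc} (h : L.loc.Inverts L'.toIdal)
    (h' : L'.loc.Inverts L.toIdal) {δ : A ⟶ B} {δ' : A' ⟶ B'}
    {a : A ⟶ L.R.obj (L'.incl.obj A')} {b : B ⟶ L.R.obj (L'.incl.obj B')}
    {a' : A' ⟶ L'.R.obj (L.incl.obj A)} {b' : B' ⟶ L'.R.obj (L.incl.obj B)} (ha : IsIso a)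
    (haa : a ≫ L.R.map (L'.incl.map a') ≫ (cIso L L' h (L.incl.obj A)).inv = (dIso L A).inv)
    (hbb : b ≫ L.R.map (L'.incl.map b') ≫ (cIso L L' h (L.incl.obj B)).inv = (dIso L B).inv)
    (e : δ ≫ b = a ≫ L.R.map (L'.incl.map δ')) :
    δ' ≫ b' = a' ≫ L'.R.map (L.incl.map δ) := by
  apply trans_faithful_of_inverts h'
  rw [← cancel_epi a, ← cancel_mono (cIso L L' h _).inv]
  simp only [Functor.map_comp, Category.assoc]
  rw [← reassoc_of% e, hbb, map_R L L' h (L.incl.map δ)]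
  simp only [Category.assoc, Iso.hom_inv_id, Category.comp_id]
  rw [reassoc_of% haa, dIso_inv_naturality]

/-- `pullInv η` is a right inverse of `η`, for the composition of morphisms of local data. -/
lemma comp_pullInv {H : TensorFunctor I.Loc J.Loc} {H' : TensorFunctor I.Loc J'.Loc}
    {f : J.toIdal ⟶ J'.toIdal} (η : H ≅ H'.comp (pull f)) (g : J'.toIdal ⟶ J.toIdal) (M : I.Loc) :
    η.hom.hom.app M ≫ J.R.map (J'.incl.map ((pullInv η g).hom.app M)) ≫
      (cIso J J' (J.loc_inverts.of_hom f) (J.incl.obj (H.toFunctor.obj M))).inv =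
      (dIso J (H.toFunctor.obj M)).inv := by
  rw [pullInv_app]
  exact comp_pullInv_aux _ _ J.loc_inverts (iso_hom_inv_app η M)

/-- `pullInv η` is a left inverse of `η`, for the composition of morphisms of local data. -/
lemma pullInv_comp {H : TensorFunctor I.Loc J.Loc} {H' : TensorFunctor I.Loc J'.Loc}
    {f : J.toIdal ⟶ J'.toIdal} (η : H ≅ H'.comp (pull f)) (g : J'.toIdal ⟶ J.toIdal) (M : I.Loc) :
    (pullInv η g).hom.app M ≫ J'.R.map (J.incl.map (η.hom.hom.app M)) ≫
      (cIso J' J (J'.loc_inverts.of_hom g) (J'.incl.obj (H'.toFunctor.obj M))).inv =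
      (dIso J' (H'.toFunctor.obj M)).inv := by
  have key {M : J.Loc} {M' : J'.Loc} (h' : J'.loc.Inverts J.toIdal)
    {η : M ⟶ J.R.obj (J'.incl.obj M')} {θ : J.R.obj (J'.incl.obj M') ⟶ M} (e : θ ≫ η = 𝟙 _) :
    ((dIso J' M').inv ≫ (cIso J' J h' (J'.incl.obj M')).hom ≫
      J'.R.map (J.incl.map θ)) ≫ J'.R.map (J.incl.map η) ≫ (cIso J' J h' (J'.incl.obj M')).inv =
      (dIso J' M').inv := by
    simp only [Category.assoc]
    rw [← Functor.map_comp_assoc, ← Functor.map_comp, e]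
    simp
  rw [pullInv_app]
  exact key _ (iso_inv_hom_app η M)

/-- `comp_pullInv` after localization at the overlap. -/
lemma pathMap_comp_pullInv {L L' : FPIdal D} (h : L.loc.Inverts J.toIdal)
    (h' : L'.loc.Inverts J'.toIdal) {H : TensorFunctor I.Loc J.Loc}
    {H' : TensorFunctor I.Loc J'.Loc} {f : J.toIdal ⟶ J'.toIdal} (η : H ≅ H'.comp (pull f))
    (g : J'.toIdal ⟶ J.toIdal) (k : L.toIdal ⟶ L'.toIdal) (k' : L'.toIdal ⟶ L.toIdal) (X : C) :
    (pathMap h h' f k η.hom).hom.app X ≫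
      L.R.map (L'.incl.map ((pathMap h' h g k' (pullInv η g)).hom.app X)) ≫
        (cIso L L' (L.loc_inverts.of_hom k) (L.incl.obj ((path L h H).toFunctor.obj X))).inv =
      (dIso L ((path L h H).toFunctor.obj X)).inv := by
  rw [pathMap_app, pathMap_app]
  refine (pathMap_comp_aux h h' (J.loc_inverts.of_hom f) (L.loc_inverts.of_hom k)
    (L'.loc_inverts.of_hom k') L.loc_inverts (h.of_hom f) _ _).symm.trans ?_
  refine Eq.trans ?_ (pathMap_id_aux h L.loc_inverts (H.toFunctor.obj (I.R.obj X)))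
  exact congrArg (fun x => L.R.map (J.incl.map x) ≫ _) (comp_pullInv η g (I.R.obj X))

lemma isIso_pathMap_app {L L' : FPIdal D} (h : L.loc.Inverts J.toIdal)
    (h' : L'.loc.Inverts J'.toIdal) {H : TensorFunctor I.Loc J.Loc}
    {H' : TensorFunctor I.Loc J'.Loc} {f : J.toIdal ⟶ J'.toIdal} (η : H ≅ H'.comp (pull f))
    (k : L.toIdal ⟶ L'.toIdal) (X : C) : IsIso ((pathMap h h' f k η.hom).hom.app X) := by
  have key {M : J.Loc} {A : D} (h₂ : L.loc.Inverts L'.toIdal) {t : M ⟶ J.R.obj A} (_ : IsIso t) :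
      IsIso (L.R.map (J.incl.map t) ≫ (cIso L J h A).inv ≫ (cIso L L' h₂ A).hom) := by
    infer_instance
  rw [pathMap_app]
  exact key _ ⟨η.inv.hom.app _, iso_hom_inv_app η _, iso_inv_hom_app η _⟩

/-- The inverse of a morphism of local data whose components are isomorphisms. -/
noncomputable def LocalDatum.invHom {I₁ I₂ : FPIdal C} {X Y : LocalDatum I₁ I₂ D}
    (φ : LocalDatum.Hom X Y)
    (g₁ : X.J₁.toIdal ≅ Y.J₁.toIdal) (hg₁ : g₁.hom = φ.f₁)
    (g₂ : X.J₂.toIdal ≅ Y.J₂.toIdal) (hg₂ : g₂.hom = φ.f₂)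
    (η₁ : X.H₁ ≅ Y.H₁.comp (pull φ.f₁)) (hη₁ : η₁.hom = φ.η₁)
    (η₂ : X.H₂ ≅ Y.H₂.comp (pull φ.f₂)) (hη₂ : η₂.hom = φ.η₂) : LocalDatum.Hom Y X where
  f₁ := g₁.inv
  f₂ := g₂.inv
  η₁ := pullInv η₁ g₁.inv
  η₂ := pullInv η₂ g₂.inv
  comm₁ := by
    have h := φ.comm₁
    rw [← hg₂, ← hη₁] at h
    exact comm_inv_aux (X.J₁.loc_inverts.of_hom φ.f₁) (Y.J₁.loc_inverts.of_hom g₁.inv)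
      (congrArg Idal.Hom.hom g₂.hom_inv_id)
      (congrArg Idal.Hom.hom g₂.inv_hom_id) (comp_pullInv η₁ g₁.inv _) h
  comm₂ := by
    have h := φ.comm₂
    rw [← hg₁, ← hη₂] at h
    exact comm_inv_aux (X.J₂.loc_inverts.of_hom φ.f₂) (Y.J₂.loc_inverts.of_hom g₂.inv)
      (congrArg Idal.Hom.hom g₁.hom_inv_id)
      (congrArg Idal.Hom.hom g₁.inv_hom_id) (comp_pullInv η₂ g₂.inv _) h
  comm := by
    have h := φ.comm
    rw [← hη₁, ← hη₂] at h
    ext M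
    have h' := congrArg (fun t => t.hom.app M) h
    have h'' := (congrArg (_ ≫ ·) (glueMap₂_app _ _ _ _ _ M)).symm.trans
      (h'.trans (congrArg (· ≫ _) (glueMap₁_app _ _ _ _ _ M)))
    change Y.δ.hom.hom.app M ≫ (glueMap₂ _ _ _ _ _).hom.app M =
      (glueMap₁ _ _ _ _ _).hom.app M ≫
        (Y.J₁.tensor Y.J₂).R.map ((X.J₁.tensor X.J₂).incl.map (X.δ.hom.hom.app M))
    refine (congrArg (_ ≫ ·) (glueMap₂_app _ _ _ _ _ M)).trans
      (Eq.trans ?_ (congrArg (· ≫ _) (glueMap₁_app _ _ _ _ _ M).symm))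
    exact comm_inv_aux' _
      ((Y.J₁.tensor Y.J₂).loc_inverts.of_hom (FPIdal.tensorHom g₁.inv g₂.inv))
      (isIso_pathMap_app _ _ η₁ (FPIdal.tensorHom φ.f₁ φ.f₂) _)
      (pathMap_comp_pullInv (inverts_left _ _) (inverts_left _ _) η₁ g₁.inv
        (FPIdal.tensorHom φ.f₁ φ.f₂) (FPIdal.tensorHom g₁.inv g₂.inv) _)
      (pathMap_comp_pullInv (inverts_right _ _) (inverts_right _ _) η₂ g₂.inv
        (FPIdal.tensorHom φ.f₁ φ.f₂) (FPIdal.tensorHom g₁.inv g₂.inv) _) h''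

/-- A morphism of local data is an isomorphism if all its components are. -/
lemma LocalDatum.nonempty_iso {I₁ I₂ : FPIdal C} {X Y : LocalDatum I₁ I₂ D}
    (φ : LocalDatum.Hom X Y)
    (g₁ : X.J₁.toIdal ≅ Y.J₁.toIdal) (hg₁ : g₁.hom = φ.f₁)
    (g₂ : X.J₂.toIdal ≅ Y.J₂.toIdal) (hg₂ : g₂.hom = φ.f₂)
    (h₁ : ∀ M, IsIso (φ.η₁.hom.app M)) (h₂ : ∀ M, IsIso (φ.η₂.hom.app M)) : Nonempty (X ≅ Y) := by
  let η₁ := TensorFunctor.isoOfIsIso φ.η₁ h₁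
  let η₂ := TensorFunctor.isoOfIsIso φ.η₂ h₂
  let ψ := LocalDatum.invHom φ g₁ hg₁ g₂ hg₂ η₁ rfl η₂ rfl
  refine ⟨⟨φ, ψ, LocalDatum.hom_ext_aux ?_ ?_ (fun M => ?_) fun M => ?_,
    LocalDatum.hom_ext_aux ?_ ?_ (fun M => ?_) fun M => ?_⟩⟩
  · exact (congrArg (· ≫ _) hg₁.symm).trans g₁.hom_inv_id
  · exact (congrArg (· ≫ _) hg₂.symm).trans g₂.hom_inv_id
  · exact (pullComp_app φ.η₁ ψ.η₁ M).trans ((comp_pullInv η₁ g₁.inv M).trans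
      (pullId_app X.H₁ M).symm)
  · exact (pullComp_app φ.η₂ ψ.η₂ M).trans ((comp_pullInv η₂ g₂.inv M).trans
      (pullId_app X.H₂ M).symm)
  · exact (congrArg (_ ≫ ·) hg₁.symm).trans g₁.inv_hom_id
  · exact (congrArg (_ ≫ ·) hg₂.symm).trans g₂.inv_hom_id
  · exact (pullComp_app ψ.η₁ φ.η₁ M).trans ((pullInv_comp η₁ g₁.inv M).trans
      (pullId_app Y.H₁ M).symm)
  · exact (pullComp_app ψ.η₂ φ.η₂ M).trans ((pullInv_comp η₂ g₂.inv M).trans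
      (pullId_app Y.H₂ M).symm)

end InvertLocalDatum

/-! ### Essential surjectivity -/

section EssSurj

open FPIdal

variable {C : Type u₁} [Category.{v} C] [MonoidalCategory C] [SymmetricCategory C]
  [LFPTensorCategory C]
  {D : Type u₂} [Category.{v} D] [MonoidalCategory D] [SymmetricCategory D] [LFPTensorCategory D]

/-- The tensor functor glued from a local datum, with the compatibility on the overlap expressed in
terms of `δ`. -/
lemma exists_glue_datum {I₁ I₂ : FPIdal C} (X : LocalDatum I₁ I₂ D) :
    ∃ (H : TensorFunctor C D) (_ : TensorFunctor.preservesFP H)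
      (ψ₁ : H.comp X.J₁.loc ≅ I₁.loc.comp X.H₁) (ψ₂ : H.comp X.J₂.loc ≅ I₂.loc.comp X.H₂),
      ∀ M : (I₁.tensor I₂).Loc,
        ((cIso (X.J₁.tensor X.J₂) X.J₁ (inverts_left _ _)
          (H.toFunctor.obj ((I₁.tensor I₂).incl.obj M))).hom ≫
          (X.J₁.tensor X.J₂).R.map (X.J₁.incl.map
            (ψ₁.hom.hom.app ((I₁.tensor I₂).incl.obj M)))) ≫ X.δ.hom.hom.app M =
        (cIso (X.J₁.tensor X.J₂) X.J₂ (inverts_right _ _)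
          (H.toFunctor.obj ((I₁.tensor I₂).incl.obj M))).hom ≫
          (X.J₁.tensor X.J₂).R.map (X.J₂.incl.map
            (ψ₂.hom.hom.app ((I₁.tensor I₂).incl.obj M))) := by
  obtain ⟨H, hH, ψ₁, ψ₂, h⟩ := exists_glue X.cover (isMeet_tensor _ _) (I₁.loc.comp X.H₁)
    (I₂.loc.comp X.H₂) (fun Y hY => X.fp₁ _ (isFinitelyPresentable_R _ _ hY))
    (fun Y hY => X.fp₂ _ (isFinitelyPresentable_R _ _ hY)) X.overlapIso
  refine ⟨H, hH, ψ₁, ψ₂, fun M => ?_⟩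
  refine (congrArg (_ ≫ ·) (X.overlapIso_hom_app M)).symm.trans ?_
  exact (Category.assoc _ _ _).trans (h _)

lemma compare_comm_aux {J' J : FPIdal D} (h : J'.loc.Inverts J.toIdal) {A B : D} {M : J.Loc}
    {r : J'.R.obj A ⟶ J'.R.obj (J.incl.obj M)} {p : J.R.obj A ⟶ M} {q : J.R.obj B ⟶ M}
    {k : A ⟶ B} (e : r = (cIso J' J h A).hom ≫ J'.R.map (J.incl.map p))
    (hk : J.R.map k ≫ q = p) :
    r = J'.R.map k ≫ (cIso J' J h B).hom ≫ J'.R.map (J.incl.map q) := by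
  rw [e, ← hk, Functor.map_comp, Functor.map_comp, map_R J' J h]
  simp

lemma compare_comm_aux' {L L' : FPIdal D} (h : L'.loc.Inverts L.toIdal) {B : D}
    {A₁ A₂ : L.Loc} {A₁' A₂' : L'.Loc}
    {p₁ : L'.R.obj B ⟶ A₁'} {p₁' : A₁' ⟶ L'.R.obj B} (hp₁ : p₁' ≫ p₁ = 𝟙 _)
    {p₂ : L'.R.obj B ⟶ A₂'}
    {m₁ : A₁' ⟶ L'.R.obj (L.incl.obj A₁)} {m₂ : A₂' ⟶ L'.R.obj (L.incl.obj A₂)}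
    {x₁ : L.R.obj B ⟶ A₁} {x₂ : L.R.obj B ⟶ A₂} {δ : A₁ ⟶ A₂} (e : x₁ ≫ δ = x₂)
    (h₁ : p₁ ≫ m₁ = (cIso L' L h B).hom ≫ L'.R.map (L.incl.map x₁))
    (h₂ : p₂ ≫ m₂ = (cIso L' L h B).hom ≫ L'.R.map (L.incl.map x₂)) :
    (p₁' ≫ p₂) ≫ m₂ = m₁ ≫ L'.R.map (L.incl.map δ) := by
  have : m₁ = p₁' ≫ (cIso L' L h B).hom ≫ L'.R.map (L.incl.map x₁) := by
    rw [← h₁, reassoc_of% hp₁]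
  rw [this, Category.assoc, h₂, ← e, Functor.map_comp, Functor.map_comp]
  simp

lemma comp_eq_of_eq_comp {A : Type u₁} [Category.{v} A] {X Y Z : A} {a : X ⟶ Y} {p : X ⟶ Z}
    {b : Z ⟶ Y} {c : Y ⟶ Z} (h : a = p ≫ b) (e : b ≫ c = 𝟙 _) : a ≫ c = p := by
  rw [h, Category.assoc, e, Category.comp_id]

/-- Every local datum is isomorphic to the restriction of the tensor functor `H` glued from it.
The isomorphisms between the localizations of `H` and the given functors are recorded for the
linear case. -/
lemma exists_restrictObj_iso {I₁ I₂ : FPIdal C} (hI : I₁.toIdal.IsCover I₂.toIdal)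
    (X : LocalDatum I₁ I₂ D) :
    ∃ (H : TensorFunctor C D) (hH : TensorFunctor.preservesFP H),
      Nonempty (H.comp X.J₁.loc ≅ I₁.loc.comp X.H₁) ∧
      Nonempty (H.comp X.J₂.loc ≅ I₂.loc.comp X.H₂) ∧
      Nonempty (restrictObj I₁ I₂ hI H hH ≅ X) := by
  obtain ⟨H, hH, ψ₁, ψ₂, hψ⟩ := exists_glue_datum X
  have inv₁ : X.J₁.loc.Inverts (I₁.map H hH).toIdal :=
    ((I₁.loc_inverts.comp X.H₁).of_iso ψ₁.symm).of_comp
  have inv₂ : X.J₂.loc.Inverts (I₂.map H hH).toIdal :=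
    ((I₂.loc_inverts.comp X.H₂).of_iso ψ₂.symm).of_comp
  -- The localizations of `H(I₁)` and `J₁` are isomorphic at `J₁`, where both are inverted, and at
  -- `J₂` by means of `π₂`; similarly for `H(I₂)` and `J₂`.
  obtain ⟨t₁₁, w₁₁⟩ := X.J₁.exists_iso_of_inverts inv₁ X.J₁.loc_inverts
  obtain ⟨t₁₂, w₁₂, ht₁⟩ := X.J₂.exists_iso_of_idalIso
    (K := (I₁.map H hH).toIdal) (I₁.toIdal.mapSquareIso ψ₂ ≪≫ X.π₂.symm)
  obtain ⟨t₂₁, w₂₁, ht₂⟩ := X.J₁.exists_iso_of_idalIso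
    (K := (I₂.map H hH).toIdal) (I₂.toIdal.mapSquareIso ψ₁ ≪≫ X.π₁.symm)
  obtain ⟨t₂₂, w₂₂⟩ := X.J₂.exists_iso_of_inverts inv₂ X.J₂.loc_inverts
  obtain ⟨f₁, -, hf₁⟩ := exists_idalIso X.cover (isMeet_tensor _ _) (inverts_left _ _)
    t₁₁ w₁₁ t₁₂ w₁₂
  obtain ⟨f₂, hf₂, -⟩ := exists_idalIso X.cover (isMeet_tensor _ _) (inverts_right _ _)
    t₂₁ w₂₁ t₂₂ w₂₂
  let φ : LocalDatum.Hom (restrictObj I₁ I₂ hI H hH) X :=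
    { f₁ := f₁.hom
      f₂ := f₂.hom
      η₁ := compareMap ψ₁ f₁.hom
      η₂ := compareMap ψ₂ f₂.hom
      comm₁ := by
        exact compare_comm_aux _ (restrIso_compareMap ψ₁ f₁.hom I₂.obj)
          (comp_eq_of_eq_comp (hf₂.trans ht₂) (congrArg Idal.Hom.hom X.π₁.inv_hom_id))
      comm₂ := by
        exact compare_comm_aux _ (restrIso_compareMap ψ₂ f₂.hom I₁.obj)
          (comp_eq_of_eq_comp (hf₁.trans ht₁) (congrArg Idal.Hom.hom X.π₂.inv_hom_id))
      comm := by
        ext M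
        change (restrictObj I₁ I₂ hI H hH).δ.hom.hom.app M ≫ (glueMap₂ _ _ _ _ _).hom.app M =
          (glueMap₁ _ _ _ _ _).hom.app M ≫
            ((I₁.map H hH).tensor (I₂.map H hH)).R.map
              ((X.J₁.tensor X.J₂).incl.map (X.δ.hom.hom.app M))
        refine (congrArg (_ ≫ ·) (glueMap₂_app _ _ _ _ _ M)).trans
          (Eq.trans ?_ (congrArg (· ≫ _) (glueMap₁_app _ _ _ _ _ M).symm))
        exact compare_comm_aux' _
          (iso_inv_hom_app (restrPathIso H hH I₁ _ (inverts_left _ (I₂.map H hH))) _) (hψ M)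
          (restrPath_compareMap ψ₁ f₁.hom (FPIdal.tensorHom f₁.hom f₂.hom) _ _ _)
          (restrPath_compareMap ψ₂ f₂.hom (FPIdal.tensorHom f₁.hom f₂.hom) _ _ _) }
  obtain ⟨e⟩ := LocalDatum.nonempty_iso φ f₁ rfl f₂ rfl (isIso_compareMap_app ψ₁ f₁.hom)
    (isIso_compareMap_app ψ₂ f₂.hom)
  exact ⟨H, hH, ⟨ψ₁⟩, ⟨ψ₂⟩, ⟨e⟩⟩

instance restrict_essSurj (I₁ I₂ : FPIdal C) (hI : I₁.toIdal.IsCover I₂.toIdal) :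
    (restrict I₁ I₂ hI D).EssSurj where
  mem_essImage X := by
    obtain ⟨H, hH, -, -, ⟨e⟩⟩ := exists_restrictObj_iso hI X
    exact ⟨⟨H, hH⟩, ⟨e⟩⟩

end EssSurj

/-! ### Linear tensor functors -/

section Linear

open FPIdal

variable {C : Type u₁} [Category.{v} C] [MonoidalCategory C] [SymmetricCategory C]
  [LFPTensorCategory C]
  {D : Type u₂} [Category.{v} D] [MonoidalCategory D] [SymmetricCategory D] [LFPTensorCategory D]
  (K : Type w) [CommRing K] [Preadditive C] [Linear K C] [Preadditive D] [Linear K D]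

/-- A tensor functor is linear if it is so locally with respect to an idal cover. -/
lemma isLinear_of_isCover {I₁ I₂ : FPIdal C} {J₁ J₂ : FPIdal D}
    (h : J₁.toIdal.IsCover J₂.toIdal) {F : TensorFunctor C D} {H₁ : TensorFunctor I₁.Loc J₁.Loc}
    {H₂ : TensorFunctor I₂.Loc J₂.Loc} (ψ₁ : F.comp J₁.loc ≅ I₁.loc.comp H₁)
    (ψ₂ : F.comp J₂.loc ≅ I₂.loc.comp H₂) (h₁ : TensorFunctor.isLinear K H₁)
    (h₂ : TensorFunctor.isLinear K H₂) : TensorFunctor.isLinear K F := by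
  -- The functor `R_J ∘ F ≅ H ∘ R_I` is linear; the localizations are linear and jointly faithful.
  have key {I : FPIdal C} {J : FPIdal D} {H : TensorFunctor I.Loc J.Loc}
      (ψ : F.comp J.loc ≅ I.loc.comp H) (hH : TensorFunctor.isLinear K H) :
      (F.toFunctor ⋙ J.R).Additive ∧ (F.toFunctor ⋙ J.R).Linear K := by
    obtain ⟨_, _⟩ := hH
    let e : F.toFunctor ⋙ J.R ≅ I.R ⋙ H.toFunctor :=
      ⟨ψ.hom.hom, ψ.inv.hom, congrArg TensorFunctor.Hom.hom ψ.hom_inv_id,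
        congrArg TensorFunctor.Hom.hom ψ.inv_hom_id⟩
    have := Functor.additive_of_iso e.symm
    exact ⟨this, Functor.linear_of_iso K e.symm⟩
  obtain ⟨a₁, l₁⟩ := key ψ₁ h₁
  obtain ⟨a₂, l₂⟩ := key ψ₂ h₂
  refine ⟨⟨fun {X Y f g} => hom_ext_of_isCover h ?_ ?_⟩,
    ⟨fun {X Y} f r => hom_ext_of_isCover h ?_ ?_⟩⟩
  · exact a₁.map_add.trans J₁.R.map_add.symm
  · exact a₂.map_add.trans J₂.R.map_add.symm
  · exact (l₁.map_smul f r).trans (J₁.R.map_smul r _).symm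
  · exact (l₂.map_smul f r).trans (J₂.R.map_smul r _).symm

lemma restrictLinear_isEquivalence (I₁ I₂ : FPIdal C) (hI : I₁.toIdal.IsCover I₂.toIdal) :
    (restrictLinear K D I₁ I₂ hI).IsEquivalence := by
  let e : restrictLinear K D I₁ I₂ hI ⋙ ObjectProperty.ι _ ≅ ObjectProperty.ιOfLE
      (inf_le_left : TensorFunctor.preservesFP (C := C) (D := D) ⊓ TensorFunctor.isLinear K ≤ _) ⋙
      restrict I₁ I₂ hI D := Iso.refl _
  have h₁ := Functor.Faithful.of_comp_iso e
  have h₂ := Functor.Full.of_comp_faithful_iso e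
  have h₃ : (restrictLinear K D I₁ I₂ hI).EssSurj := by
    refine ⟨fun X => ?_⟩
    obtain ⟨H, hH, ⟨ψ₁⟩, ⟨ψ₂⟩, ⟨e⟩⟩ := exists_restrictObj_iso hI X.obj
    exact ⟨⟨H, hH, isLinear_of_isCover K X.obj.cover ψ₁ ψ₂ X.property.1 X.property.2⟩,
      ⟨ObjectProperty.isoMk _ e⟩⟩
  exact { }

end Linear

end TensorLoc

open TensorLoc

theorem mainTheorem7 {C : Type u₁} [Category.{v} C] [MonoidalCategory C] [SymmetricCategory C]
    [LFPTensorCategory C] {D : Type u₂} [Category.{v} D] [MonoidalCategory D]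
    [SymmetricCategory D] [LFPTensorCategory D] (I₁ I₂ : FPIdal C)
    (hI : I₁.toIdal.IsCover I₂.toIdal) :
    (restrict I₁ I₂ hI D).IsEquivalence ∧
    ∀ (K : Type w) [CommRing K] [Preadditive C] [Linear K C] [MonoidalPreadditive C]
      [MonoidalLinear K C] [Preadditive D] [Linear K D] [MonoidalPreadditive D]
      [MonoidalLinear K D],
      (restrictLinear K D I₁ I₂ hI).IsEquivalence :=
  ⟨{ }, fun K _ _ _ _ _ _ _ _ _ => restrictLinear_isEquivalence K I₁ I₂ hI⟩
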